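/- **Theorem.** Let $T$ be an ergodic unimodular random rooted tree (a probability measure on isomorphism classes of connected locally finite rooted graphs that satisfies the mass transport principle and gives probability $0$ or $1$ to every measurable set closed under change of root) which almost surely is a tree with exactly one end and with all degrees at most $d$. Put iid uniform $[0,1]$ labels on $V(T)$; a *factor of iid* (fiid) is a measurable rule that depends only on the isomorphism class of the labelled graph together with the vertices at which the rule is evaluated. Then there is an fiid rule that almost surely yields the following. 1. A subset $U\subseteq V(T)$ and oriented edges on $U$ coloured with three colours, such that this diagram on $U$ is isomorphic to the Cayley diagram of $\mathbb Z^3$ with respect to the standard generators. 2. Expand this copy of $\mathbb Z^3$ to $\mathbb R^3$ (that is, embed it as the standard integer lattice; the embedding is unique up to integer translations). A tiling $\mathcal P$ of this $\mathbb R^3$ and a graph isomorphism from $T$ to the adjacency graph of $\mathcal P$, i.e. a bijection $V(T)\to\mathcal P$ that, like its inverse, preserves adjacency. Here the elements of $\mathcal P$ (tiles) are pairwise disjoint connected open polytopes, their closures cover $\mathbb R^3$, every ball meets only finitely many of them, and two different tiles are adjacent if their closures share a two-dimensional piece of a face. That the tiling and the bijection are given by the rule means: for $u\in U$ and $v\in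 V(T)$, the tile of $v$, in the lattice coordinates in which $u$ is the origin, is a measurable isomorphism-invariant function of the labelled tree and $(u,v)$. 3. Moreover, call a set a *brick solid* if it is a finite union of nondegenerate closed axis-parallel bricks, and has connected interior and connected complement. Every tile is the interior of a brick solid with finitely many pairwise disjoint brick solids, contained in that interior (the holes), removed; and every ball of $\mathbb R^3$ is contained in a single brick that is the outer solid of some tile in this sense. -/

import Mathlib

open MeasureTheory Set
open scoped ENNReal

/-! ### Rooted (labelled) graphs up to isomorphism -/

/-- A connected locally finite graph. Such a graph is countable, so `Type` holds every one of them
up to isomorphism. -/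
structure LFGraph where
  V : Type
  graph : SimpleGraph V
  connected : graph.Connected
  locallyFinite : ∀ v, (graph.neighborSet v).Finite

/-- A connected locally finite graph with labels in `L` on the vertices and with an ordered
`k`-tuple of distinguished vertices (roots). -/
structure RootedLabelledGraph (L : Type) (k : ℕ) extends LFGraph where
  label : V → L
  root : Fin k → V

/-- Isomorphisms preserve adjacency, labels and roots. -/
def RootedLabelledGraph.Isomorphic {L : Type} {k : ℕ} (G H : RootedLabelledGraph L k) : Prop :=
  ∃ e : G.graph ≃g H.graph, (∀ v, H.label (e v) = G.label v) ∧ ∀ j, e (G.root j) = H.root j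

instance RootedLabelledGraph.setoid (L : Type) (k : ℕ) : Setoid (RootedLabelledGraph L k) where
  r := RootedLabelledGraph.Isomorphic
  iseqv :=
    { refl := fun _ => ⟨RelIso.refl _, fun _ => rfl, fun _ => rfl⟩
      symm := by
        rintro G H ⟨e, h1, h2⟩
        refine ⟨e.symm, fun v => ?_, fun j => ?_⟩
        · rw [← h1 (e.symm v)]; simp
        · rw [← h2 j]; simp
      trans := by
        rintro G H K ⟨e, h1, h2⟩ ⟨f, h3, h4⟩
        refine ⟨e.trans f, fun v => ?_, fun j => ?_⟩
        · simp [h1, h3]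
        · simp [h2, h4] }

/-- Isomorphism classes of connected locally finite graphs with labels in `L` and `k` roots. -/
def GraphClass (L : Type) (k : ℕ) : Type 1 := Quotient (RootedLabelledGraph.setoid L k)

/-- The isomorphism class of the graph `G` with the given labels and roots. -/
def LFGraph.mk' (G : LFGraph) {L : Type} {k : ℕ} (label : G.V → L) (root : Fin k → G.V) :
    GraphClass L k :=
  Quotient.mk _ { toLFGraph := G, label := label, root := root }

/-- The event that the `r`-neighbourhood of the set of roots is isomorphic, as a rooted graph, to
the graph `H` on `{0, …, n - 1}` with roots `ρ`, by an isomorphism for which the label of the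
`i`-th vertex lies in `O i`. -/
def ballEvent {L : Type} {k : ℕ} (r n : ℕ) (H : SimpleGraph (Fin n)) (ρ : Fin k → Fin n)
    (O : Fin n → Set L) : Set (GraphClass L k) :=
  {g | ∃ G : RootedLabelledGraph L k, Quotient.mk _ G = g ∧ ∃ e : Fin n → G.V,
    Function.Injective e ∧
    range e = {v | ∃ j, G.graph.dist (G.root j) v ≤ r} ∧
    (∀ i i', G.graph.Adj (e i) (e i') ↔ H.Adj i i') ∧
    (∀ j, e (ρ j) = G.root j) ∧
    ∀ i, G.label (e i) ∈ O i}

/-- The Borel sigma-algebra of the local topology: the ball events with open sets of labels form a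
base of that topology (a countable union of them, if `L` is second countable, gives every
open set). -/
instance GraphClass.measurableSpace (L : Type) [TopologicalSpace L] (k : ℕ) :
    MeasurableSpace (GraphClass L k) :=
  MeasurableSpace.generateFrom
    {A | ∃ (r n : ℕ) (H : SimpleGraph (Fin n)) (ρ : Fin k → Fin n) (O : Fin n → Set L),
      (∀ i, IsOpen (O i)) ∧ A = ballEvent r n H ρ O}

/-- The space of connected locally finite rooted graphs up to isomorphism. -/
abbrev RootedGraphs : Type 1 := GraphClass Unit 1

/-- The same with an ordered pair of roots. -/
abbrev BirootedGraphs : Type 1 := GraphClass Unit 2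

/-- The class of `(G, o)`. -/
def LFGraph.rooted (G : LFGraph) (o : G.V) : RootedGraphs := G.mk' (fun _ => ()) ![o]

/-- The class of `(G, x, y)`. -/
def LFGraph.birooted (G : LFGraph) (x y : G.V) : BirootedGraphs := G.mk' (fun _ => ()) ![x, y]

/-! ### Unimodularity and ergodicity -/

/-- The mass transport principle. The integrands do not depend on the representative `g.out` of the
class `g`, since `f` is a function of isomorphism classes. -/
def IsUnimodular (μ : Measure RootedGraphs) : Prop :=
  ∀ f : BirootedGraphs → ℝ≥0∞, Measurable f →
    ∫⁻ g, ∑' y : (Quotient.out g).V,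
        f ((Quotient.out g).toLFGraph.birooted ((Quotient.out g).root 0) y) ∂μ =
    ∫⁻ g, ∑' y : (Quotient.out g).V,
        f ((Quotient.out g).toLFGraph.birooted y ((Quotient.out g).root 0)) ∂μ

/-- A measurable set of rooted graphs that is closed under change of the root. -/
def IsInvariantProperty (A : Set RootedGraphs) : Prop :=
  MeasurableSet A ∧ ∀ (G : LFGraph) (x y : G.V), G.rooted x ∈ A → G.rooted y ∈ A

def IsErgodicGraph (μ : Measure RootedGraphs) : Prop :=
  ∀ A, IsInvariantProperty A → (∀ᵐ g ∂μ, g ∈ A) ∨ (∀ᵐ g ∂μ, g ∉ A)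

/-- The random rooted graph with law `μ` almost surely has the property `Q` (which may not depend on
the root nor on the representative of the isomorphism class). -/
def AlmostSurely (μ : Measure RootedGraphs) (Q : LFGraph → Prop) : Prop :=
  ∀ᵐ g ∂μ, ∀ (G : LFGraph) (o : G.V), G.rooted o = g → Q G

def LFGraph.OneEnded (G : LFGraph) : Prop := ∃ ξ, G.graph.end = {ξ}

/-! ### Tilings of three-space -/

abbrev E3 : Type := EuclideanSpace ℝ (Fin 3)

/-- The integer point `z`, as a point of three-space. -/
noncomputable def latticePoint (z : Fin 3 → ℤ) : E3 := WithLp.toLp 2 (fun i => (z i : ℝ))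

/-- An open polytope, possibly unbounded and with infinitely many faces: a regular open set whose
closure is the union of a locally finite family of convex polytopes. -/
def IsOpenPolytope (S : Set E3) : Prop :=
  IsOpen S ∧ interior (closure S) = S ∧
  ∃ C : Set (Set E3), (∀ c ∈ C, ∃ F : Finset E3, c = convexHull ℝ (F : Set E3)) ∧
    (∀ (x : E3) (r : ℝ), {c ∈ C | (c ∩ Metric.ball x r).Nonempty}.Finite) ∧
    closure S = ⋃₀ C

/-- A tiling of three-space by connected open polytopes. -/
structure IsTiling (P : Set (Set E3)) : Prop where
  polytope : ∀ A ∈ P, IsOpenPolytope A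
  connected : ∀ A ∈ P, IsConnected A
  disjoint : P.PairwiseDisjoint id
  cover : ⋃ A ∈ P, closure A = univ
  locallyFinite : ∀ (x : E3) (r : ℝ), {A ∈ P | (A ∩ Metric.ball x r).Nonempty}.Finite

/-- The closures of `A` and `B` share a two-dimensional piece of a face: their intersection contains
a nondegenerate triangle. -/
def ShareFace (A B : Set E3) : Prop :=
  ∃ p : Fin 3 → E3, AffineIndependent ℝ p ∧ convexHull ℝ (range p) ⊆ closure A ∩ closure B

/-- The adjacency graph of a collection of tiles. -/
def tileGraph (P : Set (Set E3)) : SimpleGraph P where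
  Adj A B := A ≠ B ∧ ShareFace A B
  symm := ⟨fun _ _ h => ⟨h.1.symm, by
    obtain ⟨p, hp, hs⟩ := h.2
    exact ⟨p, hp, fun x hx => (hs hx).symm⟩⟩⟩
  loopless := ⟨fun _ h => h.1 rfl⟩

/-! ### Bricks with holes -/

/-- The closed axis-parallel brick with opposite corners `a` and `b`. -/
def brick (a b : E3) : Set E3 := {x | ∀ i, a i ≤ x i ∧ x i ≤ b i}

/-- A solid built from finitely many nondegenerate bricks: connected interior, and no cavity. -/
def IsBrickSolid (A : Set E3) : Prop :=
  (∃ B : Set (Set E3), B.Finite ∧ (∀ s ∈ B, ∃ a b : E3, (∀ i, a i < b i) ∧ s = brick a b) ∧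
    A = ⋃₀ B) ∧ IsConnected (interior A) ∧ IsConnected Aᶜ

/-- `S` is the interior of `A` with finitely many pairwise disjoint holes, each of which is a solid
built from bricks and lies in the interior of `A`. -/
def IsSolidWithHoles (A S : Set E3) : Prop :=
  ∃ K : Set (Set E3), K.Finite ∧ (∀ h ∈ K, IsBrickSolid h ∧ h ⊆ interior A) ∧
    K.PairwiseDisjoint id ∧ S = interior A \ ⋃₀ K

/-- Every tile is a solid built from bricks, with finitely many holes of the same kind, and every
ball is contained in a single brick that is the outer solid of some tile. -/
def IsBrickTiling (P : Set (Set E3)) : Prop :=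
  (∀ S ∈ P, ∃ A, IsBrickSolid A ∧ IsSolidWithHoles A S) ∧
  ∀ r : ℝ, ∃ S ∈ P, ∃ a b : E3, (∀ i, a i < b i) ∧ Metric.ball 0 r ⊆ brick a b ∧
    IsSolidWithHoles (brick a b) S

/-! ### Factors of iid -/

/-- The space of labels. -/
abbrev Lab : Type := unitInterval

/-- The law of iid uniform `[0,1]` labels on the vertices of `G`. -/
noncomputable def LFGraph.iid (G : LFGraph) : Measure (G.V → Lab) :=
  Measure.infinitePi (fun _ : G.V => (volume : Measure Lab))

/-- Measurability of a map to the subsets of three-space, with respect to the Borel structure of the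
Fell topology (applied to maps whose relevant values are open sets). -/
def MeasurableSets {α : Type*} [MeasurableSpace α] (t : α → Set E3) : Prop :=
  ∀ K : Set E3, IsCompact K → MeasurableSet {g | K ⊆ t g}

/-- The (right) Cayley diagram of `ℤ³` for the standard generators: there is an edge of colour `i`
from `x` to `y`. -/
def cayleyDiagramZ3 (i : Fin 3) (x y : Fin 3 → ℤ) : Prop := y = x + Pi.single i 1

/-- A measurable rule, which is a function of isomorphism classes of labelled graphs: `U` selects
vertices, `E i` selects oriented edges of colour `i`, and `tile` gives to a pair `(u, v)` the set
that decorates `v`, in the coordinates in which the vertex `u` of the grid is the origin. -/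
structure FiidGridTiling where
  U : Set (GraphClass Lab 1)
  E : Fin 3 → Set (GraphClass Lab 2)
  tile : GraphClass Lab 2 → Set E3
  measurable_U : MeasurableSet U
  measurable_E : ∀ i, MeasurableSet (E i)
  measurable_tile : MeasurableSets tile

namespace FiidGridTiling

variable (F : FiidGridTiling) (G : LFGraph) (ℓ : G.V → Lab)

/-- The vertices of `G` selected by the rule from the labels `ℓ`. -/
def verts : Set G.V := {x | G.mk' ℓ ![x] ∈ F.U}

/-- There is an edge of colour `i` from `x` to `y`. -/
def edge (i : Fin 3) (x y : G.V) : Prop := G.mk' ℓ ![x, y] ∈ F.E i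

/-- The set that decorates `v`, seen from `u`. -/
def tileFrom (u v : G.V) : Set E3 := F.tile (G.mk' ℓ ![u, v])

/-- The oriented coloured edges live on the selected vertices, and `φ` is an isomorphism from the
resulting diagram to the Cayley diagram of `ℤ³`. -/
def IsGridIso (φ : F.verts G ℓ ≃ (Fin 3 → ℤ)) : Prop :=
  (∀ i x y, F.edge G ℓ i x y → x ∈ F.verts G ℓ ∧ y ∈ F.verts G ℓ) ∧
  ∀ i (x y : F.verts G ℓ), F.edge G ℓ i x y ↔ cayleyDiagramZ3 i (φ x) (φ y)

/-- The rule succeeds on `G` with the labels `ℓ`: it produces a copy of the diagram `ℤ³`, a tiling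
`P` of the three-space that this copy expands to, and a bijection from the vertices of `G` to the
tiles that preserves adjacency in both directions. The sets `tileFrom u v` determine the tiling and
the bijection in the coordinates centred at `u`. -/
def Represents : Prop :=
  ∃ φ : F.verts G ℓ ≃ (Fin 3 → ℤ), F.IsGridIso G ℓ φ ∧
    ∃ P : Set (Set E3), IsTiling P ∧ IsBrickTiling P ∧
      ∃ e : G.graph ≃g tileGraph P, ∀ (u : F.verts G ℓ) (v : G.V),
        F.tileFrom G ℓ u v = {p | p + latticePoint (φ u) ∈ (e v : Set E3)}

end FiidGridTiling

/-!
The tree is turned into a system of solids in space that are nested as the sets of descendants of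
the vertices are, and the tile of a vertex is its solid without the solids of its children. The
vertices in `U` are placed on the integer points of that space, one on each of them.

**Tree.** Each vertex of a one-ended tree has a parent, its neighbour in the direction of the end,
and finitely many descendants (`LFGraph.exists_parentMap`). Given bounds `κ n`, the cluster of stage
`n` of a vertex is the set of descendants of its last ancestor with fewer than `κ n` descendants.
Labels that are distinct, as they almost surely are, enumerate every cluster in a canonical way
(`Enum`), so that a cluster is described by a code, of which there are countably many.

**Probability.** A vertex is bad at stage `n` if it has at least `κ n` descendants, or if its cluster
has fewer than `minSize κ n` elements. The probability of the former tends to zero as `κ n` grows.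
For the latter, send mass one from such a vertex to the parent of the top of its cluster: the
receiver has at least `κ n` descendants and gets at most `d * minSize κ n`. As `minSize κ n` depends
on the earlier bounds only, the mass transport principle and the Borel–Cantelli lemma give bounds
for which almost surely every vertex is good from some stage on (`exists_scales`).

**Geometry.** A cluster of stage `n` that is large enough gets a box, whose base depends on `n` only
and whose height is proportional to the size of the cluster. A plan for the cluster puts distinct
vertices of it on the integer points of the box and draws the solids of its vertices inside the box,
the solid of the top being the box itself. The box of stage `n + 1` is obtained by stacking the boxes
of the clusters of stage `n` inside it in two columns of half the total height. This doubles the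
base in one direction, alternately the first and the second. The vertices between the tops of
the two stages get solids that consist of a part of each column and a strip that joins these parts
(`exists_layout`, `exists_plan`). The boxes grow in all directions, the volume of a box stays at most
the size of the cluster, so that the remaining integer points can be filled with further vertices,
and the solids drawn at stage `n` never change. Hence the plans of a vertex converge to a filling of
the whole grid and a nested system of solids in the whole space (`exists_limit_plan`).

**Topology of the tiles.** All solids are unions of bricks with a common extent in one direction,
whose interiors all meet the interior of one of them (`IsStarPrism`). Such a solid has a connected interior, a connected complement
and connected shells around it, so that a connected open set stays connected when solids in it are
removed. Solids of adjacent vertices are nested strictly, and those of siblings are disjoint; so the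
tiles of two vertices share a face if and only if one is the parent of the other
(`IsNestedSystem.iso`).

**Measurability.** Whether the roots are given members of a cluster with a given code can be read off
from a ball and the order of the labels in it, so this event is open
(`measurableSet_clusterEvent`). The rule only combines countably many such events.
-/

/-! ### The parent map of a one-ended tree -/

section Ends

open CategoryTheory Opposite

/-- An infinite component of the complement of a finite set contains an end, by the Mittag-Leffler
argument for the inverse system of these components. -/
theorem SimpleGraph.exists_end_of_infinite {V : Type} (G : SimpleGraph V) [G.LocallyFinite]
    [Fact G.Preconnected] [Infinite V] (K : Finset V) (C : G.ComponentCompl K)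
    (hC : C.supp.Infinite) : ∃ s ∈ G.end, s (op K) = C := by
  set F := G.componentComplFunctor with hF
  have hml : F.IsMittagLeffler :=
    F.isMittagLeffler_of_exists_finite_range fun j => ⟨j, 𝟙 j, Set.toFinite _⟩
  have : ∀ j, Nonempty (F.toEventualRanges.obj j) := F.toEventualRanges_nonempty hml
  have hmem : (C : F.obj (op K)) ∈ F.eventualRange (op K) :=
    (G.infinite_iff_in_eventualRange (K := op K) C).1 hC
  obtain ⟨s, hs⟩ := F.toEventualRanges.eval_section_surjective_of_surjective
    (F.surjective_toEventualRanges hml) (op K) ⟨C, hmem⟩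
  exact ⟨_, (F.toEventualRangesSectionsEquiv s).2, congrArg Subtype.val hs⟩

end Ends

/-- The branch at `v` that starts with the edge `v w` of a tree. -/
def branch {V : Type} (G : SimpleGraph V) (v w : V) : Set V := {x | G.dist x w < G.dist x v}

section Tree

variable {V : Type} {G : SimpleGraph V}

theorem SimpleGraph.IsTree.exists_mem_branch (hG : G.IsTree) {v x : V} (hx : x ≠ v) :
    ∃ w, G.Adj v w ∧ x ∈ branch G v w := by
  obtain ⟨q, hq⟩ := (hG.connected v x).exists_walk_length_eq_dist
  cases q with
  | nil => exact absurd rfl hx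
  | @cons _ w _ h q =>
    refine ⟨w, h, ?_⟩
    have := G.dist_le q
    rw [SimpleGraph.Walk.length_cons] at hq
    simp only [branch, mem_ofPred_eq]
    rw [G.dist_comm (u := x), G.dist_comm (u := x)]
    omega

theorem SimpleGraph.IsTree.branch_unique (hG : G.IsTree) {v x w w' : V} (h : G.Adj v w)
    (h' : G.Adj v w') (hx : x ∈ branch G v w) (hx' : x ∈ branch G v w') : w = w' := by
  have key : ∀ {w}, G.Adj v w → x ∈ branch G v w →
      ∃ q : G.Walk v x, q.IsPath ∧ q.snd = w := by
    intro w h hx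
    obtain ⟨q, hq⟩ := (hG.connected w x).exists_walk_length_eq_dist
    refine ⟨SimpleGraph.Walk.cons h q, ?_, by simp⟩
    apply SimpleGraph.Walk.isPath_of_length_eq_dist
    simp only [branch, mem_ofPred_eq] at hx
    rw [G.dist_comm (u := x), G.dist_comm (u := x)] at hx
    have := G.dist_le (SimpleGraph.Walk.cons h q)
    simp only [SimpleGraph.Walk.length_cons] at this ⊢
    omega
  obtain ⟨q, hq, rfl⟩ := key h hx
  obtain ⟨q', hq', rfl⟩ := key h' hx'
  rw [(hG.existsUnique_path v x).unique hq hq']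

theorem SimpleGraph.IsTree.mem_branch_symm (hG : G.IsTree) {v w x : V} (h : G.Adj v w) :
    x ∉ branch G v w ↔ x ∈ branch G w v := by
  simp only [branch, mem_ofPred_eq, not_lt]
  have := hG.dist_ne_of_adj x h
  omega

/-- A vertex adjacent to a vertex of a branch lies in the same branch. -/
theorem SimpleGraph.IsTree.mem_branch_of_adj (hG : G.IsTree) {v w x y : V} (h : G.Adj v w)
    (hx : x ∈ branch G v w) (hxy : G.Adj x y) (hy : y ≠ v) : y ∈ branch G v w := by
  have hne : x ≠ v := by
    rintro rfl
    simp [branch] at hx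
  obtain ⟨w', hw', hyw'⟩ := hG.exists_mem_branch hy
  have h1 := hG.dist_ne_of_adj v hxy
  have e1 := hG.connected.dist_triangle (u := y) (v := x) (w := w)
  have e2 := hG.connected.dist_triangle (u := x) (v := y) (w := w')
  have e3 := SimpleGraph.dist_eq_one_iff_adj.2 hxy
  have e4 := SimpleGraph.dist_eq_one_iff_adj.2 hxy.symm
  simp only [branch, mem_ofPred_eq] at hx hyw'
  rcases lt_or_gt_of_ne h1 with h2 | h2
  · simp only [branch, mem_ofPred_eq]
    rw [G.dist_comm (u := v), G.dist_comm (u := v)] at h2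
    omega
  · have : x ∈ branch G v w' := by
      simp only [branch, mem_ofPred_eq]
      rw [G.dist_comm (u := v), G.dist_comm (u := v)] at h2
      omega
    rwa [hG.branch_unique h hw' hx this]

/-- In a one-ended tree at most one branch at a given vertex is infinite. -/
theorem SimpleGraph.IsTree.infinite_branch_unique (hG : G.IsTree) [G.LocallyFinite] [Infinite V]
    (hend : ∃ ξ, G.end = {ξ}) {v w w' : V} (h : G.Adj v w) (h' : G.Adj v w')
    (hi : (branch G v w).Infinite) (hi' : (branch G v w').Infinite) : w = w' := by
  have : Fact G.Preconnected := ⟨hG.connected.preconnected⟩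
  have hsub : ∀ {w} (h : G.Adj v w), ∀ n, ∀ x ∈ branch G v w, G.dist x w = n →
      x ∈ (G.componentComplMk (K := (({v} : Finset V) : Set V))
        (v := w) (by simpa using h.ne')).supp := by
    intro w h n
    induction n with
    | zero =>
      intro x hx hd
      obtain rfl := (hG.connected.dist_eq_zero_iff).1 hd
      exact G.componentComplMk_mem _
    | succ n ih =>
      intro x hx hd
      have hxw : x ≠ w := by rintro rfl; simp at hd
      obtain ⟨y, hy, hy'⟩ := hG.exists_mem_branch hxw.symm
      simp only [branch, mem_ofPred_eq] at hy' hx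
      have e3 := SimpleGraph.dist_eq_one_iff_adj.2 hy
      have e1 := hG.connected.dist_triangle (u := x) (v := y) (w := w)
      have e2 := hG.connected.dist_triangle (u := x) (v := y) (w := v)
      rw [G.dist_comm (u := w), G.dist_comm (u := w)] at hy'
      have hyb : y ∈ branch G v w := by
        simp only [branch, mem_ofPred_eq]; omega
      refine SimpleGraph.ComponentCompl.mem_of_adj y x (ih y hyb (by omega)) ?_ hy.symm
      simp only [Finset.coe_singleton, mem_singleton_iff]
      rintro rfl
      simp at hx
  have hsup : ∀ {w} (h : G.Adj v w), ∀ x ∈ (G.componentComplMk (K := (({v} : Finset V) : Set V))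
        (v := w) (by simpa using h.ne')).supp, x ∈ branch G v w := by
    intro w h x hx
    obtain ⟨hxv, hx⟩ := hx
    rw [SimpleGraph.componentComplMk, SimpleGraph.ConnectedComponent.eq] at hx
    have key : ∀ (a b : ↥((({v} : Finset V) : Set V)ᶜ)) (q : (G.induce _).Walk a b),
        (b : V) ∈ branch G v w → (a : V) ∈ branch G v w := by
      intro a b q hb
      induction q with
      | nil => exact hb
      | @cons a c b hac q ih =>
        exact hG.mem_branch_of_adj h (ih hb) (SimpleGraph.induce_adj.1 hac).symm
          (by simpa using a.2)
    obtain ⟨q⟩ := hx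
    refine key _ _ q ?_
    simp only [branch, mem_ofPred_eq, SimpleGraph.dist_self]
    exact hG.connected.pos_dist_of_ne h.ne'
  obtain ⟨ξ, hξ⟩ := hend
  have inf : ∀ {w} (h : G.Adj v w), (branch G v w).Infinite →
      ξ (Opposite.op {v}) = G.componentComplMk (K := (({v} : Finset V) : Set V))
        (v := w) (by simpa using h.ne') := by
    intro w h hi
    obtain ⟨s, hs, hs'⟩ := G.exists_end_of_infinite {v} (G.componentComplMk
      (K := (({v} : Finset V) : Set V)) (v := w) (by simpa using h.ne'))
      (hi.mono fun x hx => hsub h _ x hx rfl)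
    rw [hξ, mem_singleton_iff] at hs
    rw [← hs, hs']
  have heq := (inf h hi).symm.trans (inf h' hi')
  have hw : w ∈ branch G v w' := by
    apply hsup h'
    rw [← heq]
    exact G.componentComplMk_mem _
  refine hG.branch_unique h h' ?_ hw
  simp only [branch, mem_ofPred_eq, SimpleGraph.dist_self]
  exact hG.connected.pos_dist_of_ne h.ne'

end Tree

/-- `x` is a descendant of `v` (or equal to `v`) for the parent map `p`. -/
def Below {V : Type*} (p : V → V) (x v : V) : Prop := ∃ k, p^[k] x = v

/-- `p` is a parent map of the graph `G`: the edges join the vertices to their parents, there are no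
cycles, and every vertex has finitely many descendants. -/
structure IsParentMap {V : Type} (G : SimpleGraph V) (p : V → V) : Prop where
  adj : ∀ v w, G.Adj v w ↔ p v = w ∨ p w = v
  finite : ∀ v, {x | Below p x v}.Finite
  acyclic : ∀ x k, 0 < k → p^[k] x ≠ x

/-- The parent of a vertex is its neighbour in the direction of the end, which is the only one whose
branch is infinite. -/
theorem LFGraph.exists_parentMap (T : LFGraph) (htree : T.graph.IsTree) (hend : T.OneEnded) :
    ∃ p, IsParentMap T.graph p := by
  classical
  set G := T.graph
  have hlf : G.LocallyFinite := fun v => (T.locallyFinite v).fintype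
  have hinf : Infinite T.V := by
    by_contra hfin
    rw [not_infinite_iff_finite] at hfin
    obtain ⟨ξ, hξ⟩ := hend
    have : ξ ∈ G.end := by rw [show G.end = {ξ} from hξ]; rfl
    exact isEmptyElim (⟨ξ, this⟩ : G.end)
  have hex : ∀ v, ∃ w, G.Adj v w ∧ (branch G v w).Infinite := by
    intro v
    by_contra! hcon
    apply (Set.infinite_univ (α := T.V))
    have : (univ : Set T.V) ⊆ {v} ∪ ⋃ w ∈ G.neighborSet v, branch G v w := by
      intro x _
      by_cases hx : x = v
      · exact Or.inl hx
      · obtain ⟨w, hw, hxw⟩ := htree.exists_mem_branch hx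
        exact Or.inr (mem_biUnion hw hxw)
    refine Set.Finite.subset ((finite_singleton v).union
      ((T.locallyFinite v).biUnion fun w hw => ?_)) this
    exact hcon w hw
  choose p hp hpi using hex
  have hadj : ∀ v w, G.Adj v w ↔ p v = w ∨ p w = v := by
    intro v w
    constructor
    · intro h
      by_contra! hcon
      have h1 : (branch G v w).Finite := by
        by_contra hi
        exact hcon.1 (htree.infinite_branch_unique hend (hp v) h (hpi v) hi)
      have h2 : (branch G w v).Finite := by
        by_contra hi
        exact hcon.2 (htree.infinite_branch_unique hend (hp w) h.symm (hpi w) hi)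
      refine Set.infinite_univ (α := T.V) ((h1.union h2).subset fun x _ => ?_)
      by_cases hx : x ∈ branch G v w
      · exact Or.inl hx
      · exact Or.inr ((htree.mem_branch_symm h).1 hx)
    · rintro (rfl | rfl)
      · exact hp v
      · exact (hp w).symm
  have hfin1 : ∀ v w, G.Adj v w → w ≠ p v → (branch G v w).Finite := by
    intro v w h hne
    by_contra hi
    exact hne (htree.infinite_branch_unique hend h (hp v) hi (hpi v))
  -- the set of descendants of `v`, described as the complement of a branch
  have hDfin : ∀ v, ((branch G v (p v))ᶜ).Finite := by
    intro v
    have : (branch G v (p v))ᶜ ⊆ {v} ∪ ⋃ w ∈ G.neighborSet v \ {p v}, branch G v w := by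
      intro x hx
      by_cases hxv : x = v
      · exact Or.inl hxv
      · obtain ⟨w, hw, hxw⟩ := htree.exists_mem_branch hxv
        refine Or.inr (mem_biUnion ⟨hw, ?_⟩ hxw)
        rintro rfl
        exact hx hxw
    exact ((finite_singleton v).union (((T.locallyFinite v).subset sdiff_subset).biUnion
      fun w hw => hfin1 v w hw.1 hw.2)).subset this
  have hback : ∀ v, p (p v) ≠ v := by
    intro v h
    have h1 := hpi v
    have h2 : branch G v (p v) = (branch G (p v) v)ᶜ := by
      ext x
      rw [mem_compl_iff, htree.mem_branch_symm (hp v).symm]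
    rw [h2] at h1
    nth_rewrite 2 [← h] at h1
    exact h1 (hDfin (p v))
  have hDsub : ∀ v, (branch G v (p v))ᶜ ⊂ (branch G (p v) (p (p v)))ᶜ := by
    intro v
    rw [Set.ssubset_iff_of_subset]
    · refine ⟨p v, ?_, ?_⟩
      · simp [branch]
      · simp only [branch, mem_compl_iff, mem_ofPred_eq, SimpleGraph.dist_self, not_lt,
          Nat.le_zero]
        intro h
        exact (hp v).ne' (htree.connected.dist_eq_zero_iff.1 h)
    · intro x hx hx'
      have h1 : x ∈ branch G (p v) v := (htree.mem_branch_symm (hp v)).1 hx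
      exact hback v (htree.branch_unique (hp v).symm (hp (p v)) h1 hx').symm
  have hDlt : ∀ v, ((branch G v (p v))ᶜ).ncard < ((branch G (p v) (p (p v)))ᶜ).ncard :=
    fun v => ncard_lt_ncard (hDsub v) (hDfin _)
  refine ⟨p, hadj, ?_, ?_⟩
  · intro v
    refine (hDfin v).subset ?_
    rintro x ⟨k, rfl⟩
    induction k with
    | zero => simp [branch]
    | succ k ih =>
      rw [Function.iterate_succ_apply']
      exact (hDsub _).1 ih
  · intro x k hk
    have : ∀ k, 0 < k → ((branch G x (p x))ᶜ).ncard <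
        ((branch G (p^[k] x) (p (p^[k] x)))ᶜ).ncard := by
      intro k hk
      induction k with
      | zero => omega
      | succ k ih =>
        rw [Function.iterate_succ_apply']
        rcases Nat.eq_zero_or_pos k with rfl | hk0
        · exact hDlt x
        · exact (ih hk0).trans (hDlt _)
    intro h
    have := this k hk
    rw [h] at this
    exact lt_irrefl _ this

/-! ### Descendants in a forest -/

section Below

variable {V : Type*} {p : V → V}

theorem Below.refl (x : V) : Below p x x := ⟨0, rfl⟩

theorem Below.trans {x y z : V} (h : Below p x y) (h' : Below p y z) : Below p x z := by
  obtain ⟨k, rfl⟩ := h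
  obtain ⟨l, rfl⟩ := h'
  exact ⟨l + k, Function.iterate_add_apply _ _ _ _⟩

theorem Below.parent (x : V) : Below p x (p x) := ⟨1, rfl⟩

theorem below_iff {x y : V} : Below p x y ↔ x = y ∨ Below p (p x) y := by
  constructor
  · rintro ⟨k, rfl⟩
    cases k with
    | zero => exact Or.inl rfl
    | succ k => exact Or.inr ⟨k, (Function.iterate_succ_apply _ _ _).symm⟩
  · rintro (rfl | h)
    · exact Below.refl _
    · exact (Below.parent x).trans h

theorem Below.total {x y z : V} (h : Below p x y) (h' : Below p x z) :
    Below p y z ∨ Below p z y := by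
  obtain ⟨k, rfl⟩ := h
  obtain ⟨l, rfl⟩ := h'
  rcases le_total k l with hkl | hkl
  · exact Or.inl ⟨l - k, by rw [← Function.iterate_add_apply, Nat.sub_add_cancel hkl]⟩
  · exact Or.inr ⟨k - l, by rw [← Function.iterate_add_apply, Nat.sub_add_cancel hkl]⟩

/-- A vertex strictly below `y` lies below a child of `y`. -/
theorem Below.exists_child {x y : V} (h : Below p x y) (hne : x ≠ y) :
    ∃ z, p z = y ∧ z ≠ y ∧ Below p x z := by
  obtain ⟨k, hk⟩ := h
  induction k generalizing x with
  | zero => exact absurd hk hne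
  | succ k ih =>
    by_cases hx : p x = y
    · exact ⟨x, hx, hne, Below.refl x⟩
    · obtain ⟨z, h1, h2, h3⟩ := ih hx (by rwa [← Function.iterate_succ_apply])
      exact ⟨z, h1, h2, (Below.parent x).trans h3⟩

/-- A map of a type to itself without nontrivial cycles (a fixed point is allowed, it is the root of
a finite tree) and with finite sets of descendants. -/
structure IsForest (p : V → V) : Prop where
  anti : ∀ x y, Below p x y → Below p y x → x = y
  finite : ∀ v, {x | Below p x v}.Finite

/-- The number of descendants of `v`, with `v` included. -/
noncomputable def sz (p : V → V) (v : V) : ℕ := {x | Below p x v}.ncard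

theorem IsForest.sz_pos (hp : IsForest p) (v : V) : 0 < sz p v :=
  (ncard_pos (hp.finite v)).2 ⟨v, Below.refl v⟩

theorem IsForest.sz_le (hp : IsForest p) {v w : V} (h : Below p v w) : sz p v ≤ sz p w :=
  ncard_le_ncard (fun _ hx => hx.trans h) (hp.finite w)

theorem IsForest.sz_lt (hp : IsForest p) {v w : V} (h : Below p v w) (hne : v ≠ w) :
    sz p v < sz p w := by
  refine ncard_lt_ncard ⟨fun _ hx => hx.trans h, fun hsub => ?_⟩ (hp.finite w)
  exact hne (hp.anti _ _ h (hsub (Below.refl w)))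

/-- Two children of the same vertex have no common descendant. -/
theorem IsForest.sibling_disjoint (hp : IsForest p) {v w x : V} (hvw : p v = p w) (hne : v ≠ w)
    (hv : v ≠ p v) (hw : w ≠ p w) (hxv : Below p x v) : ¬ Below p x w := by
  intro hxw
  have key : ∀ {v w : V}, p v = p w → v ≠ w → w ≠ p w → ¬ Below p v w := by
    intro v w h1 h2 h4 h
    rcases below_iff.1 h with h | h
    · exact h2 h
    · rw [h1] at h
      exact h4 (hp.anti _ _ (Below.parent w) h)
  rcases hxv.total hxw with h | h
  · exact key hvw hne hw h
  · exact key hvw.symm hne.symm hv h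

end Below

theorem IsParentMap.isForest {V : Type} {G : SimpleGraph V} {p : V → V} (hp : IsParentMap G p) :
    IsForest p where
  finite := hp.finite
  anti := by
    rintro x y ⟨k, rfl⟩ ⟨l, hl⟩
    rw [← Function.iterate_add_apply] at hl
    rcases Nat.eq_zero_or_pos k with rfl | hk
    · rfl
    · exact absurd hl (hp.acyclic x _ (by omega))

theorem IsParentMap.ne {V : Type} {G : SimpleGraph V} {p : V → V} (hp : IsParentMap G p) (x : V) :
    p x ≠ x := hp.acyclic x 1 one_pos

theorem IsParentMap.exists_common {V : Type} {G : SimpleGraph V} {p : V → V}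
    (hp : IsParentMap G p) (hG : G.Connected) (x y : V) : ∃ w, Below p x w ∧ Below p y w := by
  obtain ⟨q⟩ := hG x y
  induction q with
  | nil => exact ⟨_, Below.refl _, Below.refl _⟩
  | @cons u v w h q ih =>
    obtain ⟨z, hz, hz'⟩ := ih
    rcases (hp.adj _ _).1 h with h | h
    · exact ⟨z, below_iff.2 (Or.inr (h ▸ hz)), hz'⟩
    · rcases below_iff.1 hz with rfl | hz
      · exact ⟨p v, h ▸ Below.refl _, hz'.trans (Below.parent _)⟩
      · exact ⟨z, h ▸ hz, hz'⟩

theorem IsParentMap.lt_sz_iterate {V : Type} {G : SimpleGraph V} {p : V → V}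
    (hp : IsParentMap G p) (x : V) (k : ℕ) : k < sz p (p^[k] x) := by
  induction k with
  | zero => exact hp.isForest.sz_pos _
  | succ k ih =>
    rw [Function.iterate_succ_apply']
    have := hp.isForest.sz_lt (Below.parent (p := p) (p^[k] x)) (hp.ne _).symm
    omega

/-! ### Codes of finite trees -/

/-- A finite rooted tree on `{0, …, m - 1}`, given by its parent map and its root. -/
abbrev Code : Type := Σ m : ℕ, (Fin m → Fin m) × Fin m

/-- The parent map of a code. -/
abbrev Code.par (c : Code) : Fin c.1 → Fin c.1 := c.2.1

/-- The root of a code. -/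
abbrev Code.top (c : Code) : Fin c.1 := c.2.2

/-- The root is the only fixed point and every vertex is below it. -/
structure Code.WF (c : Code) : Prop where
  par_top : c.par c.top = c.top
  below : ∀ i, Below c.par i c.top

theorem Code.WF.isForest {c : Code} (hc : c.WF) : IsForest c.par where
  finite _ := Set.toFinite _
  anti := by
    have key : ∀ x k, 0 < k → c.par^[k] x = x → x = c.top := by
      intro x k hk h
      obtain ⟨j, hj⟩ := hc.below x
      have h1 : c.par^[k * j] x = x := by
        rw [Function.iterate_mul]
        exact Function.iterate_fixed h j
      have h2 : c.par^[k * j] x = c.top := by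
        obtain ⟨k, rfl⟩ : ∃ l, k = l + 1 := ⟨k - 1, by omega⟩
        rw [show (k + 1) * j = k * j + j by ring, Function.iterate_add_apply, hj]
        exact Function.iterate_fixed hc.par_top _
      rw [← h1, h2]
    rintro x y ⟨k, rfl⟩ ⟨l, hl⟩
    rw [← Function.iterate_add_apply] at hl
    rcases Nat.eq_zero_or_pos k with rfl | hk
    · rfl
    · rw [key x _ (by omega) hl, Function.iterate_fixed hc.par_top]

theorem Code.WF.par_ne {c : Code} (hc : c.WF) {i : Fin c.1} (hi : i ≠ c.top) : c.par i ≠ i := by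
  intro h
  obtain ⟨k, hk⟩ := hc.below i
  rw [Function.iterate_fixed h] at hk
  exact hi hk

theorem Code.WF.sz_top {c : Code} (hc : c.WF) : sz c.par c.top = c.1 := by
  have : {x | Below c.par x c.top} = univ := eq_univ_of_forall hc.below
  rw [sz, this, ncard_univ, Nat.card_eq_fintype_card, Fintype.card_fin]

section Enum

variable {V : Type*} {p : V → V} {lt : V → V → Prop} {s : V}

/-- `f` lists the descendants of `s` in an order compatible with `lt`, and `c` is the code that the
tree of descendants of `s` gets from this list. -/
structure Enum (p : V → V) (lt : V → V → Prop) (s : V) (c : Code) (f : Fin c.1 → V) : Prop where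
  inj : Function.Injective f
  range_eq : range f = {x | Below p x s}
  top : f c.top = s
  par_top : c.par c.top = c.top
  par : ∀ i, i ≠ c.top → f (c.par i) = p (f i)
  mono : ∀ i j, i < j → lt (f i) (f j)

variable {c : Code} {f : Fin c.1 → V}

theorem Enum.below (h : Enum p lt s c f) (i : Fin c.1) : Below p (f i) s :=
  (h.range_eq ▸ mem_range_self i : f i ∈ {x | Below p x s})

theorem Enum.exists_eq (h : Enum p lt s c f) {x : V} (hx : Below p x s) : ∃ i, f i = x :=
  (h.range_eq.symm ▸ hx : x ∈ range f)

theorem Enum.below_iff (h : Enum p lt s c f) (hp : IsForest p) {i j : Fin c.1} :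
    Below c.par i j ↔ Below p (f i) (f j) := by
  constructor
  · rintro ⟨k, hk⟩
    induction k generalizing i with
    | zero => rw [show i = j from hk]; exact Below.refl _
    | succ k ih =>
      rw [Function.iterate_succ_apply] at hk
      by_cases hi : i = c.top
      · rw [hi, h.par_top] at hk
        rw [hi]
        exact ih hk
      · refine Below.trans ?_ (ih hk)
        rw [h.par i hi]
        exact Below.parent _
  · rintro ⟨k, hk⟩
    induction k generalizing i with
    | zero => rw [h.inj (show f i = f j from hk)]; exact Below.refl _
    | succ k ih =>
      by_cases hi : i = c.top
      · have h1 : Below p (f i) (f j) := ⟨_, hk⟩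
        rw [h.inj (hp.anti _ _ h1 (by rw [hi, h.top]; exact h.below j))]
        exact Below.refl _
      · rw [Function.iterate_succ_apply, ← h.par i hi] at hk
        exact (Below.parent i).trans (ih hk)

theorem Enum.wf (h : Enum p lt s c f) (hp : IsForest p) : c.WF :=
  ⟨h.par_top, fun i => (h.below_iff hp).2 (by rw [h.top]; exact h.below i)⟩

theorem Enum.sz_eq (h : Enum p lt s c f) (hp : IsForest p) (i : Fin c.1) :
    sz c.par i = sz p (f i) := by
  have : {x | Below p x (f i)} = f '' {j | Below c.par j i} := by
    ext x
    constructor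
    · intro hx
      obtain ⟨j, rfl⟩ := h.exists_eq (hx.trans (h.below i))
      exact ⟨j, (h.below_iff hp).2 hx, rfl⟩
    · rintro ⟨j, hj, rfl⟩
      exact (h.below_iff hp).1 hj
  rw [sz, sz, this, ncard_image_of_injective _ h.inj]

theorem Enum.sz_top (h : Enum p lt s c f) (hp : IsForest p) : sz p s = c.1 := by
  rw [← (h.wf hp).sz_top, h.sz_eq hp, h.top]

theorem Enum.comp (h : Enum p lt s c f) (hp : IsForest p) {i : Fin c.1} {c' : Code}
    {f' : Fin c'.1 → Fin c.1} (h' : Enum c.par (· < ·) i c' f') :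
    Enum p lt (f i) c' (f ∘ f') where
  inj := h.inj.comp h'.inj
  range_eq := by
    ext x
    simp only [mem_range, Function.comp_apply, mem_ofPred_eq]
    constructor
    · rintro ⟨a, rfl⟩
      exact (h.below_iff hp).1 (h'.below a)
    · intro hx
      obtain ⟨j, rfl⟩ := h.exists_eq (hx.trans (h.below i))
      obtain ⟨a, rfl⟩ := h'.exists_eq ((h.below_iff hp).2 hx)
      exact ⟨a, rfl⟩
  top := by simp [h'.top]
  par_top := h'.par_top
  par a ha := by
    have hne : f' a ≠ c.top := by
      intro hfa
      have h1 := h'.below a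
      have h2 : i = f' a :=
        (h.wf hp).isForest.anti _ _ (hfa ▸ (h.wf hp).below i) h1
      rw [← h'.top] at h2
      exact ha (h'.inj h2).symm
    simp only [Function.comp_apply]
    rw [h'.par a ha, h.par _ hne]
  mono a b hab := h.mono _ _ (h'.mono a b hab)

theorem Enum.exists [LinearOrder V] (hp : IsForest p) (s : V) :
    ∃ c f, Enum p (· < ·) s c f := by
  set F := (hp.finite s).toFinset with hF
  have hmem : ∀ x, x ∈ F ↔ Below p x s := fun x => by simp [hF]
  set e := F.orderIsoOfFin rfl
  set par : Fin F.card → Fin F.card := fun i =>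
    if h : (e i : V) ≠ s then e.symm ⟨p (e i), (hmem _).2 (by
      rcases _root_.below_iff.1 ((hmem _).1 (e i).2) with h1 | h1
      · exact absurd h1 h
      · exact h1)⟩ else i
  set top : Fin F.card := e.symm ⟨s, (hmem _).2 (Below.refl s)⟩
  have htop : (e top : V) = s := by simp [top]
  refine ⟨⟨F.card, par, top⟩, fun i => (e i : V), ?_, ?_, htop, ?_, ?_, ?_⟩
  · exact Subtype.val_injective.comp e.injective
  · ext x
    simp only [mem_range, mem_ofPred_eq, ← hmem]
    exact ⟨by rintro ⟨i, rfl⟩; exact (e i).2, fun hx => ⟨e.symm ⟨x, hx⟩, by simp⟩⟩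
  · simp [Code.par, Code.top, par, htop]
  · intro i hi
    have : (e i : V) ≠ s := by
      intro h
      apply hi
      apply e.injective
      apply Subtype.ext
      rw [h]
      exact htop.symm
    simp [Code.par, par, this]
  · intro i j hij
    exact e.strictMono hij

theorem Enum.exists_of_injective {L : Type*} [LinearOrder L] (ℓ : V → L)
    (hℓ : Function.Injective ℓ) (hp : IsForest p) (s : V) :
    ∃ c f, Enum p (fun x y => ℓ x < ℓ y) s c f := by
  let _ : LinearOrder V := LinearOrder.lift' ℓ hℓ
  exact Enum.exists hp s

theorem Enum.exists_true (hp : IsForest p) (s : V) :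
    ∃ c f, Enum p (fun _ _ => True) s c f := by
  obtain ⟨r, hr⟩ := exists_wellFoundedLT V
  obtain ⟨c, f, h⟩ := Enum.exists hp s
  exact ⟨c, f, { h with mono := fun _ _ _ => trivial }⟩

/-- The list of descendants of `s` and its code are determined by the labels. -/
theorem Enum.unique {L : Type*} [LinearOrder L] {ℓ : V → L}
    {c' : Code} {f' : Fin c'.1 → V}
    (h : Enum p (fun x y => ℓ x < ℓ y) s c f) (h' : Enum p (fun x y => ℓ x < ℓ y) s c' f') :
    (⟨c, f⟩ : Σ c : Code, Fin c.1 → V) = ⟨c', f'⟩ := by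
  obtain ⟨m, par, top⟩ := c
  obtain ⟨m', par', top'⟩ := c'
  obtain rfl : m = m' := by
    have h1 := Nat.card_range_of_injective h.inj
    have h2 := Nat.card_range_of_injective h'.inj
    rw [h.range_eq, ← h'.range_eq, h2] at h1
    simpa using h1.symm
  have hm : StrictMono (fun i => ℓ (f i)) := fun i j hij => h.mono i j hij
  have hm' : StrictMono (fun i => ℓ (f' i)) := fun i j hij => h'.mono i j hij
  have hff : (fun i => ℓ (f i)) = fun i => ℓ (f' i) := by
    apply (StrictMono.range_inj hm hm').1
    change range (ℓ ∘ f) = range (ℓ ∘ f')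
    rw [range_comp, range_comp, h.range_eq, h'.range_eq]
  have key : f = f' := by
    funext i
    obtain ⟨j, hj⟩ := h'.exists_eq (h.below i)
    have h1 : ℓ (f' j) = ℓ (f' i) := by rw [hj]; exact congrFun hff i
    rw [← hj, hm'.injective h1]
  subst key
  obtain rfl : top = top' := h.inj (h.top.trans h'.top.symm)
  obtain rfl : par = par' := by
    funext i
    by_cases hi : i = top
    · rw [hi]
      exact h.par_top.trans h'.par_top.symm
    · exact h.inj ((h.par i hi).trans (h'.par i hi).symm)
  rfl

end Enum

/-! ### Bricks -/

/-- The point of three-space with the given coordinates. -/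
noncomputable abbrev vec (f : Fin 3 → ℝ) : E3 := WithLp.toLp 2 f

/-- The open axis-parallel brick with opposite corners `a` and `b`. -/
def openBrick (a b : E3) : Set E3 := {x | ∀ i, a i < x i ∧ x i < b i}

theorem continuous_coord (i : Fin 3) : Continuous fun x : E3 => x i := by fun_prop

theorem isOpen_openBrick (a b : E3) : IsOpen (openBrick a b) := by
  have : openBrick a b = ⋂ i, {x : E3 | a i < x i} ∩ {x | x i < b i} := by
    ext x; simp [openBrick]
  rw [this]
  exact isOpen_iInter_of_finite fun i =>
    (isOpen_lt continuous_const (continuous_coord i)).inter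
      (isOpen_lt (continuous_coord i) continuous_const)

theorem isCompact_brick (a b : E3) : IsCompact (brick a b) := by
  have h := (isCompact_univ_pi fun i => isCompact_Icc (a := a i) (b := b i)).image
    (PiLp.continuous_toLp 2 (fun _ : Fin 3 => ℝ))
  convert h using 1
  ext x
  simp only [brick, mem_ofPred_eq, mem_image, mem_pi, mem_univ, true_implies, mem_Icc]
  exact ⟨fun hx => ⟨x.ofLp, hx, rfl⟩, by rintro ⟨y, hy, rfl⟩; exact hy⟩

theorem openBrick_subset_brick (a b : E3) : openBrick a b ⊆ brick a b :=
  fun _ hx i => ⟨(hx i).1.le, (hx i).2.le⟩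

theorem convex_openBrick (a b : E3) : Convex ℝ (openBrick a b) := by
  intro x hx y hy s t hs ht hst i
  have h1 := hx i
  have h2 := hy i
  simp only [PiLp.add_apply, PiLp.smul_apply, smul_eq_mul]
  obtain rfl : t = 1 - s := by linarith
  rcases hs.eq_or_lt with rfl | hs'
  · constructor <;> nlinarith
  · constructor <;> nlinarith

/-- The centre of a brick. -/
noncomputable def mid (a b : E3) : E3 := vec fun i => (a i + b i) / 2

theorem mid_mem {a b : E3} (h : ∀ i, a i < b i) : mid a b ∈ openBrick a b := by
  intro i
  have := h i
  simp only [mid, PiLp.toLp_apply]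
  constructor <;> linarith

theorem brick_subset_closure {a b : E3} (h : ∀ i, a i < b i) :
    brick a b ⊆ closure (openBrick a b) := by
  intro x hx
  -- approach `x` along the segment from the centre
  have hcont : Continuous fun t : ℝ => (1 - t) • x + t • mid a b := by fun_prop
  have h1 : x ∈ closure ((fun t : ℝ => (1 - t) • x + t • mid a b) '' Ioo 0 1) := by
    apply mem_closure_of_tendsto (b := nhdsWithin (0 : ℝ) (Ioi 0))
      (f := fun t : ℝ => (1 - t) • x + t • mid a b)
    · have := hcont.tendsto 0
      simp only [sub_zero, one_smul, zero_smul, add_zero] at this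
      exact this.mono_left nhdsWithin_le_nhds
    · filter_upwards [Ioo_mem_nhdsGT (one_pos : (0 : ℝ) < 1)] with t ht
      exact mem_image_of_mem _ ht
  refine closure_mono ?_ h1
  rintro _ ⟨t, ht, rfl⟩ i
  have h2 := hx i
  have h3 := mid_mem h i
  simp only [PiLp.add_apply, PiLp.smul_apply, smul_eq_mul]
  have := ht.1
  have := ht.2
  constructor <;> nlinarith

/-! ### Star prisms -/

/-- A finite union of nondegenerate bricks that have the same extent in one of the coordinate
directions and whose interiors all meet the interior of one of them. Such sets are the outer solids
of all tiles of the construction. -/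
def IsStarPrism (A : Set E3) : Prop :=
  ∃ (o : Fin 3) (J : Finset (E3 × E3)), ∃ j₀ ∈ J, (∀ j ∈ J, ∀ i, j.1 i < j.2 i) ∧
    (∀ j ∈ J, j.1 o = j₀.1 o ∧ j.2 o = j₀.2 o) ∧
    (∀ j ∈ J, ∀ i, j.1 i < j₀.2 i ∧ j₀.1 i < j.2 i) ∧ A = ⋃ j ∈ J, brick j.1 j.2

theorem isStarPrism_brick {a b : E3} (h : ∀ i, a i < b i) : IsStarPrism (brick a b) :=
  ⟨0, {(a, b)}, (a, b), by simp, by simpa using h, by simp, by simpa using h, by simp⟩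

theorem isConnected_iUnion_openBrick {ι : Type*} {J : Set ι} {a b : ι → E3} {j₀ : ι} (h₀ : j₀ ∈ J)
    (hJ : ∀ j ∈ J, ∀ i, a j i < b j i) (hmeet : ∀ j ∈ J, ∀ i, a j i < b j₀ i ∧ a j₀ i < b j i) :
    IsConnected (⋃ j ∈ J, openBrick (a j) (b j)) := by
  have hm : mid (a j₀) (b j₀) ∈ openBrick (a j₀) (b j₀) := mid_mem (hJ _ h₀)
  refine ⟨⟨_, mem_biUnion h₀ hm⟩, ?_⟩
  refine isPreconnected_of_forall (mid (a j₀) (b j₀)) ?_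
  intro x hx
  obtain ⟨j, hj, hxj⟩ := mem_iUnion₂.1 hx
  refine ⟨openBrick (a j₀) (b j₀) ∪ openBrick (a j) (b j), ?_, Or.inl hm, Or.inr hxj, ?_⟩
  · exact union_subset (subset_biUnion_of_mem (u := fun j => openBrick (a j) (b j)) h₀)
      (subset_biUnion_of_mem (u := fun j => openBrick (a j) (b j)) hj)
  · refine IsPreconnected.union (vec fun i => (max (a j i) (a j₀ i) + min (b j i) (b j₀ i)) / 2)
      ?_ ?_ (convex_openBrick _ _).isPreconnected (convex_openBrick _ _).isPreconnected
    all_goals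
      intro i
      have h1 := hJ j hj i
      have h2 := hJ j₀ h₀ i
      have h3 := hmeet j hj i
      dsimp only
      have h4 : max (a j i) (a j₀ i) < min (b j i) (b j₀ i) := by
        simp only [max_lt_iff, lt_min_iff]
        exact ⟨⟨h1, h3.2⟩, h3.1, h2⟩
      have h5 := le_max_left (a j i) (a j₀ i)
      have h6 := le_max_right (a j i) (a j₀ i)
      have h7 := min_le_left (b j i) (b j₀ i)
      have h8 := min_le_right (b j i) (b j₀ i)
      constructor <;> linarith

section Shell

variable {o : Fin 3} {J : Finset (E3 × E3)} {j₀ : E3 × E3}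

/-- The open `ε`-neighbourhood (for the supremum norm) of a union of bricks. -/
def thicken (J : Finset (E3 × E3)) (ε : ℝ) : Set E3 :=
  ⋃ j ∈ J, openBrick (vec fun i => j.1 i - ε) (vec fun i => j.2 i + ε)

theorem subset_thicken {ε : ℝ} (hε : 0 < ε) : (⋃ j ∈ J, brick j.1 j.2) ⊆ thicken J ε := by
  refine biUnion_mono (subset_refl _) fun j _ x hx i => ?_
  have := hx i
  dsimp only
  constructor <;> linarith

theorem isOpen_thicken (J : Finset (E3 × E3)) (ε : ℝ) : IsOpen (thicken J ε) :=
  isOpen_biUnion fun _ _ => isOpen_openBrick _ _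

/-- The neighbourhoods of a star prism are connected shells around it: a point beside the prism can
be moved, in the common direction of the bricks, above or below the prism, and the parts of the
neighbourhood above and below the prism are connected. -/
theorem isConnected_thicken_diff (h₀ : j₀ ∈ J) (hJ : ∀ j ∈ J, ∀ i, j.1 i < j.2 i)
    (ho : ∀ j ∈ J, j.1 o = j₀.1 o ∧ j.2 o = j₀.2 o)
    (hmeet : ∀ j ∈ J, ∀ i, j.1 i < j₀.2 i ∧ j₀.1 i < j.2 i) {ε : ℝ} (hε : 0 < ε) :
    IsConnected (thicken J ε \ ⋃ j ∈ J, brick j.1 j.2) := by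
  classical
  set A := ⋃ j ∈ J, brick j.1 j.2 with hA
  set c := j₀.1 o
  set d := j₀.2 o
  have hcd : c < d := hJ _ h₀ o
  -- the lids above and below
  set up : Set E3 := ⋃ j ∈ (J : Set (E3 × E3)),
    openBrick (vec (Function.update (fun i => j.1 i - ε) o d))
      (vec fun i => j.2 i + ε) with hup
  set dn : Set E3 := ⋃ j ∈ (J : Set (E3 × E3)),
    openBrick (vec fun i => j.1 i - ε)
      (vec (Function.update (fun i => j.2 i + ε) o c)) with hdn
  have hupc : IsConnected up := by
    refine isConnected_iUnion_openBrick (j₀ := j₀) (by simpa using h₀) ?_ ?_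
    · intro j hj i
      have h1 := hJ j hj i
      by_cases hi : i = o
      · subst hi
        simp [(ho j hj).2, d, hε]
      · simp only [Function.update_of_ne hi]; linarith
    · intro j hj i
      have h1 := hmeet j hj i
      by_cases hi : i = o
      · subst hi
        simp [(ho j hj).2, d, hε]
      · simp only [Function.update_of_ne hi]
        constructor <;> linarith
  have hdnc : IsConnected dn := by
    refine isConnected_iUnion_openBrick (j₀ := j₀) (by simpa using h₀) ?_ ?_
    · intro j hj i
      have h1 := hJ j hj i
      by_cases hi : i = o
      · subst hi
        simp [(ho j hj).1, c, hε]
      · simp only [Function.update_of_ne hi]; linarith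
    · intro j hj i
      have h1 := hmeet j hj i
      by_cases hi : i = o
      · subst hi
        simp [(ho j hj).1, c, hε]
      · simp only [Function.update_of_ne hi]
        constructor <;> linarith
  have hAo : ∀ x ∈ A, c ≤ x o ∧ x o ≤ d := by
    intro x hx
    obtain ⟨j, hj, hxj⟩ := mem_iUnion₂.1 hx
    have := hxj o
    rw [(ho j hj).1, (ho j hj).2] at this
    exact this
  have hmem_up : ∀ x ∈ thicken J ε, d < x o → x ∈ up := by
    intro x hx hd
    obtain ⟨j, hj, hxj⟩ := mem_iUnion₂.1 hx
    refine mem_biUnion (Finset.mem_coe.2 hj) fun i => ⟨?_, (hxj i).2⟩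
    by_cases hi : i = o
    · subst hi; simpa using hd
    · simpa [Function.update_of_ne hi] using (hxj i).1
  have hmem_dn : ∀ x ∈ thicken J ε, x o < c → x ∈ dn := by
    intro x hx hd
    obtain ⟨j, hj, hxj⟩ := mem_iUnion₂.1 hx
    refine mem_biUnion (Finset.mem_coe.2 hj) fun i => ⟨(hxj i).1, ?_⟩
    by_cases hi : i = o
    · subst hi; simpa using hd
    · simpa [Function.update_of_ne hi] using (hxj i).2
  have hup_sub : up ⊆ thicken J ε \ A := by
    intro x hx
    obtain ⟨j, hj, hxj⟩ := mem_iUnion₂.1 hx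
    have hxo : d < x o := by simpa using (hxj o).1
    refine ⟨mem_biUnion (Finset.mem_coe.1 hj) fun i => ⟨?_, (hxj i).2⟩, fun hxA => ?_⟩
    · by_cases hi : i = o
      · subst hi
        have := (ho j hj).1
        dsimp only
        linarith
      · simpa [Function.update_of_ne hi] using (hxj i).1
    · exact absurd (hAo x hxA).2 (not_le.2 hxo)
  have hdn_sub : dn ⊆ thicken J ε \ A := by
    intro x hx
    obtain ⟨j, hj, hxj⟩ := mem_iUnion₂.1 hx
    have hxo : x o < c := by simpa using (hxj o).2
    refine ⟨mem_biUnion (Finset.mem_coe.1 hj) fun i => ⟨(hxj i).1, ?_⟩, fun hxA => ?_⟩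
    · by_cases hi : i = o
      · subst hi
        have := (ho j hj).2
        dsimp only
        linarith
      · simpa [Function.update_of_ne hi] using (hxj i).2
    · exact absurd (hAo x hxA).1 (not_le.2 hxo)
  -- the vertical segments
  set seg : E3 → Set E3 := fun x =>
    (fun s : ℝ => vec (Function.update (fun i => x i) o s)) '' Ioo (c - ε) (d + ε) with hseg
  have hsegc : ∀ x, IsPreconnected (seg x) := by
    intro x
    refine isPreconnected_Ioo.image _ (Continuous.continuousOn ?_)
    have : Continuous fun s : ℝ => Function.update (fun i => x i) o s :=
      continuous_const.update o continuous_id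
    exact (PiLp.continuous_toLp 2 (fun _ : Fin 3 => ℝ)).comp this
  have hseg_sub : ∀ x ∈ thicken J ε \ A, c ≤ x o → x o ≤ d →
      seg x ⊆ thicken J ε \ A ∧ x ∈ seg x ∧ (seg x ∩ up).Nonempty ∧ (seg x ∩ dn).Nonempty := by
    intro x hx hc hd
    have hsub : seg x ⊆ thicken J ε \ A := by
      rintro _ ⟨s, hs, rfl⟩
      constructor
      · obtain ⟨j, hj, hxj⟩ := mem_iUnion₂.1 hx.1
        refine mem_biUnion hj fun i => ?_
        by_cases hi : i = o
        · subst hi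
          simpa [(ho j hj).1, (ho j hj).2] using hs
        · simpa [Function.update_of_ne hi] using hxj i
      · intro hA'
        obtain ⟨j, hj, hxj⟩ := mem_iUnion₂.1 hA'
        refine hx.2 (mem_biUnion hj fun i => ?_)
        by_cases hi : i = o
        · subst hi
          rw [(ho j hj).1, (ho j hj).2]
          exact ⟨hc, hd⟩
        · simpa [Function.update_of_ne hi] using hxj i
    refine ⟨hsub, ⟨x o, ⟨by linarith, by linarith⟩, ?_⟩, ?_, ?_⟩
    · ext i
      by_cases hi : i = o
      · subst hi; simp
      · simp [Function.update_of_ne hi]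
    · have hm : vec (Function.update (fun i => x i) o (d + ε / 2)) ∈ seg x :=
        ⟨d + ε / 2, ⟨by linarith, by linarith⟩, rfl⟩
      exact ⟨_, hm, hmem_up _ (hsub hm).1 (by simp [hε])⟩
    · have hm : vec (Function.update (fun i => x i) o (c - ε / 2)) ∈ seg x :=
        ⟨c - ε / 2, ⟨by linarith, by linarith⟩, rfl⟩
      exact ⟨_, hm, hmem_dn _ (hsub hm).1 (by simp [hε])⟩
  -- a point beside the prism
  obtain ⟨q, hq, hqc, hqd⟩ : ∃ q ∈ thicken J ε \ A, c ≤ q o ∧ q o ≤ d := by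
    obtain ⟨i, hi⟩ : ∃ i : Fin 3, i ≠ o := exists_ne o
    obtain ⟨j, hj, hmax⟩ := J.exists_max_image (fun j => j.2 i) ⟨j₀, h₀⟩
    refine ⟨vec (Function.update (mid j.1 j.2) i (j.2 i + ε / 2)), ⟨?_, ?_⟩, ?_⟩
    · refine mem_biUnion hj fun k => ?_
      have h1 := mid_mem (hJ j hj) k
      by_cases hk : k = i
      · subst hk
        have := hJ j hj k
        simp only [Function.update_self]
        constructor <;> linarith
      · simp only [Function.update_of_ne hk]
        constructor <;> linarith
    · intro hA'
      obtain ⟨j', hj', hx⟩ := mem_iUnion₂.1 hA'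
      have h1 := (hx i).2
      have h2 := hmax j' hj'
      simp only [Function.update_self] at h1
      linarith
    · have h1 := mid_mem (hJ j hj) o
      rw [(ho j hj).1, (ho j hj).2] at h1
      simp only [Function.update_of_ne hi.symm]
      exact ⟨h1.1.le, h1.2.le⟩
  obtain ⟨y, hy⟩ := hupc.nonempty
  refine ⟨⟨y, hup_sub hy⟩, isPreconnected_of_forall y ?_⟩
  intro x hx
  by_cases h1 : d < x o
  · exact ⟨up, hup_sub, hy, hmem_up x hx.1 h1, hupc.isPreconnected⟩
  by_cases h2 : x o < c
  · obtain ⟨s1, s2, s3, s4⟩ := hseg_sub q hq hqc hqd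
    have hc1 : IsPreconnected (up ∪ seg q) :=
      IsPreconnected.union' (by rwa [inter_comm] at s3) hupc.isPreconnected (hsegc q)
    refine ⟨(up ∪ seg q) ∪ dn, union_subset (union_subset hup_sub s1) hdn_sub,
      Or.inl (Or.inl hy), Or.inr (hmem_dn x hx.1 h2), ?_⟩
    refine IsPreconnected.union' ?_ hc1 hdnc.isPreconnected
    exact s4.mono (inter_subset_inter_left _ subset_union_right)
  · obtain ⟨s1, s2, s3, s4⟩ := hseg_sub x hx (not_lt.1 h2) (not_lt.1 h1)
    exact ⟨up ∪ seg x, union_subset hup_sub s1, Or.inl hy, Or.inr s2,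
      IsPreconnected.union' (by rwa [inter_comm] at s3) hupc.isPreconnected (hsegc x)⟩

end Shell

namespace IsStarPrism

variable {A : Set E3}

theorem isCompact (h : IsStarPrism A) : IsCompact A := by
  obtain ⟨o, J, j₀, h₀, hJ, ho, hm, rfl⟩ := h
  exact J.finite_toSet.isCompact_biUnion fun j _ => isCompact_brick _ _

theorem openBricks_subset_interior (J : Finset (E3 × E3)) :
    (⋃ j ∈ (J : Set (E3 × E3)), openBrick j.1 j.2) ⊆ interior (⋃ j ∈ J, brick j.1 j.2) :=
  interior_maximal (biUnion_mono (fun _ h => h) fun _ _ => openBrick_subset_brick _ _)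
    (isOpen_biUnion fun _ _ => isOpen_openBrick _ _)

theorem subset_closure_openBricks {J : Finset (E3 × E3)} (hJ : ∀ j ∈ J, ∀ i, j.1 i < j.2 i) :
    (⋃ j ∈ J, brick j.1 j.2) ⊆ closure (⋃ j ∈ (J : Set (E3 × E3)), openBrick j.1 j.2) := by
  intro x hx
  obtain ⟨j, hj, hxj⟩ := mem_iUnion₂.1 hx
  exact closure_mono (subset_biUnion_of_mem (u := fun j : E3 × E3 => openBrick j.1 j.2)
    (Finset.mem_coe.2 hj)) (brick_subset_closure (hJ j hj) hxj)

theorem subset_closure_interior (h : IsStarPrism A) : A ⊆ closure (interior A) := by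
  obtain ⟨o, J, j₀, h₀, hJ, ho, hm, rfl⟩ := h
  exact (subset_closure_openBricks hJ).trans (closure_mono (openBricks_subset_interior J))

theorem isConnected_interior (h : IsStarPrism A) : IsConnected (interior A) := by
  obtain ⟨o, J, j₀, h₀, hJ, ho, hm, rfl⟩ := h
  have hc : IsConnected (⋃ j ∈ (J : Set (E3 × E3)), openBrick j.1 j.2) :=
    isConnected_iUnion_openBrick (Finset.mem_coe.2 h₀) hJ hm
  exact hc.subset_closure (openBricks_subset_interior J)
    (interior_subset.trans (subset_closure_openBricks hJ))

theorem isConnected_compl (h : IsStarPrism A) : IsConnected Aᶜ := by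
  obtain ⟨o, J, j₀, h₀, hJ, ho, hm, rfl⟩ := h
  have hs := fun (ε : ℝ) (hε : 0 < ε) => isConnected_thicken_diff h₀ hJ ho hm hε
  have hmono : ∀ ε ε' : ℝ, ε ≤ ε' → thicken J ε ⊆ thicken J ε' := by
    intro ε ε' hle
    refine biUnion_mono (subset_refl _) fun j _ x hx i => ?_
    have := hx i
    dsimp only at this ⊢
    constructor <;> linarith
  obtain ⟨y, hy⟩ := (hs 1 one_pos).nonempty
  refine ⟨⟨y, hy.2⟩, isPreconnected_of_forall y fun x hx => ?_⟩
  obtain ⟨M, hM⟩ : ∃ M : ℝ, ∀ i, |x i| + |j₀.1 i| + |j₀.2 i| < M := by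
    obtain ⟨M, hM⟩ := (Set.finite_range fun i => |x i| + |j₀.1 i| + |j₀.2 i|).bddAbove
    exact ⟨M + 1, fun i => lt_of_le_of_lt (hM (mem_range_self i)) (lt_add_one M)⟩
  refine ⟨thicken J (max M 1) \ ⋃ j ∈ J, brick j.1 j.2, fun z hz => hz.2, ⟨?_, hy.2⟩, ⟨?_, hx⟩,
    (hs _ (by positivity)).isPreconnected⟩
  · exact hmono _ _ (le_max_right _ _) hy.1
  · refine hmono M _ (le_max_left _ _) (mem_biUnion h₀ fun i => ?_)
    have h1 := hM i
    have h2 := abs_le.1 (le_refl |x i|)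
    have h3 := abs_le.1 (le_refl |j₀.1 i|)
    have h4 := abs_le.1 (le_refl |j₀.2 i|)
    have h5 := abs_nonneg (x i)
    have h6 := abs_nonneg (j₀.1 i)
    have h7 := abs_nonneg (j₀.2 i)
    dsimp only
    constructor <;> linarith

/-- A star prism has arbitrarily small connected shells around it. -/
theorem exists_shell (h : IsStarPrism A) {N : Set E3} (hN : IsOpen N) (hAN : A ⊆ N) :
    ∃ O, IsOpen O ∧ A ⊆ O ∧ O ⊆ N ∧ IsConnected (O \ A) := by
  have hA := h.isCompact
  obtain ⟨o, J, j₀, h₀, hJ, ho, hm, rfl⟩ := h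
  obtain ⟨δ, hδ, hsub⟩ := hA.exists_cthickening_subset_open hN hAN
  refine ⟨thicken J (δ / 3), isOpen_thicken _ _, subset_thicken (by positivity), ?_,
    isConnected_thicken_diff h₀ hJ ho hm (by positivity)⟩
  intro x hx
  obtain ⟨j, hj, hxj⟩ := mem_iUnion₂.1 hx
  apply hsub
  set y : E3 := vec fun i => max (j.1 i) (min (x i) (j.2 i)) with hy
  have hyA : y ∈ ⋃ j ∈ J, brick j.1 j.2 := by
    refine mem_biUnion hj fun i => ?_
    have := hJ j hj i
    simp only [hy, PiLp.toLp_apply]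
    exact ⟨le_max_left _ _, max_le this.le (min_le_right _ _)⟩
  refine Metric.mem_cthickening_of_dist_le x y δ _ hyA ?_
  rw [EuclideanSpace.dist_eq]
  apply Real.sqrt_le_iff.2 ⟨hδ.le, ?_⟩
  have hi : ∀ i, dist (x i) (y i) ^ 2 ≤ (δ / 3) ^ 2 := by
    intro i
    have h1 := hxj i
    have h2 := hJ j hj i
    dsimp only at h1
    rw [Real.dist_eq, sq_abs]
    simp only [hy, PiLp.toLp_apply]
    apply sq_le_sq'
    · rcases le_total (x i) (j.2 i) with h3 | h3 <;> rcases le_total (j.1 i) (x i) with h4 | h4 <;>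
        simp only [min_eq_left h3, min_eq_right h3, max_eq_left, max_eq_right, h4, h2.le] <;>
        linarith
    · rcases le_total (x i) (j.2 i) with h3 | h3 <;> rcases le_total (j.1 i) (x i) with h4 | h4 <;>
        simp only [min_eq_left h3, min_eq_right h3, max_eq_left, max_eq_right, h4, h2.le] <;>
        linarith
  calc ∑ i, dist (x i) (y i) ^ 2 ≤ ∑ _i : Fin 3, (δ / 3) ^ 2 := Finset.sum_le_sum fun i _ => hi i
    _ ≤ δ ^ 2 := by simp; nlinarith

theorem isBrickSolid (h : IsStarPrism A) : IsBrickSolid A := by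
  refine ⟨?_, h.isConnected_interior, h.isConnected_compl⟩
  obtain ⟨o, J, j₀, h₀, hJ, ho, hm, rfl⟩ := h
  refine ⟨(fun j : E3 × E3 => brick j.1 j.2) '' (J : Set (E3 × E3)), J.finite_toSet.image _, ?_, ?_⟩
  · rintro _ ⟨j, hj, rfl⟩
    exact ⟨j.1, j.2, hJ j hj, rfl⟩
  · rw [sUnion_image]
    rfl

/-- The frontier of a star prism contains a nondegenerate triangle: a corner of the topmost face. -/
theorem exists_triangle (h : IsStarPrism A) : ∃ q : Fin 3 → E3, AffineIndependent ℝ q ∧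
    convexHull ℝ (range q) ⊆ A \ interior A := by
  obtain ⟨o, J, j₀, h₀, hJ, ho, hm, rfl⟩ := h
  obtain ⟨j, hj, hmax⟩ := J.exists_max_image (fun j => j.2 0) ⟨j₀, h₀⟩
  have hj1 := hJ j hj
  set q : Fin 3 → E3 := ![vec ![j.2 0, j.1 1, j.1 2], vec ![j.2 0, j.2 1, j.1 2],
    vec ![j.2 0, j.1 1, j.2 2]] with hq
  refine ⟨q, ?_, ?_⟩
  · rw [affineIndependent_iff_linearIndependent_vsub ℝ _ (0 : Fin 3)]
    rw [Fintype.linearIndependent_iff]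
    intro g hg
    have hsum : ∀ w : {x : Fin 3 // x ≠ 0} → E3,
        ∑ i, w i = w ⟨1, by decide⟩ + w ⟨2, by decide⟩ := by
      intro w
      have : (Finset.univ : Finset {x : Fin 3 // x ≠ 0}) = {⟨1, by decide⟩, ⟨2, by decide⟩} := by
        decide
      rw [this, Finset.sum_pair (by decide)]
    rw [hsum] at hg
    have e1 := congrArg (fun x : E3 => x 1) hg
    have e2 := congrArg (fun x : E3 => x 2) hg
    simp [hq, sub_eq_zero, (hj1 1).ne', (hj1 2).ne'] at e1 e2
    rintro ⟨i, hi⟩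
    fin_cases i
    · exact absurd rfl hi
    · exact e1
    · exact e2
  · have hsub : convexHull ℝ (range q) ⊆ {x : E3 | x 0 = j.2 0} ∩ brick j.1 j.2 := by
      refine convexHull_min ?_ ?_
      · rintro _ ⟨k, rfl⟩
        refine ⟨by fin_cases k <;> simp [hq], fun i => ?_⟩
        have h0 := (hj1 0).le
        have h1 := (hj1 1).le
        have h2 := (hj1 2).le
        fin_cases k <;> fin_cases i <;> simp [hq, h0, h1, h2]
      · refine Convex.inter ?_ ?_
        · intro x hx y hy s t hs ht hst
          simp only [mem_ofPred_eq] at hx hy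
          simp only [mem_ofPred_eq, PiLp.add_apply, PiLp.smul_apply, smul_eq_mul, hx, hy]
          rw [← add_mul, hst, one_mul]
        · intro x hx y hy s t hs ht hst i
          have h1 := hx i
          have h2 := hy i
          simp only [PiLp.add_apply, PiLp.smul_apply, smul_eq_mul]
          obtain rfl : t = 1 - s := by linarith
          constructor <;> nlinarith
    intro x hx
    obtain ⟨hx0, hxj⟩ := hsub hx
    refine ⟨mem_biUnion hj hxj, fun hint => ?_⟩
    -- move slightly out of the face
    have hcont : Continuous fun t : ℝ => x + t • vec ![1, 0, 0] := by fun_prop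
    have hpre := (isOpen_interior (s := ⋃ j ∈ J, brick j.1 j.2)).preimage hcont
    have h0 : (0 : ℝ) ∈ (fun t : ℝ => x + t • vec ![1, 0, 0]) ⁻¹'
        interior (⋃ j ∈ J, brick j.1 j.2) := by simpa using hint
    obtain ⟨ε, hε, hball⟩ := Metric.isOpen_iff.1 hpre 0 h0
    have h1 : ε / 2 ∈ Metric.ball (0 : ℝ) ε := by
      rw [Metric.mem_ball, Real.dist_eq, sub_zero, abs_of_pos (by positivity)]
      linarith
    have h2 := interior_subset (hball h1)
    obtain ⟨j', hj', hx'⟩ := mem_iUnion₂.1 h2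
    have h3 := (hx' 0).2
    have h4 := hmax j' hj'
    simp only [mem_ofPred_eq] at hx0
    simp [hx0] at h3
    linarith

end IsStarPrism

/-! ### Finite unions of boxes are polytopes -/

/-- A finite union of products of three intervals, of any kind. -/
def IsBoxUnion (S : Set E3) : Prop :=
  ∃ F : Set (Fin 3 → Set ℝ), F.Finite ∧ (∀ I ∈ F, ∀ i, (I i).OrdConnected) ∧
    S = ⋃ I ∈ F, {x | ∀ i, x i ∈ I i}

namespace IsBoxUnion

variable {S T : Set E3}

theorem box {I : Fin 3 → Set ℝ} (hI : ∀ i, (I i).OrdConnected) : IsBoxUnion {x | ∀ i, x i ∈ I i} :=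
  ⟨{I}, finite_singleton _, by simpa using hI, by simp⟩

theorem brick (a b : E3) : IsBoxUnion (brick a b) :=
  box (I := fun i => Icc (a i) (b i)) fun _ => ordConnected_Icc

theorem empty : IsBoxUnion (∅ : Set E3) := ⟨∅, finite_empty, by simp, by simp⟩

theorem union (hS : IsBoxUnion S) (hT : IsBoxUnion T) : IsBoxUnion (S ∪ T) := by
  obtain ⟨F, hF, hFo, rfl⟩ := hS
  obtain ⟨F', hF', hFo', rfl⟩ := hT
  refine ⟨F ∪ F', hF.union hF', ?_, by rw [biUnion_union]⟩
  rintro I (hI | hI)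
  exacts [hFo I hI, hFo' I hI]

theorem inter (hS : IsBoxUnion S) (hT : IsBoxUnion T) : IsBoxUnion (S ∩ T) := by
  obtain ⟨F, hF, hFo, rfl⟩ := hS
  obtain ⟨F', hF', hFo', rfl⟩ := hT
  refine ⟨image2 (fun I I' i => I i ∩ I' i) F F', hF.image2 _ hF', ?_, ?_⟩
  · rintro _ ⟨I, hI, I', hI', rfl⟩ i
    exact (hFo I hI i).inter (hFo' I' hI' i)
  · ext x
    simp only [mem_inter_iff, mem_iUnion, mem_ofPred_eq, exists_prop, mem_image2]
    constructor
    · rintro ⟨⟨I, hI, h⟩, I', hI', h'⟩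
      exact ⟨_, ⟨I, hI, I', hI', rfl⟩, fun i => ⟨h i, h' i⟩⟩
    · rintro ⟨_, ⟨I, hI, I', hI', rfl⟩, h⟩
      exact ⟨⟨I, hI, fun i => (h i).1⟩, I', hI', fun i => (h i).2⟩

theorem biUnion {ι : Type*} {s : Set ι} (hs : s.Finite) {f : ι → Set E3}
    (hf : ∀ i ∈ s, IsBoxUnion (f i)) : IsBoxUnion (⋃ i ∈ s, f i) := by
  induction s, hs using Set.Finite.induction_on with
  | empty => simpa using empty
  | @insert a s ha hs ih =>
    rw [biUnion_insert]
    exact (hf a (mem_insert _ _)).union (ih fun i hi => hf i (mem_insert_of_mem _ hi))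

theorem compl (hS : IsBoxUnion S) : IsBoxUnion Sᶜ := by
  obtain ⟨F, hF, hFo, rfl⟩ := hS
  induction F, hF using Set.Finite.induction_on with
  | empty =>
    simp only [mem_empty_iff_false, iUnion_of_empty, iUnion_empty, compl_empty]
    convert box (I := fun _ => univ) fun _ => ordConnected_univ
    simp
  | @insert I F hI hF ih =>
    rw [biUnion_insert, compl_union]
    refine inter ?_ (ih fun I' hI' => hFo I' (mem_insert_of_mem _ hI'))
    have hIo := hFo I (mem_insert _ _)
    -- the part of the complement of a box that lies on one side in one direction
    have hhalf : ∀ (i : Fin 3) (L : Set ℝ), L.OrdConnected → IsBoxUnion {x : E3 | x i ∈ L} := by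
      intro i L hL
      convert box (I := fun j => if j = i then L else univ) ?_ using 1
      · ext x
        simp only [mem_ofPred_eq]
        constructor
        · intro h j
          split_ifs with hj
          · rwa [hj]
          · trivial
        · intro h
          simpa using h i
      · intro j
        split_ifs
        exacts [hL, ordConnected_univ]
    have : {x : E3 | ∀ i, x i ∈ I i}ᶜ = ⋃ i ∈ (univ : Set (Fin 3)),
        ({x : E3 | x i ∈ {t | ∀ s ∈ I i, t < s}} ∪ {x : E3 | x i ∈ {t | ∀ s ∈ I i, s < t}}) := by
      ext x
      simp only [mem_compl_iff, mem_ofPred_eq, mem_univ, iUnion_true, mem_iUnion, mem_union,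
        not_forall]
      refine exists_congr fun i => ⟨fun h => ?_, fun h hx => ?_⟩
      · by_contra! hcon
        obtain ⟨⟨s, hs, hs'⟩, t, ht, ht'⟩ := hcon
        exact h ((hIo i).out hs ht ⟨hs', ht'⟩)
      · rcases h with h | h
        · exact lt_irrefl _ (h _ hx)
        · exact lt_irrefl _ (h _ hx)
    rw [this]
    refine biUnion finite_univ fun i _ => (hhalf i _ ?_).union (hhalf i _ ?_)
    · exact ⟨fun a _ b hb t ht s hs => ht.2.trans_lt (hb s hs)⟩
    · exact ⟨fun a ha b _ t ht s hs => (ha s hs).trans_le ht.1⟩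

theorem closure_box (I : Fin 3 → Set ℝ) :
    closure {x : E3 | ∀ i, x i ∈ I i} = {x | ∀ i, x i ∈ closure (I i)} := by
  have h := (PiLp.homeomorph 2 (fun _ : Fin 3 => ℝ)).preimage_closure (univ.pi I)
  rw [closure_pi_set] at h
  have e1 : ∀ I : Fin 3 → Set ℝ, (PiLp.homeomorph 2 (fun _ : Fin 3 => ℝ)) ⁻¹' univ.pi I =
      {x | ∀ i, x i ∈ I i} := by
    intro I
    ext x
    simp only [mem_preimage, mem_pi, mem_univ, true_implies, mem_ofPred_eq]
    rfl
  rw [e1, e1] at h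
  exact h.symm

theorem closure (hS : IsBoxUnion S) : IsBoxUnion (closure S) := by
  obtain ⟨F, hF, hFo, rfl⟩ := hS
  rw [hF.closure_biUnion]
  refine biUnion hF fun I hI => ?_
  rw [closure_box]
  exact box fun i => (hFo I hI i).isPreconnected.closure.ordConnected

theorem interior (hS : IsBoxUnion S) : IsBoxUnion (interior S) := by
  rw [interior_eq_compl_closure_compl]
  exact hS.compl.closure.compl

theorem brick_eq_convexHull {a b : E3} (hab : ∀ i, a i ≤ b i) :
    ∃ F : Finset E3, _root_.brick a b = convexHull ℝ (F : Set E3) := by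
  classical
  set F : Finset E3 := (Fintype.piFinset fun i => ({a i, b i} : Finset ℝ)).image (WithLp.toLp 2)
  refine ⟨F, ?_⟩
  have h1 : (F : Set E3) = (WithLp.linearEquiv 2 ℝ (Fin 3 → ℝ)).symm.toLinearMap ''
      (univ.pi fun i => ({a i, b i} : Set ℝ)) := by
    ext x
    simp only [F, Finset.coe_image, mem_image, SetLike.mem_coe, Fintype.mem_piFinset, mem_pi,
      mem_univ, true_implies, Finset.mem_insert, Finset.mem_singleton, mem_insert_iff,
      mem_singleton_iff]
    rfl
  rw [h1, ← LinearMap.image_convexHull, convexHull_pi]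
  ext x
  simp only [_root_.brick, mem_ofPred_eq, mem_image, mem_pi, mem_univ, true_implies,
    convexHull_pair, segment_eq_Icc (hab _), mem_Icc]
  exact ⟨fun hx => ⟨x.ofLp, hx, rfl⟩, by rintro ⟨y, hy, rfl⟩; exact hy⟩

/-- A bounded regular open finite union of boxes is an open polytope. -/
theorem isOpenPolytope (hS : IsBoxUnion S) (ho : IsOpen S)
    (hr : _root_.interior (_root_.closure S) = S) (hb : Bornology.IsBounded S) :
    IsOpenPolytope S := by
  refine ⟨ho, hr, ?_⟩
  obtain ⟨F, hF, hFo, hSF⟩ := hS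
  set F' := {I ∈ F | ∃ x : E3, ∀ i, x i ∈ I i} with hF'
  have hF'fin : F'.Finite := hF.subset fun _ h => h.1
  refine ⟨(fun I => _root_.closure {x : E3 | ∀ i, x i ∈ I i}) '' F', ?_, ?_, ?_⟩
  · rintro _ ⟨I, ⟨hI, x, hx⟩, rfl⟩
    have hsub : {x : E3 | ∀ i, x i ∈ I i} ⊆ S := by
      rw [hSF]
      exact subset_biUnion_of_mem (u := fun I : Fin 3 → Set ℝ => {x : E3 | ∀ i, x i ∈ I i}) hI
    have hcc : ∀ i, ∃ a b, a ≤ b ∧ _root_.closure (I i) = Icc a b := by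
      intro i
      have hconn : IsConnected (_root_.closure (I i)) :=
        IsConnected.closure ⟨⟨_, hx i⟩, (hFo I hI i).isPreconnected⟩
      have hbd : Bornology.IsBounded (I i) := by
        obtain ⟨R, hR⟩ := (Metric.isBounded_iff_subset_closedBall 0).1 hb
        refine (Metric.isBounded_iff_subset_closedBall 0).2 ⟨R, fun t ht => ?_⟩
        have hmem : (vec (Function.update (fun i => x i) i t) : E3) ∈ S := by
          apply hsub
          intro j
          by_cases hj : j = i
          · subst hj; simpa using ht
          · simpa [Function.update_of_ne hj] using hx j
        have h1 := hR hmem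
        rw [mem_closedBall_zero_iff] at h1 ⊢
        refine le_trans ?_ h1
        have := PiLp.norm_apply_le (vec (Function.update (fun i => x i) i t)) i
        simpa using this
      have hcomp : IsCompact (_root_.closure (I i)) := hbd.isCompact_closure
      have heq := eq_Icc_of_connected_compact hconn hcomp
      refine ⟨_, _, ?_, heq⟩
      have := hconn.nonempty
      rw [heq] at this
      exact nonempty_Icc.1 this
    choose a b hab hI' using hcc
    have : _root_.closure {x : E3 | ∀ i, x i ∈ I i} = _root_.brick (vec a) (vec b) := by
      rw [closure_box]
      simp only [hI']
      rfl
    simp only [this]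
    exact brick_eq_convexHull hab
  · intro x r
    exact (hF'fin.image _).subset fun _ h => h.1
  · rw [sUnion_image, ← hF'fin.closure_biUnion, hSF]
    congr 1
    ext x
    simp only [mem_iUnion, mem_ofPred_eq, exists_prop, hF']
    exact ⟨fun ⟨I, hI, h⟩ => ⟨I, ⟨hI, x, h⟩, h⟩, fun ⟨I, hI, h⟩ => ⟨I, hI.1, h⟩⟩

end IsBoxUnion

theorem IsStarPrism.isBoxUnion {A : Set E3} (h : IsStarPrism A) : IsBoxUnion A := by
  obtain ⟨o, J, j₀, h₀, hJ, ho, hm, rfl⟩ := h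
  exact IsBoxUnion.biUnion J.finite_toSet fun j _ => IsBoxUnion.brick _ _

/-! ### The tiling given by nested solids -/

/-- Removing a closed set from a connected open set leaves a connected set, if the closed set has a
connected shell around it. -/
theorem IsConnected.diff_of_shell {X : Type*} [TopologicalSpace X] {N K O : Set X}
    (hN : IsConnected N) (hNo : IsOpen N) (hK : IsClosed K) (hO : IsOpen O) (hKO : K ⊆ O)
    (hON : O ⊆ N) (hc : IsConnected (O \ K)) : IsConnected (N \ K) := by
  refine ⟨hc.nonempty.mono (sdiff_subset_sdiff_left hON), ?_⟩
  rw [isPreconnected_iff_subset_of_disjoint]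
  -- a separation for which the shell lies on the side `U` has nothing on the side `W`
  have key : ∀ U W : Set X, IsOpen U → IsOpen W → N \ K ⊆ U ∪ W → N \ K ∩ (U ∩ W) = ∅ →
      O \ K ⊆ U → N \ K ⊆ U := by
    intro U W hU hW hsub hdis hOU
    have h1 := (isPreconnected_iff_subset_of_disjoint.1 hN.isPreconnected)
      ((N ∩ U) ∪ O) ((N \ K) ∩ W) ((hNo.inter hU).union hO) ((hNo.sdiff hK).inter hW) ?_ ?_
    · rcases h1 with h1 | h1
      · intro x hx
        rcases h1 hx.1 with h | h
        · exact h.2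
        · exact hOU ⟨h, hx.2⟩
      · intro x hx
        obtain ⟨y, hy⟩ := hc.nonempty
        have h2 := h1 (hON hy.1)
        have : y ∈ N \ K ∩ (U ∩ W) := ⟨h2.1, hOU hy, h2.2⟩
        rw [hdis] at this
        exact absurd this (notMem_empty y)
    · intro x hx
      by_cases hxK : x ∈ K
      · exact Or.inl (Or.inr (hKO hxK))
      · rcases hsub ⟨hx, hxK⟩ with h | h
        · exact Or.inl (Or.inl ⟨hx, h⟩)
        · exact Or.inr ⟨⟨hx, hxK⟩, h⟩
    · rw [eq_empty_iff_forall_notMem]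
      rintro x ⟨hxN, hx, hx2, hxW⟩
      have hxU : x ∈ U := by
        rcases hx with h | h
        · exact h.2
        · exact hOU ⟨h, hx2.2⟩
      have : x ∈ N \ K ∩ (U ∩ W) := ⟨hx2, hxU, hxW⟩
      rw [hdis] at this
      exact notMem_empty x this
  intro U W hU hW hsub hdis
  have h1 := (isPreconnected_iff_subset_of_disjoint.1 hc.isPreconnected) U W hU hW
    ((sdiff_subset_sdiff_left hON).trans hsub) (subset_eq_empty
      (inter_subset_inter_left _ (sdiff_subset_sdiff_left hON)) hdis)
  rcases h1 with h1 | h1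
  · exact Or.inl (key U W hU hW hsub hdis h1)
  · exact Or.inr (key W U hW hU (by rwa [union_comm]) (by rwa [inter_comm W U]) h1)

/-- A system of solids, one for each vertex of a one-ended tree, that are nested as the sets of
descendants of the vertices are. -/
structure IsNestedSystem {V : Type} (p : V → V) (A : V → Set E3) : Prop where
  star : ∀ v, IsStarPrism (A v)
  nest : ∀ v, A v ⊆ interior (A (p v))
  sib : ∀ v w, v ≠ w → p v = p w → Disjoint (A v) (A w)
  exhaust : ∀ r : ℝ, ∃ v a b, (∀ i, a i < b i) ∧ A v = brick a b ∧ Metric.ball 0 r ⊆ A v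

/-- The tile of a vertex: the interior of its solid without the solids of its children. -/
def nestedTile {V : Type} (p : V → V) (A : V → Set E3) (v : V) : Set E3 :=
  interior (A v) \ ⋃ c ∈ {c | p c = v}, A c

namespace IsNestedSystem

variable {V : Type} {G : SimpleGraph V} {p : V → V} {A : V → Set E3}

theorem finite_children (hp : IsParentMap G p) (v : V) : {c | p c = v}.Finite :=
  (hp.finite v).subset fun _ hc => ⟨1, hc⟩

theorem mono (hA : IsNestedSystem p A) {v w : V} (h : Below p v w) : A v ⊆ A w := by
  obtain ⟨k, rfl⟩ := h
  induction k with
  | zero => exact subset_refl _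
  | succ k ih =>
    rw [Function.iterate_succ_apply']
    exact ih.trans ((hA.nest _).trans interior_subset)

theorem disjoint_of_not_below (hA : IsNestedSystem p A) (hp : IsParentMap G p)
    (hG : G.Connected) {v w : V} (h : ¬ Below p v w) (h' : ¬ Below p w v) :
    Disjoint (A v) (A w) := by
  classical
  obtain ⟨u, ⟨k, hk⟩, hw⟩ := hp.exists_common hG v w
  have hex : ∃ k, Below p w (p^[k] v) := ⟨k, hk ▸ hw⟩
  -- the lowest ancestor of `v` that is above `w`
  have hk0 : Nat.find hex ≠ 0 := by
    intro h0
    have := Nat.find_spec hex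
    rw [h0] at this
    exact h' this
  obtain ⟨l, hl⟩ := Nat.exists_eq_succ_of_ne_zero hk0
  have hspec := Nat.find_spec hex
  have hmin : ¬ Below p w (p^[l] v) := Nat.find_min hex (by omega)
  rw [hl, Function.iterate_succ_apply'] at hspec
  have hne : w ≠ p (p^[l] v) := by
    rintro rfl
    exact h ⟨l + 1, Function.iterate_succ_apply' _ _ _⟩
  obtain ⟨z, hz, -, hwz⟩ := hspec.exists_child hne
  have hzl : p^[l] v ≠ z := by
    rintro rfl
    exact hmin hwz
  exact (hA.sib _ _ hzl hz.symm).mono (hA.mono ⟨l, rfl⟩) (hA.mono hwz)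

theorem disjoint_nestedTile_of_below (hA : IsNestedSystem p A) {v w : V} (h : Below p v w)
    (hne : v ≠ w) : Disjoint (A v) (nestedTile p A w) := by
  obtain ⟨z, hz, -, hvz⟩ := h.exists_child hne
  rw [Set.disjoint_left]
  intro x hx hxw
  exact hxw.2 (mem_biUnion (show z ∈ {c | p c = w} from hz) (hA.mono hvz hx))

theorem nestedTile_subset (v : V) : nestedTile p A v ⊆ A v := sdiff_subset.trans interior_subset

theorem disjoint_nestedTile (hA : IsNestedSystem p A) (hp : IsParentMap G p)
    (hG : G.Connected) {v w : V} (hne : v ≠ w) :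
    Disjoint (nestedTile p A v) (nestedTile p A w) := by
  by_cases h : Below p v w
  · exact (hA.disjoint_nestedTile_of_below h hne).mono_left (nestedTile_subset v)
  by_cases h' : Below p w v
  · exact ((hA.disjoint_nestedTile_of_below h' hne.symm).mono_left (nestedTile_subset w)).symm
  · exact (hA.disjoint_of_not_below hp hG h h').mono (nestedTile_subset v) (nestedTile_subset w)

theorem isClosed_children (hA : IsNestedSystem p A) (hp : IsParentMap G p) (v : V) :
    IsClosed (⋃ c ∈ {c | p c = v}, A c) :=
  (finite_children hp v).isClosed_biUnion fun c _ => (hA.star c).isCompact.isClosed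

theorem isOpen_nestedTile (hA : IsNestedSystem p A) (hp : IsParentMap G p) (v : V) :
    IsOpen (nestedTile p A v) := isOpen_interior.sdiff (hA.isClosed_children hp v)

theorem isConnected_nestedTile (hA : IsNestedSystem p A) (hp : IsParentMap G p) (v : V) :
    IsConnected (nestedTile p A v) := by
  have key : ∀ s : Set V, s.Finite → s ⊆ {c | p c = v} →
      IsConnected (interior (A v) \ ⋃ c ∈ s, A c) := by
    intro s hs
    induction s, hs using Set.Finite.induction_on with
    | empty =>
      intro _
      simpa using (hA.star v).isConnected_interior
    | @insert c s hc hs ih =>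
      intro hsub
      have ihc := ih ((subset_insert _ _).trans hsub)
      have hop : IsOpen (interior (A v) \ ⋃ c ∈ s, A c) :=
        isOpen_interior.sdiff (hs.isClosed_biUnion fun c _ => (hA.star c).isCompact.isClosed)
      have hcv : p c = v := hsub (mem_insert _ _)
      have hin : A c ⊆ interior (A v) \ ⋃ c ∈ s, A c := by
        intro x hx
        refine ⟨hcv ▸ hA.nest c hx, fun hx' => ?_⟩
        obtain ⟨c', hc', hxc'⟩ := mem_iUnion₂.1 hx'
        have hne : c ≠ c' := by rintro rfl; exact hc hc'
        have hc'v : p c' = v := hsub (mem_insert_of_mem _ hc')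
        exact Set.disjoint_left.1 (hA.sib c c' hne (hcv.trans hc'v.symm)) hx hxc'
      obtain ⟨O, hO, hKO, hON, hOc⟩ := (hA.star c).exists_shell hop hin
      have := ihc.diff_of_shell hop (hA.star c).isCompact.isClosed hO hKO hON hOc
      rwa [sdiff_sdiff, union_comm, ← biUnion_insert] at this
  exact key _ (finite_children hp v) (subset_refl _)

theorem closure_nestedTile (hA : IsNestedSystem p A) (hp : IsParentMap G p) (v : V) :
    closure (nestedTile p A v) = A v \ ⋃ c ∈ {c | p c = v}, interior (A c) := by
  apply Subset.antisymm
  · have hcl : IsClosed (A v \ ⋃ c ∈ {c | p c = v}, interior (A c)) :=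
      (hA.star v).isCompact.isClosed.sdiff (isOpen_biUnion fun _ _ => isOpen_interior)
    refine closure_minimal ?_ hcl
    exact sdiff_subset_sdiff interior_subset
      (biUnion_mono (subset_refl _) fun _ _ => interior_subset)
  · rintro x ⟨hx, hx'⟩
    rw [mem_closure_iff]
    intro N hN hxN
    by_cases hc : ∃ c, p c = v ∧ x ∈ A c
    · -- `x` lies on the frontier of the solid of a child
      obtain ⟨c, hc, hxc⟩ := hc
      have hxi : x ∉ interior (A c) := fun h => hx' (mem_biUnion (show c ∈ {c | p c = v} from hc) h)
      set W := N ∩ (interior (A v) \ ⋃ c' ∈ {c' | p c' = v} \ {c}, A c') with hW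
      have hWo : IsOpen W := hN.inter (isOpen_interior.sdiff
        (((finite_children hp v).subset sdiff_subset).isClosed_biUnion
          fun c _ => (hA.star c).isCompact.isClosed))
      have hxW : x ∈ W := by
        refine ⟨hxN, hc ▸ hA.nest c hxc, fun h => ?_⟩
        obtain ⟨c', ⟨hc', hne⟩, hxc'⟩ := mem_iUnion₂.1 h
        exact Set.disjoint_left.1 (hA.sib c c' (fun h => hne h.symm) (hc.trans hc'.symm)) hxc hxc'
      have hnot : ¬ W ⊆ A c := fun h => hxi (interior_maximal h hWo hxW)
      obtain ⟨y, hyW, hyc⟩ := not_subset.1 hnot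
      refine ⟨y, hyW.1, hyW.2.1, fun h => ?_⟩
      obtain ⟨c', hc', hyc'⟩ := mem_iUnion₂.1 h
      by_cases hcc : c' = c
      · exact hyc (hcc ▸ hyc')
      · exact hyW.2.2 (mem_biUnion (show c' ∈ {c' | p c' = v} \ {c} from ⟨hc', hcc⟩) hyc')
    · push Not at hc
      have hxcl := (hA.star v).subset_closure_interior hx
      have hW : IsOpen (N \ ⋃ c ∈ {c | p c = v}, A c) := hN.sdiff (hA.isClosed_children hp v)
      obtain ⟨y, hy, hyi⟩ := mem_closure_iff.1 hxcl _ hW ⟨hxN, fun h => by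
        obtain ⟨c, hc', hxc⟩ := mem_iUnion₂.1 h
        exact hc c hc' hxc⟩
      exact ⟨y, hy.1, hyi, hy.2⟩

theorem isOpenPolytope_nestedTile (hA : IsNestedSystem p A) (hp : IsParentMap G p) (v : V) :
    IsOpenPolytope (nestedTile p A v) := by
  refine IsBoxUnion.isOpenPolytope ?_ (hA.isOpen_nestedTile hp v) ?_
    ((hA.star v).isCompact.isBounded.subset (nestedTile_subset v))
  · exact (hA.star v).isBoxUnion.interior.inter
      (IsBoxUnion.biUnion (finite_children hp v) fun c _ => (hA.star c).isBoxUnion).compl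
  · apply Subset.antisymm
    · rw [hA.closure_nestedTile hp]
      intro x hx
      refine ⟨interior_mono sdiff_subset hx, fun hxc => ?_⟩
      obtain ⟨c, hc, hxc⟩ := mem_iUnion₂.1 hxc
      obtain ⟨y, hy, hyi⟩ := mem_closure_iff.1 ((hA.star c).subset_closure_interior hxc) _
        isOpen_interior hx
      exact (interior_subset hy).2 (mem_biUnion hc hyi)
    · exact interior_maximal subset_closure (hA.isOpen_nestedTile hp v)

theorem nestedTile_injective (hA : IsNestedSystem p A) (hp : IsParentMap G p)
    (hG : G.Connected) : Function.Injective (nestedTile p A) := by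
  intro v w h
  by_contra hne
  have h1 := hA.disjoint_nestedTile hp hG hne
  rw [h, disjoint_self] at h1
  exact (hA.isConnected_nestedTile hp w).nonempty.ne_empty h1

theorem exists_mem_closure (hA : IsNestedSystem p A) (hp : IsParentMap G p) {v : V} {x : E3}
    (hx : x ∈ A v) : ∃ u, x ∈ closure (nestedTile p A u) := by
  induction hn : sz p v using Nat.strong_induction_on generalizing v with
  | _ n ih =>
    by_cases hc : ∃ c, p c = v ∧ x ∈ A c
    · obtain ⟨c, hc, hxc⟩ := hc
      refine ih _ ?_ hxc rfl
      rw [← hn, ← hc]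
      exact hp.isForest.sz_lt (Below.parent c) (hp.ne c).symm
    · push Not at hc
      refine ⟨v, ?_⟩
      rw [hA.closure_nestedTile hp]
      refine ⟨hx, fun h => ?_⟩
      obtain ⟨c, hc', hxc⟩ := mem_iUnion₂.1 h
      exact hc c hc' (interior_subset hxc)

theorem isTiling (hA : IsNestedSystem p A) (hp : IsParentMap G p) (hG : G.Connected) :
    IsTiling (range (nestedTile p A)) where
  polytope := by
    rintro _ ⟨v, rfl⟩
    exact hA.isOpenPolytope_nestedTile hp v
  connected := by
    rintro _ ⟨v, rfl⟩
    exact hA.isConnected_nestedTile hp v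
  disjoint := by
    rintro _ ⟨v, rfl⟩ _ ⟨w, rfl⟩ hne
    exact hA.disjoint_nestedTile hp hG (fun h => hne (h ▸ rfl))
  cover := by
    refine eq_univ_of_forall fun x => ?_
    obtain ⟨v, a, b, -, -, hball⟩ := hA.exhaust (‖x‖ + 1)
    obtain ⟨u, hu⟩ := hA.exists_mem_closure hp (hball (by simp : x ∈ Metric.ball 0 (‖x‖ + 1)))
    exact mem_biUnion (mem_range_self u) hu
  locallyFinite := by
    intro x r
    obtain ⟨v, a, b, -, -, hball⟩ := hA.exhaust (‖x‖ + r)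
    have hsub : Metric.ball x r ⊆ A v := by
      refine Subset.trans (Metric.ball_subset_ball' ?_) hball
      rw [dist_zero_right, add_comm]
    refine ((hp.finite v).image (nestedTile p A)).subset ?_
    rintro _ ⟨⟨w, rfl⟩, y, hy, hyb⟩
    refine ⟨w, ?_, rfl⟩
    by_contra h
    by_cases h' : Below p v w
    · have hne : v ≠ w := by rintro rfl; exact h (Below.refl _)
      exact Set.disjoint_left.1 (hA.disjoint_nestedTile_of_below h' hne) (hsub hyb) hy
    · exact Set.disjoint_left.1 (hA.disjoint_of_not_below hp hG h h') (nestedTile_subset w hy)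
        (hsub hyb)

theorem isSolidWithHoles (hA : IsNestedSystem p A) (hp : IsParentMap G p) (v : V) :
    IsSolidWithHoles (A v) (nestedTile p A v) := by
  refine ⟨A '' {c | p c = v}, (finite_children hp v).image A, ?_, ?_, ?_⟩
  · rintro _ ⟨c, hc, rfl⟩
    have hc : p c = v := hc
    exact ⟨(hA.star c).isBrickSolid, hc ▸ hA.nest c⟩
  · rintro _ ⟨c, hc, rfl⟩ _ ⟨c', hc', rfl⟩ hne
    have hc : p c = v := hc
    exact hA.sib c c' (fun h => hne (h ▸ rfl)) (hc.trans (Eq.symm hc'))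
  · rw [sUnion_image]
    rfl

theorem isBrickTiling (hA : IsNestedSystem p A) (hp : IsParentMap G p) :
    IsBrickTiling (range (nestedTile p A)) := by
  constructor
  · rintro _ ⟨v, rfl⟩
    exact ⟨A v, (hA.star v).isBrickSolid, hA.isSolidWithHoles hp v⟩
  · intro r
    obtain ⟨v, a, b, hab, hAv, hball⟩ := hA.exhaust r
    exact ⟨_, mem_range_self v, a, b, hab, hAv ▸ hball, hAv ▸ hA.isSolidWithHoles hp v⟩

theorem shareFace_parent (hA : IsNestedSystem p A) (hp : IsParentMap G p) (v : V) :
    ShareFace (nestedTile p A v) (nestedTile p A (p v)) := by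
  obtain ⟨q, hq, hsub⟩ := (hA.star v).exists_triangle
  refine ⟨q, hq, fun x hx => ?_⟩
  obtain ⟨hx1, hx2⟩ := hsub hx
  rw [hA.closure_nestedTile hp, hA.closure_nestedTile hp]
  refine ⟨⟨hx1, fun h => ?_⟩, interior_subset (hA.nest v hx1), fun h => ?_⟩
  · obtain ⟨c, hc, hxc⟩ := mem_iUnion₂.1 h
    have hc : p c = v := hc
    exact hx2 (hc ▸ hA.nest c (interior_subset hxc))
  · obtain ⟨c, hc, hxc⟩ := mem_iUnion₂.1 h
    by_cases hcv : c = v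
    · exact hx2 (hcv ▸ hxc)
    · exact Set.disjoint_left.1 (hA.sib c v hcv hc) (interior_subset hxc) hx1

theorem disjoint_closure_of_below (hA : IsNestedSystem p A) (hp : IsParentMap G p) {v w : V}
    (h : Below p v w) (hne : v ≠ w) (hpv : p v ≠ w) :
    Disjoint (closure (nestedTile p A v)) (closure (nestedTile p A w)) := by
  obtain ⟨z, hz, -, hvz⟩ := h.exists_child hne
  have hvz' : v ≠ z := by rintro rfl; exact hpv hz
  have h1 : Below p (p v) z := (below_iff.1 hvz).resolve_left hvz'
  rw [hA.closure_nestedTile hp, hA.closure_nestedTile hp, Set.disjoint_left]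
  intro x hx hxw
  exact hxw.2 (mem_biUnion (show z ∈ {c | p c = w} from hz)
    (interior_mono (hA.mono h1) (hA.nest v hx.1)))

theorem adj_iff_shareFace (hA : IsNestedSystem p A) (hp : IsParentMap G p) (hG : G.Connected)
    {v w : V} (hne : v ≠ w) :
    ShareFace (nestedTile p A v) (nestedTile p A w) ↔ G.Adj v w := by
  rw [hp.adj]
  constructor
  · rintro ⟨q, -, hq⟩
    obtain ⟨hx1, hx2⟩ := hq (subset_convexHull ℝ _ (mem_range_self 0))
    by_contra! hcon
    by_cases h : Below p v w
    · exact Set.disjoint_left.1 (hA.disjoint_closure_of_below hp h hne hcon.1) hx1 hx2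
    by_cases h' : Below p w v
    · exact Set.disjoint_left.1 (hA.disjoint_closure_of_below hp h' hne.symm hcon.2) hx2 hx1
    · rw [hA.closure_nestedTile hp] at hx1 hx2
      exact Set.disjoint_left.1 (hA.disjoint_of_not_below hp hG h h') hx1.1 hx2.1
  · rintro (rfl | rfl)
    · exact hA.shareFace_parent hp v
    · obtain ⟨q, hq, hs⟩ := hA.shareFace_parent hp w
      exact ⟨q, hq, fun x hx => (hs hx).symm⟩

/-- The adjacency graph of the tiling is the tree. -/
noncomputable def iso (hA : IsNestedSystem p A) (hp : IsParentMap G p) (hG : G.Connected) :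
    G ≃g tileGraph (range (nestedTile p A)) where
  toEquiv := Equiv.ofInjective _ (hA.nestedTile_injective hp hG)
  map_rel_iff' := by
    intro v w
    simp only [tileGraph, Equiv.ofInjective_apply, ne_eq]
    constructor
    · rintro ⟨h1, h2⟩
      exact (hA.adj_iff_shareFace hp hG (fun h => h1 (by subst h; rfl))).1 h2
    · intro h
      exact ⟨fun h' => h.ne (hA.nestedTile_injective hp hG (congrArg Subtype.val h')),
        (hA.adj_iff_shareFace hp hG h.ne).2 h⟩

end IsNestedSystem

/-! ### A depth-first order of a finite tree -/

/-- The vertices of a finite forest can be ordered in such a way that the descendants of every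
vertex form an interval: insert the vertices one by one, each directly after its parent. -/
theorem IsForest.exists_order {V : Type*} [Fintype V] {p : V → V} (hp : IsForest p) :
    ∃ ord : V → ℕ, Function.Injective ord ∧ (∀ x, ord x < Fintype.card V) ∧
      ∀ x y z w, Below p y x → Below p z x → ord y ≤ ord w → ord w ≤ ord z → Below p w x := by
  classical
  have key : ∀ (n : ℕ) (S : Finset V), S.card = n → (∀ x ∈ S, p x ∈ S) →
      ∃ r : V → ℝ, (∀ x ∈ S, ∀ y ∈ S, r x = r y → x = y) ∧
        ∀ x ∈ S, ∀ y ∈ S, ∀ z ∈ S, ∀ w ∈ S, Below p y x → Below p z x → r y ≤ r w → r w ≤ r z →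
          Below p w x := by
    intro n
    induction n with
    | zero =>
      intro S hS _
      rw [Finset.card_eq_zero] at hS
      exact ⟨0, by simp [hS], by simp [hS]⟩
    | succ n ih =>
      intro S hS hup
      obtain ⟨x, hx, hmin⟩ := S.exists_min_image (sz p)
        (Finset.card_pos.1 (by omega))
      have hleaf : ∀ y ∈ S, Below p y x → y = x := by
        intro y hy hyx
        by_contra hne
        exact absurd (hp.sz_lt hyx hne) (not_lt.2 (hmin y hy))
      obtain ⟨r, hinj, hconv⟩ := ih (S.erase x) (by rw [Finset.card_erase_of_mem hx]; omega) (by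
        intro y hy
        rw [Finset.mem_erase] at hy ⊢
        refine ⟨fun h => hy.1 (hleaf y hy.2 (h ▸ Below.parent y)), hup y hy.2⟩)
      -- the new value lies above the value at the parent, or above everything
      obtain ⟨t, ht⟩ : ∃ t : ℝ, ∀ y ∈ S.erase x, (p x ≠ x → r (p x) < t ∧
          (r (p x) < r y → t < r y)) ∧ (p x = x → r y < t) := by
        by_cases hpx : p x = x
        · obtain ⟨t, ht⟩ := ((S.erase x).image r).bddAbove
          refine ⟨t + 1, fun y hy => ⟨fun h => absurd hpx h, fun _ => ?_⟩⟩
          have := ht (Finset.mem_coe.2 (Finset.mem_image_of_mem r hy))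
          linarith
        · by_cases hne : ((S.erase x).filter fun y => r (p x) < r y).Nonempty
          · obtain ⟨y₀, hy₀, hmin'⟩ := Finset.exists_min_image _ r hne
            rw [Finset.mem_filter] at hy₀
            refine ⟨(r (p x) + r y₀) / 2, fun y hy => ⟨fun _ => ⟨by linarith, fun h => ?_⟩,
              fun h => absurd h hpx⟩⟩
            have := hmin' y (Finset.mem_filter.2 ⟨hy, h⟩)
            linarith
          · refine ⟨r (p x) + 1, fun y hy => ⟨fun _ => ⟨by linarith, fun h => ?_⟩,
              fun h => absurd h hpx⟩⟩
            exact absurd ⟨y, Finset.mem_filter.2 ⟨hy, h⟩⟩ hne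
      have hpS : p x ≠ x → p x ∈ S.erase x := fun h => Finset.mem_erase.2 ⟨h, hup x hx⟩
      have hr : ∀ y ∈ S, y ≠ x → Function.update r x t y = r y := fun y _ h =>
        Function.update_of_ne h _ _
      have htne : ∀ y ∈ S, y ≠ x → r y ≠ t := by
        intro y hy hyx h
        have h1 := ht y (Finset.mem_erase.2 ⟨hyx, hy⟩)
        by_cases hpx : p x = x
        · exact absurd (h1.2 hpx) (by simp [h])
        · have h2 := h1.1 hpx
          exact absurd (h2.2 (h ▸ h2.1)) (by simp [h])
      refine ⟨Function.update r x t, ?_, ?_⟩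
      · intro y hy z hz h
        by_cases hyx : y = x
        · by_cases hzx : z = x
          · rw [hyx, hzx]
          · rw [hyx, Function.update_self, hr z hz hzx] at h
            exact absurd h.symm (htne z hz hzx)
        · by_cases hzx : z = x
          · rw [hzx, Function.update_self, hr y hy hyx] at h
            exact absurd h (htne y hy hyx)
          · rw [hr y hy hyx, hr z hz hzx] at h
            exact hinj y (Finset.mem_erase.2 ⟨hyx, hy⟩) z (Finset.mem_erase.2 ⟨hzx, hz⟩) h
      · intro v hv y hy z hz w hw hyv hzv hyw hwz
        by_cases hvx : v = x
        · subst hvx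
          rw [hleaf y hy hyv] at hyw
          rw [hleaf z hz hzv] at hwz
          by_cases hwv : w = v
          · rw [hwv]; exact Below.refl _
          · rw [Function.update_self, hr w hw hwv] at hyw hwz
            exact absurd (le_antisymm hwz hyw) (htne w hw hwv)
        have hmem : ∀ {u}, u ∈ S → u ≠ x → u ∈ S.erase x := fun h h' =>
          Finset.mem_erase.2 ⟨h', h⟩
        have hxv : Below p x v → p x ≠ x ∧ Below p (p x) v := by
          intro h
          have h1 := (below_iff.1 h).resolve_left (Ne.symm hvx)
          refine ⟨fun h2 => hvx ?_, h1⟩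
          obtain ⟨k, hk⟩ := h
          rw [← hk, Function.iterate_fixed h2]
        by_cases hwx : w = x
        · subst hwx
          by_cases hyx : y = w
          · rwa [hyx] at hyv
          by_cases hzx : z = w
          · rwa [hzx] at hzv
          rw [Function.update_self, hr y hy hyx] at hyw
          rw [Function.update_self, hr z hz hzx] at hwz
          have h1 := ht y (hmem hy hyx)
          have h2 := ht z (hmem hz hzx)
          by_cases hpx : p w = w
          · exact absurd (h2.2 hpx) (not_lt.2 hwz)
          · refine (Below.parent w).trans (hconv v (hmem hv hvx) y (hmem hy hyx) z (hmem hz hzx)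
              (p w) (hpS hpx) hyv hzv ?_ ?_)
            · by_contra! hlt
              exact absurd ((h1.1 hpx).2 hlt) (not_lt.2 hyw)
            · exact ((h1.1 hpx).1.trans_le hwz).le
        · rw [hr w hw hwx] at hyw hwz
          have h3 := ht w (hmem hw hwx)
          obtain ⟨y', hy', hyv', hyw'⟩ : ∃ y' ∈ S.erase x, Below p y' v ∧ r y' ≤ r w := by
            by_cases hyx : y = x
            · rw [hyx] at hyv
              obtain ⟨h4, h5⟩ := hxv hyv
              rw [hyx, Function.update_self] at hyw
              exact ⟨p x, hpS h4, h5, ((h3.1 h4).1.trans_le hyw).le⟩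
            · rw [hr y hy hyx] at hyw
              exact ⟨y, hmem hy hyx, hyv, hyw⟩
          obtain ⟨z', hz', hzv', hwz'⟩ : ∃ z' ∈ S.erase x, Below p z' v ∧ r w ≤ r z' := by
            by_cases hzx : z = x
            · rw [hzx] at hzv
              obtain ⟨h4, h5⟩ := hxv hzv
              rw [hzx, Function.update_self] at hwz
              refine ⟨p x, hpS h4, h5, ?_⟩
              by_contra! hlt
              exact absurd ((h3.1 h4).2 hlt) (not_lt.2 hwz)
            · rw [hr z hz hzx] at hwz
              exact ⟨z, hmem hz hzx, hzv, hwz⟩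
          exact hconv v (hmem hv hvx) y' hy' z' hz' w (hmem hw hwx) hyv' hzv' hyw' hwz'
  obtain ⟨r, hinj, hconv⟩ := key _ Finset.univ rfl (by simp)
  -- replace the values by their ranks
  have hlt : ∀ x y, r x < r y → (Finset.univ.filter fun u => r u < r x).card <
      (Finset.univ.filter fun u => r u < r y).card := by
    intro x y h
    refine Finset.card_lt_card ⟨?_, fun hsub => ?_⟩
    · intro u hu
      simp only [Finset.mem_filter, Finset.mem_univ, true_and] at hu ⊢
      exact hu.trans h
    · have := hsub (Finset.mem_filter.2 ⟨Finset.mem_univ x, h⟩)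
      simp at this
  have hle : ∀ x y, (Finset.univ.filter fun u => r u < r x).card ≤
      (Finset.univ.filter fun u => r u < r y).card → r x ≤ r y := by
    intro x y h
    by_contra! hcon
    exact absurd (hlt y x hcon) (not_lt.2 h)
  refine ⟨fun x => (Finset.univ.filter fun u => r u < r x).card, ?_, ?_, ?_⟩
  · intro x y h
    exact hinj x (Finset.mem_univ x) y (Finset.mem_univ y)
      (le_antisymm (hle _ _ h.le) (hle _ _ h.ge))
  · intro x
    rw [← Finset.card_univ]
    refine Finset.card_lt_card ⟨Finset.subset_univ _, fun hsub => ?_⟩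
    have := hsub (Finset.mem_univ x)
    simp at this
  · intro x y z w hy hz h h'
    exact hconv x (Finset.mem_univ x) y (Finset.mem_univ y) z (Finset.mem_univ z) w
      (Finset.mem_univ w) hy hz (hle _ _ h) (hle _ _ h')

/-! ### Stacking boxes in two columns -/

/-- Items of heights `h` are stacked in two columns: up the first one and then down the second one,
in the given order. The other elements get thin slabs in the gaps between consecutive items. -/
theorem exists_stacking {R : Type*} [Fintype R] (ord : R → ℕ) (hinj : Function.Injective ord)
    (hord : ∀ x, ord x < Fintype.card R) (I : Finset R) (h : R → ℕ) (hmax H : ℕ)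
    (hh : ∀ x ∈ I, 1 ≤ h x ∧ h x ≤ hmax)
    (hfit : ∑ x ∈ I, (h x + 1) + 2 * hmax + 8 ≤ 2 * H) :
    ∃ (col : R → Fin 3) (zlo zhi : R → ℝ) (t : R → ℤ) (η : ℝ), 0 < η ∧ η ≤ 1 / 4 ∧
      (∀ x, col x = 0 ∨ col x = 1) ∧ (∀ x y, ord x < ord y → col y = 0 → col x = 0) ∧
      (∀ x y, ord x < ord y → col x = 0 → col y = 0 → zhi x + η ≤ zlo y) ∧
      (∀ x y, ord x < ord y → col x = 1 → col y = 1 → zhi y + η ≤ zlo x) ∧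
      (∀ x, 5 / 4 ≤ zlo x ∧ zlo x < zhi x ∧ zhi x + η ≤ H - 2) ∧
      ∀ x ∈ I, zlo x = t x ∧ zhi x = t x + h x ∧ 1 ≤ t x ∧ t x + h x + 1 ≤ H := by
  classical
  set N : ℝ := ((Fintype.card R : ℕ) : ℝ) with hN
  set S := ∑ x ∈ I, (h x + 1) with hS
  -- each item is given its height and a gap of one; `pre` and `suf` measure what comes before and
  -- after `x`, and `x` goes to the first column if it ends in the first half of the total height
  set pre : R → ℕ := fun x => ∑ y ∈ I.filter (fun y => ord y < ord x), (h y + 1) with hpre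
  set suf : R → ℕ := fun x => ∑ y ∈ I.filter (fun y => ord x < ord y), (h y + 1) with hsuf
  set len : R → ℕ := fun x => if x ∈ I then h x + 1 else 0 with hlen
  set M := (S + 1) / 2 with hM
  have hlen_eq : ∀ x, len x = ∑ y ∈ I.filter (fun y => y = x), (h y + 1) := by
    intro x
    rw [Finset.sum_filter, Finset.sum_ite_eq' I x]
  have hsum : ∀ x, pre x + len x + suf x = S := by
    intro x
    rw [hlen_eq, ← Finset.sum_union, ← Finset.sum_union]
    · congr 1
      ext y
      simp only [Finset.mem_union, Finset.mem_filter]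
      rcases lt_trichotomy (ord y) (ord x) with h1 | h1 | h1
      · tauto
      · have := hinj h1; tauto
      · tauto
    · rw [Finset.disjoint_left]
      intro y hy hy'
      simp only [Finset.mem_union, Finset.mem_filter] at hy hy'
      rcases hy with hy | ⟨-, rfl⟩ <;> omega
    · rw [Finset.disjoint_left]
      intro y hy hy'
      simp only [Finset.mem_filter] at hy hy'
      rw [hy'.2] at hy
      omega
  have hpre_le : ∀ x y, ord x < ord y → pre x + len x ≤ pre y := by
    intro x y hxy
    rw [hlen_eq, ← Finset.sum_union]
    · refine Finset.sum_le_sum_of_subset fun u hu => ?_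
      simp only [Finset.mem_union, Finset.mem_filter] at hu ⊢
      rcases hu with hu | ⟨hu, rfl⟩
      · exact ⟨hu.1, hu.2.trans hxy⟩
      · exact ⟨hu, hxy⟩
    · rw [Finset.disjoint_left]
      intro u hu hu'
      simp only [Finset.mem_filter] at hu hu'
      rw [hu'.2] at hu
      omega
  have hsuf_le : ∀ x y, ord x < ord y → suf y + len y ≤ suf x := by
    intro x y hxy
    have h1 := hsum x
    have h2 := hsum y
    have h3 := hpre_le x y hxy
    omega
  set c0 : R → Prop := fun x => pre x + len x ≤ M with hc0
  set q : R → ℕ := fun x => if c0 x then pre x else suf x with hq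
  -- items start at integers; the others are slabs in the gap of one unit that ends at `2 + q x`,
  -- and `k` gives their order within that gap
  set k : R → ℝ := fun x => if c0 x then (ord x : ℝ) else N - 1 - ord x with hk
  set zlo : R → ℝ := fun x => 2 + q x + (if x ∈ I then 0 else -(3 / 4) + k x / (2 * N)) with hzlo
  set zhi : R → ℝ := fun x => zlo x + (if x ∈ I then (h x : ℝ) else 1 / (8 * N)) with hzhi
  by_cases hR : IsEmpty R
  · exact ⟨fun _ => 0, fun _ => 0, fun _ => 0, fun _ => 0, 1 / 4, by norm_num, le_refl _,
      fun x => isEmptyElim x, fun x => isEmptyElim x, fun x => isEmptyElim x,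
      fun x => isEmptyElim x, fun x => isEmptyElim x, fun x => isEmptyElim x⟩
  rw [not_isEmpty_iff] at hR
  have hN1 : 1 ≤ N := by
    rw [hN]
    exact_mod_cast Fintype.card_pos
  have hordN : ∀ x, (ord x : ℝ) + 1 ≤ N := fun x => by
    rw [hN]
    exact_mod_cast hord x
  have hk0 : ∀ x, 0 ≤ k x ∧ k x + 1 ≤ N := by
    intro x
    have h1 := hordN x
    have h2 : (0 : ℝ) ≤ ord x := Nat.cast_nonneg _
    simp only [hk]
    split_ifs <;> constructor <;> linarith
  have hη : 0 < 1 / (8 * N) := by positivity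
  have hη' : 1 / (8 * N) ≤ 1 / 8 := by
    apply one_div_le_one_div_of_le <;> linarith
  have hkN : ∀ x, 0 ≤ k x / (2 * N) ∧ k x / (2 * N) + 4 * (1 / (8 * N)) ≤ 1 / 2 := by
    intro x
    obtain ⟨h1, h2⟩ := hk0 x
    refine ⟨by positivity, ?_⟩
    rw [show k x / (2 * N) + 4 * (1 / (8 * N)) = (k x + 1) / (2 * N) by field_simp; ring,
      div_le_iff₀ (by positivity)]
    linarith
  -- the separation of two consecutive elements of one column
  have hsep : ∀ x y, q x + len x ≤ q y → k x + 1 ≤ k y → zhi x + 1 / (8 * N) ≤ zlo y := by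
    intro x y h1 h2
    have h1' : (q x : ℝ) + len x ≤ q y := by exact_mod_cast h1
    obtain ⟨a1, a2⟩ := hkN x
    obtain ⟨b1, b2⟩ := hkN y
    have h3 : k x / (2 * N) + 4 * (1 / (8 * N)) ≤ k y / (2 * N) := by
      rw [show k x / (2 * N) + 4 * (1 / (8 * N)) = (k x + 1) / (2 * N) by field_simp; ring]
      exact div_le_div_of_nonneg_right h2 (by positivity)
    simp only [hzhi, hzlo]
    by_cases hx : x ∈ I <;> by_cases hy : y ∈ I <;> simp only [hx, hy, if_true, if_false] <;>
      simp only [hlen, hx, if_true, if_false, Nat.cast_add, Nat.cast_one, Nat.cast_zero] at h1' <;>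
      linarith
  have hqb : ∀ x, q x + len x + 4 ≤ H := by
    intro x
    simp only [hq]
    have h1 := hsum x
    have h2 : len x ≤ hmax + 1 := by
      simp only [hlen]
      split_ifs with hx
      · have := (hh x hx).2; omega
      · omega
    split_ifs with hc
    · simp only [hc0] at hc
      omega
    · simp only [hc0] at hc
      omega
  refine ⟨fun x => if c0 x then 0 else 1, zlo, zhi, fun x => 2 + q x, 1 / (8 * N), hη,
    by linarith, ?_, ?_, ?_, ?_, ?_, ?_⟩
  · intro x
    dsimp only
    split_ifs
    exacts [Or.inl rfl, Or.inr rfl]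
  · intro x y hxy hy
    have hy' : c0 y := by
      by_contra hcon
      simp [hcon] at hy
    have h1 := hpre_le x y hxy
    have : c0 x := by
      simp only [hc0] at hy' ⊢
      omega
    simp [this]
  · intro x y hxy hx hy
    have hx' : c0 x := by
      by_contra hcon
      simp [hcon] at hx
    have hy' : c0 y := by
      by_contra hcon
      simp [hcon] at hy
    refine hsep x y ?_ ?_
    · simp only [hq, hx', hy', if_true]
      exact hpre_le x y hxy
    · simp only [hk, hx', hy', if_true]
      exact_mod_cast hxy
  · intro x y hxy hx hy
    have hx' : ¬ c0 x := by
      intro hcon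
      simp [hcon] at hx
    have hy' : ¬ c0 y := by
      intro hcon
      simp [hcon] at hy
    refine hsep y x ?_ ?_
    · simp only [hq, hx', hy', if_false]
      exact hsuf_le x y hxy
    · simp only [hk, hx', hy', if_false]
      have : (ord x : ℝ) + 1 ≤ ord y := by exact_mod_cast hxy
      linarith
  · intro x
    obtain ⟨a1, a2⟩ := hkN x
    have hq0 : (0 : ℝ) ≤ q x := Nat.cast_nonneg _
    have hqb := hqb x
    have hqb' : (q x : ℝ) + len x + 4 ≤ H := by exact_mod_cast hqb
    simp only [hzhi, hzlo]
    by_cases hx : x ∈ I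
    · simp only [hlen, hx, if_true, Nat.cast_add, Nat.cast_one] at hqb' ⊢
      have h1 : (1 : ℝ) ≤ h x := by exact_mod_cast (hh x hx).1
      refine ⟨by linarith, by linarith, by linarith⟩
    · simp only [hlen, hx, if_false, Nat.cast_zero] at hqb' ⊢
      refine ⟨by linarith, by linarith, by linarith⟩
  · intro x hx
    have hqb := hqb x
    simp only [hlen, hx, if_true] at hqb
    refine ⟨?_, ?_, ?_, ?_⟩
    · simp [hzlo, hx]
    · simp [hzhi, hzlo, hx]
    · dsimp only
      omega
    · dsimp only
      omega

/-- The dimensions of a box with base `b` and height `h`. -/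
def boxDim (b : Fin 3 → ℕ) (h : ℕ) (i : Fin 3) : ℕ := if i = 2 then h else b i

/-- The base of a box that holds two columns of boxes with base `b`, side by side in direction `a`,
with room around and between them. -/
def foldBase (a : Fin 3) (b : Fin 3 → ℕ) (i : Fin 3) : ℕ := if i = a then 2 * b i + 3 else b i + 2

theorem exists_choice_min {R : Type*} (D : R → Finset R) (P : R → Prop) (f : R → ℝ) :
    ∃ g : R → ℝ, ∀ x, (∃ u ∈ D x, P u) →
      (∀ u ∈ D x, P u → g x ≤ f u) ∧ ∃ u ∈ D x, P u ∧ g x = f u := by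
  classical
  have : ∀ x, ∃ g : ℝ, (∃ u ∈ D x, P u) →
      (∀ u ∈ D x, P u → g ≤ f u) ∧ ∃ u ∈ D x, P u ∧ g = f u := by
    intro x
    by_cases h : ((D x).filter P).Nonempty
    · obtain ⟨u, hu, hmin⟩ := Finset.exists_min_image _ f h
      rw [Finset.mem_filter] at hu
      exact ⟨f u, fun _ => ⟨fun w hw hw' => hmin w (Finset.mem_filter.2 ⟨hw, hw'⟩),
        u, hu.1, hu.2, rfl⟩⟩
    · exact ⟨0, fun ⟨u, hu, hu'⟩ => absurd ⟨u, Finset.mem_filter.2 ⟨hu, hu'⟩⟩ h⟩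
  choose g hg using this
  exact ⟨g, hg⟩

theorem exists_choice_max {R : Type*} (D : R → Finset R) (P : R → Prop) (f : R → ℝ) :
    ∃ g : R → ℝ, ∀ x, (∃ u ∈ D x, P u) →
      (∀ u ∈ D x, P u → f u ≤ g x) ∧ ∃ u ∈ D x, P u ∧ g x = f u := by
  obtain ⟨g, hg⟩ := exists_choice_min D P (fun u => -f u)
  refine ⟨fun x => -g x, fun x hx => ?_⟩
  obtain ⟨h1, u, hu, hu', h2⟩ := hg x hx
  exact ⟨fun w hw hw' => le_neg.1 (h1 w hw hw'), u, hu, hu', by simp [h2]⟩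

theorem disjoint_brick {a b a' b' : E3} (i : Fin 3) (h : b i < a' i) :
    Disjoint (brick a b) (brick a' b') := by
  rw [Set.disjoint_left]
  intro x hx hx'
  exact absurd ((hx' i).1.trans (hx i).2) (not_le.2 h)

set_option maxHeartbeats 2000000 in
/-- Given finite sets `D x`, nested or disjoint, and an order for which they are intervals, there
are solids `A x` with the same nesting, such that the solid of an item is a box of prescribed
dimensions. The solid of `x` is the thickened hull of the elements of `D x` in a stack of two
columns; if `D x` meets both columns, then the parts in the columns extend up to a common strip
that joins the columns at the top. -/
theorem exists_layout {R : Type*} [Fintype R] (D : R → Finset R) (hself : ∀ x, x ∈ D x)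
    (ord : R → ℕ) (hinj : Function.Injective ord) (hord : ∀ x, ord x < Fintype.card R)
    (hconv : ∀ x, ∀ y ∈ D x, ∀ z ∈ D x, ∀ w, ord y ≤ ord w → ord w ≤ ord z → w ∈ D x)
    (I : Finset R) (hI : ∀ x ∈ I, D x = {x}) (h : R → ℕ) (hmax H : ℕ)
    (hh : ∀ x ∈ I, 1 ≤ h x ∧ h x ≤ hmax)
    (hfit : ∑ x ∈ I, (h x + 1) + 2 * hmax + 8 ≤ 2 * H)
    (a : Fin 3) (ha : a ≠ 2) (b : Fin 3 → ℕ) (hb : ∀ i, 1 ≤ b i) :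
    ∃ (τ : R → Fin 3 → ℤ) (A : R → Set E3), (∀ x, IsStarPrism (A x)) ∧
      (∀ x ∈ I, A x = brick (vec fun i => τ x i) (vec fun i => τ x i + boxDim b (h x) i)) ∧
      (∀ x y, D x ⊂ D y → A x ⊆ interior (A y)) ∧
      (∀ x y, Disjoint (D x) (D y) → Disjoint (A x) (A y)) ∧
      (∀ x, A x ⊆ openBrick (vec fun _ => 0) (vec fun i => boxDim (foldBase a b) H i)) ∧
      ∀ x ∈ I, ∀ i, 1 ≤ τ x i ∧
        τ x i + boxDim b (h x) i + 1 ≤ boxDim (foldBase a b) H i := by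
  classical
  obtain ⟨col, zlo, zhi, t, η, hη, hη', hcol, hmono, hsep0, hsep1, hz, hIt⟩ :=
    exists_stacking ord hinj hord I h hmax H hh hfit
  obtain ⟨o, hoa, ho2, hcases⟩ : ∃ o : Fin 3, o ≠ a ∧ o ≠ 2 ∧ ∀ i, i = a ∨ i = o ∨ i = 2 := by
    fin_cases a
    · exact ⟨1, by decide, by decide, by decide⟩
    · exact ⟨0, by decide, by decide, by decide⟩
    · exact absurd rfl ha
  choose zl hzl using fun j : Fin 3 => exists_choice_min D (fun u => col u = j) zlo
  choose zh hzh using fun j : Fin 3 => exists_choice_max D (fun u => col u = j) zhi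
  set has : Fin 3 → R → Prop := fun j x => ∃ u ∈ D x, col u = j with hhas
  set both : R → Prop := fun x => has 0 x ∧ has 1 x with hboth
  set J : R → Finset (Fin 3) := fun x =>
    Finset.univ.filter fun j => if j = 2 then both x else has j x with hJ
  -- the corners of the pieces before thickening: the pieces `0` and `1` of `x` are the hulls of the
  -- elements of `D x` in the two columns, and the piece `2` is the strip that joins the columns
  set L : R → Fin 3 → Fin 3 → ℝ := fun x j i =>
    if i = 2 then (if j = 2 then (H : ℝ) - 2 else zl j x)
    else if i = a then (if j = 1 then 2 + b a else 1) else 1 with hL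
  set U : R → Fin 3 → Fin 3 → ℝ := fun x j i => if i = 2 then
      (if j = 2 then (H : ℝ) - 1 else if both x then (H : ℝ) - 1 else zh j x)
    else if i = a then (if j = 0 then 1 + b a else 2 + 2 * b a) else 1 + b o with hU
  have hcard : ∀ x : R, (0 : ℝ) < Fintype.card R := fun x => by
    exact_mod_cast Fintype.card_pos_iff.2 ⟨x⟩
  -- the thickening grows with `D x`, so that nested sets get strictly nested solids
  set δ : R → ℝ := fun x => η / (4 * Fintype.card R) * ((D x).card - 1) with hδ
  have hδ0 : ∀ x, 0 ≤ δ x := by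
    intro x
    have h1 : (1 : ℝ) ≤ (D x).card := by exact_mod_cast Finset.card_pos.2 ⟨x, hself x⟩
    have := hcard x
    exact mul_nonneg (by positivity) (by linarith)
  have hδ1 : ∀ x, δ x ≤ η / 4 := by
    intro x
    have h1 : ((D x).card : ℝ) ≤ Fintype.card R := by exact_mod_cast Finset.card_le_univ _
    have h2 := hcard x
    have h3 : δ x ≤ η / (4 * Fintype.card R) * Fintype.card R :=
      mul_le_mul_of_nonneg_left (by linarith) (by positivity)
    refine h3.trans (le_of_eq ?_)
    field_simp
  have hδlt : ∀ x y, D x ⊂ D y → δ x < δ y := by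
    intro x y hxy
    have h1 : ((D x).card : ℝ) < (D y).card := by exact_mod_cast Finset.card_lt_card hxy
    have := hcard x
    exact mul_lt_mul_of_pos_left (by linarith) (by positivity)
  have hzl5 : ∀ j x, has j x → 5 / 4 ≤ zl j x ∧ zl j x + η < H - 2 := by
    intro j x hx
    obtain ⟨-, u, -, -, h1⟩ := hzl j x hx
    rw [h1]
    have := hz u
    constructor <;> linarith
  have hzh5 : ∀ j x, has j x → zh j x + η ≤ H - 2 := by
    intro j x hx
    obtain ⟨-, u, -, -, h1⟩ := hzh j x hx
    rw [h1]
    have := hz u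
    linarith
  have hzlh : ∀ j x, has j x → zl j x < zh j x := by
    intro j x hx
    obtain ⟨h1, u, hu, hu', -⟩ := hzl j x hx
    have h2 := (hzh j x hx).1 u hu hu'
    have h3 := h1 u hu hu'
    have := hz u
    linarith
  have hbR : ∀ i, (1 : ℝ) ≤ b i := fun i => by exact_mod_cast hb i
  have hbo := hbR o
  have hba := hbR a
  have hJ2 : ∀ {x}, (2 : Fin 3) ∈ J x ↔ both x := by simp [hJ]
  have hJ0 : ∀ {x}, (0 : Fin 3) ∈ J x ↔ has 0 x := by simp [hJ]
  have hJ1 : ∀ {x}, (1 : Fin 3) ∈ J x ↔ has 1 x := by simp [hJ]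
  have hJne : ∀ {x j}, j ∈ J x → j ≠ 2 → has j x := by
    intro x j hj hj2
    simpa [hJ, hj2] using hj
  have hLU : ∀ x, ∀ j ∈ J x, ∀ i, L x j i < U x j i := by
    intro x j hj i
    rcases hcases i with rfl | rfl | rfl
    · simp only [hL, hU, ha, if_false, if_true]
      split_ifs with h1 h2 <;> first | linarith | (subst h1; simp at h2)
    · simp only [hL, hU, ho2, hoa, if_false]
      linarith
    · simp only [hL, hU, if_true]
      by_cases hj2 : j = 2
      · simp only [hj2, if_true]; linarith
      · have h1 := hJne hj hj2
        have h2 := hzl5 j x h1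
        have h3 := hzlh j x h1
        simp only [hj2, if_false]
        split_ifs <;> linarith
  set A : R → Set E3 := fun x => ⋃ j ∈ J x,
    brick (vec fun i => L x j i - δ x) (vec fun i => U x j i + δ x) with hA
  have hJnonempty : ∀ x, ∃ j ∈ J x, (j = 2 ∨ ¬ both x) := by
    intro x
    by_cases hbx : both x
    · exact ⟨2, hJ2.2 hbx, Or.inl rfl⟩
    · rcases hcol x with h1 | h1
      · exact ⟨0, hJ0.2 ⟨x, hself x, h1⟩, Or.inr hbx⟩
      · exact ⟨1, hJ1.2 ⟨x, hself x, h1⟩, Or.inr hbx⟩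
  have hsingle : ∀ x, ¬ both x → ∀ j ∈ J x, ∀ j' ∈ J x, j = j' := by
    intro x hbx j hj j' hj'
    have key : ∀ j ∈ J x, (j = 0 ∧ has 0 x) ∨ (j = 1 ∧ has 1 x) := by
      intro j hj
      fin_cases j
      · exact Or.inl ⟨rfl, hJ0.1 hj⟩
      · exact Or.inr ⟨rfl, hJ1.1 hj⟩
      · exact absurd (hJ2.1 hj) hbx
    rcases key j hj with ⟨h1, h2⟩ | ⟨h1, h2⟩ <;> rcases key j' hj' with ⟨h3, h4⟩ | ⟨h3, h4⟩
    · rw [h1, h3]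
    · exact absurd ⟨h2, h4⟩ hbx
    · exact absurd ⟨h4, h2⟩ hbx
    · rw [h1, h3]
  have hstar : ∀ x, IsStarPrism (A x) := by
    intro x
    obtain ⟨j₀, hj₀, hcase⟩ := hJnonempty x
    have hd := hδ0 x
    refine ⟨o, (J x).image fun j => (vec fun i => L x j i - δ x, vec fun i => U x j i + δ x), _,
      Finset.mem_image_of_mem _ hj₀, ?_, ?_, ?_, ?_⟩
    · intro j hj i
      obtain ⟨k, hk, rfl⟩ := Finset.mem_image.1 hj
      have := hLU x k hk i
      dsimp only
      linarith
    · intro j hj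
      obtain ⟨k, hk, rfl⟩ := Finset.mem_image.1 hj
      simp only [hL, hU, ho2, hoa, if_false, and_self]
    · intro j hj i
      obtain ⟨k, hk, rfl⟩ := Finset.mem_image.1 hj
      rcases hcase with rfl | hbx
      · have hbx := hJ2.1 hj₀
        have h1 : L x k i < U x 2 i ∧ L x 2 i < U x k i := by
          have hlu := hLU x k hk i
          by_cases hj2 : k = 2
          · subst hj2; exact ⟨hlu, hlu⟩
          have h2 := hzl5 k x (hJne hk hj2)
          rcases hcases i with rfl | rfl | rfl
          · simp only [hL, hU, ha, if_false, if_true]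
            have h20 : ¬ (2 : Fin 3) = 0 := by decide
            have h21 : ¬ (2 : Fin 3) = 1 := by decide
            simp only [h20, h21, if_false]
            constructor <;> split_ifs <;> linarith
          · simp only [hL, hU, ho2, hoa, if_false]
            constructor <;> linarith
          · simp only [hL, hU, if_true, hj2, if_false, hbx]
            constructor <;> linarith
        dsimp only
        constructor <;> linarith [h1.1, h1.2]
      · obtain rfl := hsingle x hbx k hk j₀ hj₀
        have := hLU x k hk i
        dsimp only
        constructor <;> linarith
    · simp only [hA, Finset.set_biUnion_finset_image]
  refine ⟨fun x i => if i = 2 then t x else if i = a then (if col x = 0 then 1 else 2 + b a) else 1,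
    A, hstar, ?_, ?_, ?_, ?_, ?_⟩
  · intro x hx
    have hDx := hI x hx
    have hd : δ x = 0 := by simp [hδ, hDx]
    have hhas' : ∀ j, has j x ↔ j = col x := by
      intro j
      simp [hhas, hDx, eq_comm]
    have hnb : ¬ both x := by
      rintro ⟨h1, h2⟩
      rw [hhas'] at h1 h2
      rw [← h1] at h2
      exact absurd h2 (by decide)
    have hc2 : col x ≠ 2 := by
      rcases hcol x with h1 | h1 <;> rw [h1] <;> decide
    have hJx : J x = {col x} := by
      ext j
      simp only [hJ, Finset.mem_filter, Finset.mem_univ, true_and, Finset.mem_singleton]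
      split_ifs with hj
      · subst hj; simp [hnb, Ne.symm hc2]
      · exact hhas' j
    have hzlx : zl (col x) x = zlo x := by
      obtain ⟨-, u, hu, -, h1⟩ := hzl (col x) x ((hhas' _).2 rfl)
      rw [hDx, Finset.mem_singleton] at hu
      rw [h1, hu]
    have hzhx : zh (col x) x = zhi x := by
      obtain ⟨-, u, hu, -, h1⟩ := hzh (col x) x ((hhas' _).2 rfl)
      rw [hDx, Finset.mem_singleton] at hu
      rw [h1, hu]
    obtain ⟨e1, e2, -, -⟩ := hIt x hx
    have hcn : ¬ (col x = 0 ∧ col x = 1) := by rintro ⟨h1, h2⟩; rw [h1] at h2; simp at h2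
    simp only [hA, hJx, Finset.mem_singleton, iUnion_iUnion_eq_left, hd, sub_zero, add_zero]
    congr 1
    · ext i
      rcases hcases i with rfl | rfl | rfl
      · rcases hcol x with h1 | h1 <;> simp [hL, ha, h1]
      · simp [hL, ho2, hoa]
      · simp [hL, hc2, hzlx, e1]
    · ext i
      rcases hcases i with rfl | rfl | rfl
      · rcases hcol x with h1 | h1 <;> simp [hU, ha, h1, boxDim] <;> ring
      · simp [hU, ho2, hoa, boxDim]
      · simp [hU, hc2, hzhx, e2, hnb, boxDim]
  · intro x y hxy
    have hd := hδlt x y hxy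
    have hhm : ∀ j, has j x → has j y := fun j ⟨u, hu, hu'⟩ => ⟨u, hxy.1 hu, hu'⟩
    have hbm : both x → both y := fun hb => ⟨hhm _ hb.1, hhm _ hb.2⟩
    refine iUnion₂_subset fun j hj => ?_
    have hj' : j ∈ J y := by
      by_cases hj2 : j = 2
      · subst hj2; exact hJ2.2 (hbm (hJ2.1 hj))
      · simpa [hJ, hj2] using hhm j (hJne hj hj2)
    have hin : openBrick (vec fun i => L y j i - δ y) (vec fun i => U y j i + δ y) ⊆
        interior (A y) := by
      refine interior_maximal ?_ (isOpen_openBrick _ _)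
      exact (openBrick_subset_brick _ _).trans
        (subset_biUnion_of_mem (u := fun j => brick (vec fun i => L y j i - δ y)
          (vec fun i => U y j i + δ y)) hj')
    refine Subset.trans ?_ hin
    intro p hp i
    have hpi := hp i
    have h1 : L y j i ≤ L x j i ∧ U x j i ≤ U y j i := by
      rcases hcases i with rfl | rfl | rfl
      · simp only [hL, hU, ha, if_false, if_true, le_refl, and_self]
      · simp only [hL, hU, ho2, hoa, if_false, le_refl, and_self]
      · by_cases hj2 : j = 2
        · simp only [hL, hU, hj2, if_true, le_refl, and_self]
        · have hjx := hJne hj hj2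
          obtain ⟨-, u, hu, hu', h2⟩ := hzl j x hjx
          have h3 := (hzl j y (hhm j hjx)).1 u (hxy.1 hu) hu'
          obtain ⟨-, w, hw, hw', h4⟩ := hzh j x hjx
          have h5 := (hzh j y (hhm j hjx)).1 w (hxy.1 hw) hw'
          have h6 := hzh5 j x hjx
          simp only [hL, hU, hj2, if_true, if_false]
          refine ⟨by linarith, ?_⟩
          by_cases hbx : both x
          · simp only [hbx, hbm hbx, if_true, le_refl]
          · simp only [hbx, if_false]
            split_ifs <;> linarith
    dsimp only at hpi ⊢
    constructor <;> linarith
  · -- if `D x` comes before `D y`, the pieces are separated in one of the coordinates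
    have key : ∀ x y, (∀ u ∈ D x, ∀ w ∈ D y, ord u < ord w) → Disjoint (A x) (A y) := by
      intro x y hlt
      have hd := hδ1 x
      have hd' := hδ1 y
      have hdx := hδ0 x
      have hdy := hδ0 y
      have h10 : has 1 x → ¬ has 0 y := by
        rintro ⟨u, hu, hu'⟩ ⟨w, hw, hw'⟩
        rw [hmono u w (hlt u hu w hw) hw'] at hu'
        exact absurd hu' (by decide)
      have hsepb : ∀ j j' i, (U x j i + η ≤ L y j' i ∨ U y j' i + η ≤ L x j i) →
          Disjoint (brick (vec fun i => L x j i - δ x) (vec fun i => U x j i + δ x))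
            (brick (vec fun i => L y j' i - δ y) (vec fun i => U y j' i + δ y)) := by
        rintro j j' i (h1 | h1)
        · apply disjoint_brick i; dsimp only; linarith
        · apply Disjoint.symm; apply disjoint_brick i; dsimp only; linarith
      simp only [hA, Set.disjoint_iUnion_left, Set.disjoint_iUnion_right]
      intro j' hj' j hj
      have hnb : has 1 x → ¬ both y := fun h1 h2 => h10 h1 h2.1
      have hnb' : has 0 y → ¬ both x := fun h1 h2 => h10 h2.2 h1
      fin_cases j <;> fin_cases j'
      · -- both in the first column
        have hx := hJ0.1 hj
        have hy := hJ0.1 hj'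
        refine hsepb 0 0 2 (Or.inl ?_)
        obtain ⟨-, u, hu, hu', h1⟩ := hzh 0 x hx
        obtain ⟨-, w, hw, hw', h2⟩ := hzl 0 y hy
        have := hsep0 u w (hlt u hu w hw) hu' hw'
        simp [hU, hL, hnb' hy, h1, h2, this]
      · refine hsepb 0 1 a (Or.inl ?_)
        simp only [hU, hL, ha, if_true, if_false]
        linarith
      · have hx := hJ0.1 hj
        have hy := hJ2.1 hj'
        refine hsepb 0 2 2 (Or.inl ?_)
        have := hzh5 0 x hx
        simp [hU, hL, hnb' hy.1, this]
      · exact absurd (hJ0.1 hj') (h10 (hJ1.1 hj))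
      · have hx := hJ1.1 hj
        have hy := hJ1.1 hj'
        refine hsepb 1 1 2 (Or.inr ?_)
        obtain ⟨-, u, hu, hu', h1⟩ := hzl 1 x hx
        obtain ⟨-, w, hw, hw', h2⟩ := hzh 1 y hy
        have := hsep1 u w (hlt u hu w hw) hu' hw'
        simp [hU, hL, hnb hx, h1, h2, this]
      · exact absurd (hJ2.1 hj') (hnb (hJ1.1 hj))
      · exact absurd (hJ2.1 hj) (hnb' (hJ0.1 hj'))
      · have hx := hJ2.1 hj
        have hy := hJ1.1 hj'
        refine hsepb 2 1 2 (Or.inr ?_)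
        have := hzh5 1 y hy
        simp [hU, hL, hnb hx.2, this]
      · exact absurd (hJ2.1 hj') (hnb (hJ2.1 hj).2)
    intro x y hxy
    have hne : x ≠ y := by
      rintro rfl
      exact Finset.disjoint_left.1 hxy (hself x) (hself x)
    have hlt : ∀ x y, Disjoint (D x) (D y) → ord x < ord y →
        ∀ u ∈ D x, ∀ w ∈ D y, ord u < ord w := by
      intro x y hxy h1 u hu w hw
      have h2 : ord u < ord y := by
        by_contra! hcon
        exact Finset.disjoint_left.1 hxy (hconv x x (hself x) u hu y h1.le hcon) (hself y)
      by_contra! hcon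
      exact Finset.disjoint_left.1 hxy hu (hconv y w hw y (hself y) u hcon h2.le)
    rcases lt_or_gt_of_ne (fun h => hne (hinj h)) with h1 | h1
    · exact key x y (hlt x y hxy h1)
    · exact (key y x (hlt y x hxy.symm h1)).symm
  · intro x
    refine iUnion₂_subset fun j hj => ?_
    intro p hp i
    have hpi := hp i
    have hd := hδ1 x
    have h1 : 1 ≤ L x j i ∧ U x j i + 1 ≤ boxDim (foldBase a b) H i := by
      rcases hcases i with rfl | rfl | rfl
      · simp only [hL, hU, ha, if_false, if_true, boxDim, foldBase]
        push_cast
        constructor <;> split_ifs <;> linarith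
      · simp only [hL, hU, ho2, hoa, if_false, boxDim, foldBase]
        push_cast
        constructor <;> linarith
      · simp only [hL, hU, if_true, boxDim]
        by_cases hj2 : j = 2
        · have h2 := hzl5 _ _ (hJ2.1 (hj2 ▸ hj)).1
          simp only [hj2, if_true]
          constructor <;> linarith
        · have hjx := hJne hj hj2
          have h2 := hzl5 j x hjx
          have h3 := hzh5 j x hjx
          simp only [hj2, if_false]
          constructor
          · linarith
          · split_ifs <;> linarith
    dsimp only at hpi ⊢
    constructor <;> linarith
  · intro x hx i
    obtain ⟨-, -, e1, e2⟩ := hIt x hx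
    rcases hcases i with rfl | rfl | rfl
    · have h1 := hb i
      simp only [ha, if_false, if_true, boxDim, foldBase]
      push_cast
      split_ifs <;> omega
    · have h1 := hb i
      simp [boxDim, foldBase, ho2, hoa]
      omega
    · simp only [if_true, boxDim]
      omega

/-! ### Plans for finite trees -/

/-- The translate of `S` by the integer vector `τ`. -/
def shift (τ : Fin 3 → ℤ) (S : Set E3) : Set E3 := {x | x - latticePoint τ ∈ S}

theorem latticePoint_add (σ τ : Fin 3 → ℤ) :
    latticePoint (σ + τ) = latticePoint σ + latticePoint τ := by
  ext i
  simp [latticePoint]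

theorem shift_shift (σ τ : Fin 3 → ℤ) (S : Set E3) : shift σ (shift τ S) = shift (σ + τ) S := by
  ext x
  simp only [shift, mem_ofPred_eq, latticePoint_add]
  rw [sub_sub]

theorem shift_mono (τ : Fin 3 → ℤ) {S S' : Set E3} (h : S ⊆ S') : shift τ S ⊆ shift τ S' :=
  fun _ hx => h hx

theorem disjoint_shift (τ : Fin 3 → ℤ) {S S' : Set E3} (h : Disjoint S S') :
    Disjoint (shift τ S) (shift τ S') :=
  h.preimage _

theorem interior_shift (τ : Fin 3 → ℤ) (S : Set E3) :
    interior (shift τ S) = shift τ (interior S) :=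
  ((Homeomorph.subRight (latticePoint τ)).preimage_interior S).symm

theorem shift_brick (τ : Fin 3 → ℤ) (a b : E3) :
    shift τ (brick a b) = brick (a + latticePoint τ) (b + latticePoint τ) := by
  ext x
  simp [shift, brick, latticePoint, le_sub_iff_add_le]

theorem IsStarPrism.shift {A : Set E3} (h : IsStarPrism A) (τ : Fin 3 → ℤ) :
    IsStarPrism (shift τ A) := by
  classical
  obtain ⟨o, J, j₀, hj₀, h1, h2, h3, rfl⟩ := h
  refine ⟨o, J.image fun j => (j.1 + latticePoint τ, j.2 + latticePoint τ),
    (j₀.1 + latticePoint τ, j₀.2 + latticePoint τ), Finset.mem_image_of_mem _ hj₀, ?_, ?_, ?_, ?_⟩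
  · rw [Finset.forall_mem_image]
    exact fun j hj i => by simpa using h1 j hj i
  · rw [Finset.forall_mem_image]
    exact fun j hj => by simpa using h2 j hj
  · rw [Finset.forall_mem_image]
    exact fun j hj i => by simpa using h3 j hj i
  · ext x
    simp only [Finset.mem_image, iUnion_exists, biUnion_and', iUnion_iUnion_eq_right, mem_iUnion,
      ← shift_brick]
    simp [_root_.shift]

/-- The integer points of the half-open box with one corner at the origin and side lengths `D`. -/
noncomputable def latticeBox (D : Fin 3 → ℕ) : Finset (Fin 3 → ℤ) :=
  Fintype.piFinset fun i => Finset.Ico 0 (D i : ℤ)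

theorem mem_latticeBox {D : Fin 3 → ℕ} {z : Fin 3 → ℤ} :
    z ∈ latticeBox D ↔ ∀ i, 0 ≤ z i ∧ z i < D i := by
  simp [latticeBox]

theorem card_latticeBox (D : Fin 3 → ℕ) : (latticeBox D).card = ∏ i, D i := by
  simp [latticeBox]

/-- The brick of side lengths `D` with one corner at the origin. -/
noncomputable def cornerBrick (D : Fin 3 → ℕ) : Set E3 := brick (vec fun _ => 0) (vec fun i => D i)

/-- A grid box filled with vertices, and a solid for each vertex. -/
structure Plan (V : Type*) where
  site : (Fin 3 → ℤ) → V
  sol : V → Set E3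

variable {V W : Type*}

/-- The plan `P` places the descendants of `t` in the box with side lengths `D`: distinct grid
points of the box carry distinct descendants of `t`, the solid of `t` is the whole box, and the
solids are nested as the sets of descendants are. -/
structure IsPlan (p : V → V) (t : V) (D : Fin 3 → ℕ) (P : Plan V) : Prop where
  inj : Set.InjOn P.site (latticeBox D)
  below : ∀ z ∈ latticeBox D, Below p (P.site z) t
  top : P.sol t = cornerBrick D
  star : ∀ x, Below p x t → IsStarPrism (P.sol x)
  nest : ∀ x, Below p x t → x ≠ t → P.sol x ⊆ interior (P.sol (p x))
  sib : ∀ x y, Below p x t → Below p y t → x ≠ t → y ≠ t → x ≠ y → p x = p y →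
    Disjoint (P.sol x) (P.sol y)

/-- The plan `Q` for a box with side lengths `D'` contains, translated by `τ`, the plan `P` for the
descendants of `r` and the box with side lengths `D`. -/
structure Extends (p : V → V) (r : V) (D : Fin 3 → ℕ) (P : Plan V) (D' : Fin 3 → ℕ) (Q : Plan V)
    (τ : Fin 3 → ℤ) : Prop where
  site : ∀ z ∈ latticeBox D, Q.site (z + τ) = P.site z
  sol : ∀ x, Below p x r → Q.sol x = shift τ (P.sol x)
  margin : ∀ i, 1 ≤ τ i ∧ τ i + D i + 1 ≤ D' i

theorem Below.antisymm_fixed {p : V → V} (hp : IsForest p) {r t : V} (hr : Below p r t)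
    (h : Below p (p r) r) : r = t := by
  have h1 : p r = r := hp.anti _ _ h (Below.parent r)
  obtain ⟨k, hk⟩ := hr
  rwa [Function.iterate_fixed h1] at hk

/-- The boxes of disjoint subtrees fit into a box for the whole tree. The solids of the vertices
above these subtrees come from `exists_layout`, applied with the boxes of the subtrees as the
items. The grid points of the large box outside of the small ones are filled with arbitrary further
vertices, of which there are enough since the volume of the box is at most the size of the tree. -/
theorem exists_plan [Fintype V] {p : V → V} (hp : IsForest p) {t : V} (ht : ∀ x, Below p x t)
    (S : Finset V) (hSt : t ∉ S) (hS : ∀ r ∈ S, ∀ r' ∈ S, Below p r r' → r = r')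
    (h : V → ℕ) (hmax H : ℕ) (hh : ∀ r ∈ S, 1 ≤ h r ∧ h r ≤ hmax)
    (hfit : ∑ r ∈ S, (h r + 1) + 2 * hmax + 8 ≤ 2 * H) (a : Fin 3) (ha : a ≠ 2)
    (b : Fin 3 → ℕ) (hb : ∀ i, 1 ≤ b i)
    (hcard : ∏ i, boxDim (foldBase a b) H i ≤ Fintype.card V)
    (P : V → Plan V) (hP : ∀ r ∈ S, IsPlan p r (boxDim b (h r)) (P r)) :
    ∃ Q, IsPlan p t (boxDim (foldBase a b) H) Q ∧
      ∀ r ∈ S, ∃ τ, Extends p r (boxDim b (h r)) (P r) (boxDim (foldBase a b) H) Q τ := by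
  classical
  set D' := boxDim (foldBase a b) H with hD'
  have hD'0 : ∀ i, 0 < D' i := by
    intro i
    simp only [hD', boxDim, foldBase]
    split_ifs <;> omega
  have hSne : ∀ r ∈ S, r ≠ t := fun r hr h => hSt (h ▸ hr)
  have hdisjS : ∀ r ∈ S, ∀ r' ∈ S, ∀ x, Below p x r → Below p x r' → r = r' := by
    intro r hr r' hr' x hx hx'
    rcases hx.total hx' with h1 | h1
    · exact hS r hr r' hr' h1
    · exact (hS r' hr' r hr h1).symm
  -- the part of the tree that is not strictly below a vertex of `S`
  set R := {y : V // ∀ r ∈ S, Below p y r → y = r} with hR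
  set p' : R → R := fun y => ⟨p y.1, fun r hr hb => by
    have h1 := y.2 r hr ((Below.parent _).trans hb)
    rw [h1] at hb
    exact absurd (Below.antisymm_fixed hp (ht r) hb) (hSne r hr)⟩ with hp'
  have hiter : ∀ k (y : R), ((p'^[k] y : R) : V) = p^[k] y.1 := by
    intro k
    induction k with
    | zero => intro y; rfl
    | succ k ih =>
      intro y
      rw [Function.iterate_succ_apply, Function.iterate_succ_apply, ih]
  have hbelow : ∀ x y : R, Below p' x y ↔ Below p x.1 y.1 := by
    intro x y
    constructor
    · rintro ⟨k, rfl⟩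
      exact ⟨k, (hiter k x).symm⟩
    · rintro ⟨k, hk⟩
      exact ⟨k, Subtype.ext ((hiter k x).trans hk)⟩
  have hfor : IsForest p' := ⟨fun x y h1 h2 => Subtype.ext
    (hp.anti _ _ ((hbelow _ _).1 h1) ((hbelow _ _).1 h2)), fun v => Set.toFinite _⟩
  obtain ⟨ord, hinj, hord, hconv⟩ := hfor.exists_order
  set D : R → Finset R := fun x => Finset.univ.filter fun y => Below p' y x with hD
  have hmemD : ∀ x y, y ∈ D x ↔ Below p y.1 x.1 := by
    intro x y
    simp [hD, hbelow]
  have hssub : ∀ x y : R, Below p x.1 y.1 → x.1 ≠ y.1 → D x ⊂ D y := by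
    intro x y hxy hne
    refine Finset.ssubset_iff_subset_ne.2 ⟨fun z hz => ?_, fun he => ?_⟩
    · rw [hmemD] at hz ⊢
      exact hz.trans hxy
    · have : y ∈ D x := he ▸ (hmemD y y).2 (Below.refl _)
      exact hne (hp.anti _ _ hxy ((hmemD _ _).1 this))
  have hdis : ∀ x y : R, (∀ z, Below p z x.1 → ¬ Below p z y.1) → Disjoint (D x) (D y) := by
    intro x y hxy
    rw [Finset.disjoint_left]
    intro z hz hz'
    exact hxy _ ((hmemD _ _).1 hz) ((hmemD _ _).1 hz')
  have hmemS : ∀ r ∈ S, ∀ r' ∈ S, Below p r r' → r = r' := hS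
  obtain ⟨τ, A, hstar, hitem, hnest, hsib, hin, hmargin⟩ := exists_layout D
    (fun x => (hmemD x x).2 (Below.refl _)) ord hinj hord
    (fun x y hy z hz w h1 h2 => by
      simp only [hD, Finset.mem_filter, Finset.mem_univ, true_and] at hy hz ⊢
      exact hconv x y z w hy hz h1 h2)
    (S.subtype _) (fun x hx => by
      ext y
      rw [hmemD, Finset.mem_singleton]
      constructor
      · intro h1
        exact Subtype.ext (y.2 _ (Finset.mem_subtype.1 hx) h1)
      · rintro rfl
        exact Below.refl _)
    (fun x => h x.1) hmax H (fun x hx => hh _ (Finset.mem_subtype.1 hx))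
    (by rwa [Finset.sum_subtype_of_mem (f := fun r => h r + 1) hmemS]) a ha b hb
  set toR : ∀ r ∈ S, R := fun r hr => ⟨r, hmemS r hr⟩ with htoR
  set σ : V → Fin 3 → ℤ := fun r => if hr : r ∈ S then τ (toR r hr) else 0 with hσ
  have hσS : ∀ r (hr : r ∈ S), σ r = τ (toR r hr) := fun r hr => dif_pos hr
  have hσm : ∀ r ∈ S, ∀ i, 1 ≤ σ r i ∧ σ r i + boxDim b (h r) i + 1 ≤ D' i := by
    intro r hr i
    rw [hσS r hr]
    exact hmargin (toR r hr) (Finset.mem_subtype.2 hr) i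
  have hAS : ∀ r (hr : r ∈ S), A (toR r hr) = shift (σ r) (cornerBrick (boxDim b (h r))) := by
    intro r hr
    rw [hitem _ (Finset.mem_subtype.2 hr), cornerBrick, shift_brick, hσS r hr]
    congr 1
    · ext i
      simp [latticePoint]
    · ext i
      simp [latticePoint, htoR, add_comm]
  -- the solids: translated old ones below `S`, new ones elsewhere
  set sol : V → Set E3 := fun x =>
    if h1 : ∃ r ∈ S, Below p x r then shift (σ h1.choose) ((P h1.choose).sol x)
    else if x = t then cornerBrick D'
    else if h2 : ∀ r ∈ S, Below p x r → x = r then A ⟨x, h2⟩ else ∅ with hsol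
  have hsol1 : ∀ r ∈ S, ∀ x, Below p x r → sol x = shift (σ r) ((P r).sol x) := by
    intro r hr x hx
    have h1 : ∃ r ∈ S, Below p x r := ⟨r, hr, hx⟩
    have h2 : h1.choose = r := hdisjS _ h1.choose_spec.1 _ hr x h1.choose_spec.2 hx
    simp only [hsol]
    rw [dif_pos h1, h2]
  have hsolt : sol t = cornerBrick D' := by
    have h1 : ¬ ∃ r ∈ S, Below p t r := by
      rintro ⟨r, hr, hb⟩
      exact hSne r hr (hp.anti _ _ (ht r) hb)
    simp only [hsol]
    rw [dif_neg h1]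
    simp
  have hsol2 : ∀ x : R, x.1 ≠ t → sol x.1 = A x := by
    intro x hx
    by_cases h1 : ∃ r ∈ S, Below p x.1 r
    · obtain ⟨r, hr, hb⟩ := h1
      have h2 := x.2 r hr hb
      rw [hsol1 r hr _ hb]
      have h3 : x = toR r hr := Subtype.ext h2
      rw [h2, (hP r hr).top, ← hAS r hr, h3]
    · simp only [hsol]
      rw [dif_neg h1, if_neg hx, dif_pos x.2]
  have hAin : ∀ x, A x ⊆ interior (cornerBrick D') := by
    intro x
    refine (hin x).trans (interior_maximal (openBrick_subset_brick _ _) (isOpen_openBrick _ _))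
  have hcase : ∀ x, (∃ y : R, y.1 = x) ∨ ∃ r ∈ S, Below p x r ∧ x ≠ r := by
    intro x
    by_cases h1 : ∀ r ∈ S, Below p x r → x = r
    · exact Or.inl ⟨⟨x, h1⟩, rfl⟩
    · push Not at h1
      exact Or.inr h1
  have hup : ∀ r x, Below p x r → x ≠ r → Below p (p x) r := fun r x hx hne =>
    (below_iff.1 hx).resolve_left hne
  -- the sites in the boxes of `S` are prescribed; the other grid points get arbitrary vertices
  set s : Finset {z // z ∈ latticeBox D'} :=
    Finset.univ.filter fun z => ∃ r ∈ S, z.1 - σ r ∈ latticeBox (boxDim b (h r)) with hs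
  have hzuniq : ∀ z : Fin 3 → ℤ, ∀ r ∈ S, ∀ r' ∈ S, z - σ r ∈ latticeBox (boxDim b (h r)) →
      z - σ r' ∈ latticeBox (boxDim b (h r')) → r = r' := by
    intro z r hr r' hr' h1 h2
    by_contra hne
    have h3 : Disjoint (A (toR r hr)) (A (toR r' hr')) := by
      refine hsib _ _ (hdis _ _ fun x hx hx' => hne (hdisjS r hr r' hr' x hx hx'))
    have key : ∀ r (hr : r ∈ S), z - σ r ∈ latticeBox (boxDim b (h r)) →
        latticePoint z ∈ A (toR r hr) := by
      intro r hr h1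
      rw [hAS r hr]
      intro i
      have h4 := mem_latticeBox.1 h1 i
      simp only [Pi.sub_apply] at h4
      simp only [latticePoint, PiLp.sub_apply]
      have h5 : (0 : ℝ) ≤ ((z i - σ r i : ℤ) : ℝ) := by exact_mod_cast h4.1
      have h6 : ((z i - σ r i : ℤ) : ℝ) ≤ (boxDim b (h r) i : ℕ) := by exact_mod_cast h4.2.le
      push_cast at h5 h6
      exact ⟨h5, h6⟩
    exact Set.disjoint_left.1 h3 (key r hr h1) (key r' hr' h2)
  set f : {z // z ∈ latticeBox D'} → V := fun z =>
    if h1 : ∃ r ∈ S, z.1 - σ r ∈ latticeBox (boxDim b (h r)) then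
      (P h1.choose).site (z.1 - σ h1.choose) else t with hf
  have hfS : ∀ z, ∀ r ∈ S, z.1 - σ r ∈ latticeBox (boxDim b (h r)) →
      f z = (P r).site (z.1 - σ r) := by
    intro z r hr hz
    have h1 : ∃ r ∈ S, z.1 - σ r ∈ latticeBox (boxDim b (h r)) := ⟨r, hr, hz⟩
    have h2 : h1.choose = r := hzuniq z.1 _ h1.choose_spec.1 _ hr h1.choose_spec.2 hz
    simp only [hf]
    rw [dif_pos h1, h2]
  have hfinj : Set.InjOn f s := by
    intro z hz w hw hzw
    obtain ⟨r, hr, hz⟩ := (Finset.mem_filter.1 (Finset.mem_coe.1 hz)).2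
    obtain ⟨r', hr', hw⟩ := (Finset.mem_filter.1 (Finset.mem_coe.1 hw)).2
    rw [hfS z r hr hz, hfS w r' hr' hw] at hzw
    have h1 := (hP r hr).below _ hz
    have h2 := (hP r' hr').below _ hw
    rw [← hzw] at h2
    obtain rfl := hdisjS r hr r' hr' _ h1 h2
    have := (hP r hr).inj hz hw hzw
    exact Subtype.ext (sub_left_injective this)
  have hcardbox : Fintype.card {z // z ∈ latticeBox D'} = ∏ i, D' i := by
    rw [Fintype.card_coe, card_latticeBox]
  obtain ⟨u, hu1, hu2, hu3⟩ := Finset.exists_subsuperset_card_eq (s := s.image f)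
    (t := Finset.univ) (n := Fintype.card {z // z ∈ latticeBox D'}) (Finset.subset_univ _)
    (Finset.card_image_le.trans (Finset.card_le_univ _)) (by rw [hcardbox]; exact hcard)
  obtain ⟨g, hg⟩ := Finset.exists_equiv_extend_of_card_eq hu3.symm hu1 hfinj
  set site : (Fin 3 → ℤ) → V := fun z => if hz : z ∈ latticeBox D' then g ⟨z, hz⟩ else t with hsite
  have hsiteS : ∀ z (hz : z ∈ latticeBox D'), site z = g ⟨z, hz⟩ := fun z hz => dif_pos hz
  refine ⟨⟨site, sol⟩, ?_, fun r hr => ⟨σ r, ?_, fun x hx => hsol1 r hr x hx, hσm r hr⟩⟩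
  · refine ⟨?_, fun z _ => ht _, hsolt, ?_, ?_, ?_⟩
    · intro z hz w hw hzw
      dsimp only at hzw
      rw [hsiteS z hz, hsiteS w hw] at hzw
      exact congrArg Subtype.val (g.injective (Subtype.ext hzw))
    · intro x _
      dsimp only
      rcases hcase x with ⟨y, rfl⟩ | ⟨r, hr, hb, -⟩
      · by_cases hy : y.1 = t
        · rw [hy, hsolt]
          exact isStarPrism_brick fun i => by simpa using hD'0 i
        · rw [hsol2 y hy]
          exact hstar y
      · rw [hsol1 r hr x hb]
        exact ((hP r hr).star x hb).shift _
    · intro x _ hxt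
      dsimp only
      rcases hcase x with ⟨y, rfl⟩ | ⟨r, hr, hb, hne⟩
      · rw [hsol2 y hxt]
        by_cases hy : p y.1 = t
        · rw [hy, hsolt]
          exact hAin y
        · have h1 := hsol2 (p' y) hy
          dsimp only [p'] at h1
          rw [h1]
          refine hnest _ _ (hssub _ _ (Below.parent _) fun h2 => hxt ?_)
          refine Below.antisymm_fixed hp (ht _) ?_
          rw [← show y.1 = p y.1 from h2]
          exact Below.refl _
      · rw [hsol1 r hr x hb, hsol1 r hr _ (hup r x hb hne), interior_shift]
        exact shift_mono _ ((hP r hr).nest x hb hne)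
    · intro x y _ _ hxt hyt hxy hpxy
      dsimp only
      have key : ∀ x y, p x = p y → x ≠ y → y ≠ t → ∀ r ∈ S, Below p x r → x ≠ r →
          Disjoint (sol x) (sol y) := by
        intro x y hpxy hxy hyt r hr hb hne
        have h1 := hup r x hb hne
        have h2 : Below p y r := below_iff.2 (Or.inr (hpxy ▸ h1))
        have h3 : y ≠ r := by
          rintro rfl
          rw [hpxy] at h1
          exact hyt (Below.antisymm_fixed hp (ht _) h1)
        rw [hsol1 r hr x hb, hsol1 r hr y h2]
        exact disjoint_shift _ ((hP r hr).sib x y hb h2 hne h3 hxy hpxy)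
      rcases hcase x with ⟨x', rfl⟩ | ⟨r, hr, hb, hne⟩
      · rcases hcase y with ⟨y', rfl⟩ | ⟨r, hr, hb, hne⟩
        · rw [hsol2 x' hxt, hsol2 y' hyt]
          refine hsib _ _ (hdis _ _ fun z hz => hp.sibling_disjoint hpxy hxy ?_ ?_ hz)
          · intro h1
            exact hxt (Below.antisymm_fixed hp (ht _) (h1 ▸ Below.refl _))
          · intro h1
            exact hyt (Below.antisymm_fixed hp (ht _) (h1 ▸ Below.refl _))
        · exact (key y _ hpxy.symm hxy.symm hxt r hr hb hne).symm
      · exact key x y hpxy hxy hyt r hr hb hne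
  · intro z hz
    have h1 : z + σ r ∈ latticeBox D' := by
      rw [mem_latticeBox] at hz ⊢
      intro i
      have h2 := hz i
      have h3 := hσm r hr i
      simp only [Pi.add_apply]
      omega
    dsimp only
    have h2 : (z + σ r) - σ r ∈ latticeBox (boxDim b (h r)) := by simpa using hz
    rw [hsiteS _ h1, hg ⟨_, h1⟩ (Finset.mem_filter.2 ⟨Finset.mem_univ _, r, hr, h2⟩),
      hfS ⟨_, h1⟩ r hr h2]
    simp

/-! ### The dimensions of the boxes -/

/-- The base of the boxes of stage `n`: the two horizontal directions are folded alternately. -/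
def base : ℕ → Fin 3 → ℕ
  | 0 => fun _ => 1
  | n + 1 => foldBase (if Even n then 0 else 1) (base n)

theorem base_pos (n : ℕ) (i : Fin 3) : 1 ≤ base n i := by
  cases n with
  | zero => exact le_rfl
  | succ n =>
    simp only [base, foldBase]
    split_ifs <;> omega

theorem base_even (k : ℕ) : base (2 * k) 0 + 5 = 6 * 2 ^ k ∧ base (2 * k) 1 + 7 = 8 * 2 ^ k := by
  induction k with
  | zero => simp [base]
  | succ k ih =>
    have h1 : Even (2 * k) := even_two_mul k
    have h2 : ¬ Even (2 * k + 1) := by simp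
    have e0 : base (2 * (k + 1)) 0 = 2 * base (2 * k) 0 + 3 + 2 := by
      simp [mul_add, base, foldBase, h1, h2]
    have e1 : base (2 * (k + 1)) 1 = 2 * (base (2 * k) 1 + 2) + 3 := by
      simp [mul_add, base, foldBase, h1, h2]
    rw [e0, e1, pow_succ]
    omega

theorem base_mul_le (n : ℕ) : base n 0 * base n 1 ≤ 48 * 2 ^ n := by
  rcases Nat.even_or_odd' n with ⟨k, rfl | rfl⟩
  · obtain ⟨h1, h2⟩ := base_even k
    calc base (2 * k) 0 * base (2 * k) 1 ≤ (6 * 2 ^ k) * (8 * 2 ^ k) :=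
          Nat.mul_le_mul (by omega) (by omega)
      _ = 48 * 2 ^ (2 * k) := by ring
  · obtain ⟨h1, h2⟩ := base_even k
    have h3 : Even (2 * k) := even_two_mul k
    have e0 : base (2 * k + 1) 0 = 2 * base (2 * k) 0 + 3 := by simp [base, foldBase, h3]
    have e1 : base (2 * k + 1) 1 = base (2 * k) 1 + 2 := by simp [base, foldBase, h3]
    calc base (2 * k + 1) 0 * base (2 * k + 1) 1 ≤ (12 * 2 ^ k) * (8 * 2 ^ k) :=
          Nat.mul_le_mul (by omega) (by omega)
      _ = 48 * 2 ^ (2 * k + 1) := by ring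

/-- The ratio of the height of a box of stage `n` to the number of vertices it serves. The second
term makes `2 * ratio (n + 1) - ratio n` positive, which leaves room for gaps between the boxes. -/
noncomputable def ratio (n : ℕ) : ℝ := (1 / 2 ^ n - 1 / (2 * 4 ^ n)) / 48

theorem two_mul_ratio_succ (n : ℕ) : 2 * ratio (n + 1) = ratio n + 1 / (192 * 4 ^ n) := by
  simp only [ratio, pow_succ]
  field_simp
  ring

theorem ratio_le (n : ℕ) : ratio n ≤ 1 / (48 * 2 ^ n) := by
  have h : (0 : ℝ) < 1 / (2 * 4 ^ n) := by positivity
  have e : 1 / (48 * 2 ^ n) = (1 / 2 ^ n) / (48 : ℝ) := by field_simp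
  rw [ratio, e]
  gcongr
  linarith

theorem le_ratio (n : ℕ) : 1 / (96 * 2 ^ n) ≤ ratio n := by
  have h : 1 / (2 * 4 ^ n) ≤ 1 / (2 * 2 ^ n : ℝ) := by
    gcongr
    norm_num
  have e : 1 / (96 * 2 ^ n) = (1 / 2 ^ n - 1 / (2 * 2 ^ n)) / (48 : ℝ) := by
    field_simp
    norm_num
  rw [ratio, e]
  gcongr

theorem ratio_nonneg (n : ℕ) : 0 ≤ ratio n := le_trans (by positivity) (le_ratio n)

/-- The height of the box of stage `n` that serves `N` vertices. -/
noncomputable def height (n N : ℕ) : ℕ := ⌊ratio n * N⌋₊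

/-- The dimensions of the box of stage `n` that serves `N` vertices. -/
noncomputable def dims (n N : ℕ) : Fin 3 → ℕ := boxDim (base n) (height n N)

/-- The volume of a box is at most the number of vertices it serves: the area of the base is at most
`48 * 2 ^ n`. -/
theorem prod_dims_le (n N : ℕ) : ∏ i, dims n N i ≤ N := by
  have h1 : ∏ i, dims n N i = base n 0 * base n 1 * height n N := by
    simp [Fin.prod_univ_three, dims, boxDim]
  have h2 : (height n N : ℝ) ≤ ratio n * N :=
    Nat.floor_le (mul_nonneg (ratio_nonneg n) (by positivity))
  have h3 : ((base n 0 * base n 1 : ℕ) : ℝ) ≤ 48 * 2 ^ n := by exact_mod_cast base_mul_le n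
  have h4 : ((base n 0 * base n 1 * height n N : ℕ) : ℝ) ≤ N := by
    rw [Nat.cast_mul]
    calc ((base n 0 * base n 1 : ℕ) : ℝ) * (height n N : ℕ)
        ≤ (48 * 2 ^ n) * (1 / (48 * 2 ^ n) * N) := by
          gcongr
          exact h2.trans (by gcongr; exact ratio_le n)
      _ = N := by field_simp
  rw [h1]
  exact_mod_cast h4

theorem height_le (n N : ℕ) : height n N ≤ N := by
  refine Nat.floor_le_of_le ?_
  have h1 : ratio n ≤ 1 := (ratio_le n).trans (by
    rw [div_le_one (by positivity)]
    have : (1 : ℝ) ≤ 2 ^ n := one_le_pow₀ (by norm_num)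
    linarith)
  calc ratio n * N ≤ 1 * N := by gcongr
    _ = N := one_mul _

theorem one_le_height {n N : ℕ} (h : 384 * 4 ^ n ≤ N) : 1 ≤ height n N := by
  refine Nat.le_floor ?_
  have h1 : (384 * 4 ^ n : ℝ) ≤ N := by exact_mod_cast h
  have h2 : (2 : ℝ) ^ n ≤ 4 ^ n := by gcongr; norm_num
  calc ((1 : ℕ) : ℝ) = 1 / (96 * 2 ^ n) * (96 * 2 ^ n) := by field_simp; norm_num
    _ ≤ ratio n * N := by
      gcongr
      · exact ratio_nonneg n
      · exact le_ratio n
      · linarith [pow_pos (zero_lt_two' ℝ) n]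

/-- The boxes of stage `n` for disjoint parts of a set of `N` vertices, stacked in two columns, fit
into the box of stage `n + 1` for these `N` vertices. -/
theorem sum_height_add_le {ι : Type*} (S : Finset ι) (s : ι → ℕ) {n k N : ℕ}
    (hs : ∀ i ∈ S, 384 * 4 ^ n ≤ s i) (hsum : ∑ i ∈ S, s i ≤ N)
    (hN : 384 * 4 ^ n * (2 * k + 10) ≤ N) :
    ∑ i ∈ S, (height n (s i) + 1) + 2 * k + 8 ≤ 2 * height (n + 1) N := by
  have h0 : (0 : ℝ) < 384 * 4 ^ n := by positivity
  have h1 : ∀ i ∈ S, ((height n (s i) + 1 : ℕ) : ℝ) ≤ (ratio n + 1 / (384 * 4 ^ n)) * s i := by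
    intro i hi
    have h2 : (height n (s i) : ℝ) ≤ ratio n * s i :=
      Nat.floor_le (mul_nonneg (ratio_nonneg n) (by positivity))
    have h3 : (384 * 4 ^ n : ℝ) ≤ s i := by exact_mod_cast hs i hi
    have h4 : 1 ≤ 1 / (384 * 4 ^ n) * (s i : ℝ) := by
      rw [one_div, inv_mul_eq_div, one_le_div h0]
      exact h3
    push_cast
    linarith
  have h2 : ((∑ i ∈ S, (height n (s i) + 1) : ℕ) : ℝ) ≤ (ratio n + 1 / (384 * 4 ^ n)) * N := by
    rw [Nat.cast_sum]
    refine (Finset.sum_le_sum h1).trans ?_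
    rw [← Finset.mul_sum, ← Nat.cast_sum]
    have := ratio_nonneg n
    gcongr
  have h3 : ratio (n + 1) * N - 1 < height (n + 1) N := Nat.sub_one_lt_floor _
  have h4 : ((2 * k + 10 : ℕ) : ℝ) ≤ 1 / (384 * 4 ^ n) * N := by
    rw [one_div, inv_mul_eq_div, le_div_iff₀ h0]
    have : ((384 * 4 ^ n * (2 * k + 10) : ℕ) : ℝ) ≤ N := by exact_mod_cast hN
    push_cast at this ⊢
    linarith
  have h5 : 2 * ratio (n + 1) * N = ratio n * N + 2 * (1 / (384 * 4 ^ n) * N) := by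
    rw [two_mul_ratio_succ]
    field_simp
    ring
  have h6 : ((∑ i ∈ S, (height n (s i) + 1) + 2 * k + 8 : ℕ) : ℝ) <
      (2 * height (n + 1) N + 1 : ℕ) := by
    push_cast at h2 h4 ⊢
    nlinarith
  have h7 : ∑ i ∈ S, (height n (s i) + 1) + 2 * k + 8 < 2 * height (n + 1) N + 1 := by
    exact_mod_cast h6
  omega

/-! ### Transport of plans -/

section Push

variable {V W : Type*} {p : V → V} {lt : V → V → Prop} {s : V} {c : Code} {f : Fin c.1 → V}

/-- The image of a plan under an enumeration of the descendants of a vertex. -/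
noncomputable def Plan.push (f : W → V) (P : Plan W) : Plan V where
  site := f ∘ P.site
  sol := Function.extend f P.sol fun _ => ∅

theorem Plan.push_sol {f : W → V} (hf : Function.Injective f) (P : Plan W) (x : W) :
    (P.push f).sol (f x) = P.sol x :=
  hf.extend_apply P.sol (fun _ => ∅) x

theorem Plan.push_comp {X : Type*} {f : W → V} (hf : Function.Injective f) {g : X → W}
    (hg : Function.Injective g) (P : Plan X) : (P.push g).push f = P.push (f ∘ g) := by
  simp only [Plan.push, Plan.mk.injEq]
  refine ⟨rfl, ?_⟩
  funext v
  by_cases h : ∃ w, f w = v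
  · obtain ⟨w, rfl⟩ := h
    rw [hf.extend_apply]
    by_cases h' : ∃ x, g x = w
    · obtain ⟨x, rfl⟩ := h'
      rw [hg.extend_apply, ← Function.comp_apply (f := f), (hf.comp hg).extend_apply]
    · rw [Function.extend_apply' _ _ _ h', Function.extend_apply']
      rintro ⟨x, hx⟩
      exact h' ⟨x, hf hx⟩
  · rw [Function.extend_apply' _ _ _ h, Function.extend_apply']
    rintro ⟨x, hx⟩
    exact h ⟨g x, hx⟩

theorem Enum.isPlan_push (h : Enum p lt s c f) {D : Fin 3 → ℕ} {P : Plan (Fin c.1)}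
    (hP : IsPlan c.par c.top D P) (hc : c.WF) : IsPlan p s D (P.push f) where
  inj _ hz _ hw hzw := hP.inj hz hw (h.inj hzw)
  below _ _ := h.below _
  top := by rw [← h.top, Plan.push_sol h.inj, hP.top]
  star x hx := by
    obtain ⟨i, rfl⟩ := h.exists_eq hx
    rw [Plan.push_sol h.inj]
    exact hP.star i (hc.below i)
  nest x hx hne := by
    obtain ⟨i, rfl⟩ := h.exists_eq hx
    have hi : i ≠ c.top := fun hi => hne (by rw [hi, h.top])
    rw [← h.par i hi, Plan.push_sol h.inj, Plan.push_sol h.inj]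
    exact hP.nest i (hc.below i) hi
  sib x y hx hy hxs hys hne hpp := by
    obtain ⟨i, rfl⟩ := h.exists_eq hx
    obtain ⟨j, rfl⟩ := h.exists_eq hy
    have hi : i ≠ c.top := fun hi => hxs (by rw [hi, h.top])
    have hj : j ≠ c.top := fun hj => hys (by rw [hj, h.top])
    rw [← h.par i hi, ← h.par j hj] at hpp
    rw [Plan.push_sol h.inj, Plan.push_sol h.inj]
    exact hP.sib i j (hc.below i) (hc.below j) hi hj (fun he => hne (he ▸ rfl)) (h.inj hpp)

theorem Enum.extends_push (h : Enum p lt s c f) (hp : IsForest p) {r : Fin c.1} {D D' : Fin 3 → ℕ}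
    {P Q : Plan (Fin c.1)} {τ : Fin 3 → ℤ} (hPQ : Extends c.par r D P D' Q τ) :
    Extends p (f r) D (P.push f) D' (Q.push f) τ where
  site z hz := congrArg f (hPQ.site z hz)
  sol x hx := by
    obtain ⟨i, rfl⟩ := h.exists_eq (hx.trans (h.below r))
    rw [Plan.push_sol h.inj, Plan.push_sol h.inj]
    exact hPQ.sol i ((h.below_iff hp).2 hx)
  margin := hPQ.margin

end Push

/-! ### The coherent choice of plans -/

/-- The smallest size of a cluster of stage `n` that gets a box, in terms of the bound `κ n` on the
sizes of the clusters of stage `n`. -/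
def minSize (κ : ℕ → ℕ) : ℕ → ℕ
  | 0 => 384
  | n + 1 => 384 * 4 ^ (n + 1) * (2 * κ n + 10)

theorem le_minSize (κ : ℕ → ℕ) (n : ℕ) : 384 * 4 ^ n ≤ minSize κ n := by
  cases n with
  | zero => simp [minSize]
  | succ n => exact Nat.le_mul_of_pos_right _ (by omega)

/-- The vertex `r` is the top of a cluster of stage `n` that gets a box. The cluster of stage `n` of
a vertex consists of the descendants of its last ancestor with fewer than `κ n` descendants; it gets
a box if it has at least `minSize κ n` elements. -/
def IsRoot {V : Type*} (κ : ℕ → ℕ) (n : ℕ) (p : V → V) (r : V) : Prop :=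
  minSize κ n ≤ sz p r ∧ sz p r < κ n ∧ κ n ≤ sz p (p r)

theorem IsRoot.eq_of_below {V : Type*} {κ : ℕ → ℕ} {n : ℕ} {p : V → V} (hp : IsForest p) {r r' : V}
    (hr : IsRoot κ n p r) (hr' : IsRoot κ n p r') (h : Below p r r') : r = r' := by
  rcases below_iff.1 h with h | h
  · exact h
  · exact absurd (hp.sz_le h) (by have := hr.2.2; have := hr'.2.1; omega)

theorem sum_sz_le {V : Type*} [Fintype V] {p : V → V} (S : Finset V)
    (hS : ∀ r ∈ S, ∀ r' ∈ S, Below p r r' → r = r') : ∑ r ∈ S, sz p r ≤ Fintype.card V := by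
  classical
  have h1 : ∀ r, sz p r = (Finset.univ.filter fun x => Below p x r).card := by
    intro r
    rw [sz, ← Set.ncard_coe_finset]
    congr 1
    ext x
    simp
  simp_rw [h1]
  rw [← Finset.card_biUnion]
  · exact Finset.card_le_univ _
  · intro r hr r' hr' hne
    rw [Function.onFun, Finset.disjoint_left]
    intro x hx hx'
    simp only [Finset.mem_filter, Finset.mem_univ, true_and] at hx hx'
    rcases hx.total hx' with h | h
    · exact hne (hS r hr r' hr' h)
    · exact hne (hS r' hr' r hr h).symm

/-- `Q` is a plan of stage `n + 1` for the tree `c`, and it contains the plans `prev` of the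
clusters of stage `n`. -/
def StepOK (κ : ℕ → ℕ) (n : ℕ) (prev : ∀ c : Code, Plan (Fin c.1)) (c : Code) (Q : Plan (Fin c.1)) :
    Prop :=
  IsPlan c.par c.top (dims (n + 1) c.1) Q ∧
    ∀ r c' f, Enum c.par (· < ·) r c' f → IsRoot κ n c.par r →
      ∃ τ, Extends c.par r (dims n c'.1) ((prev c').push f) (dims (n + 1) c.1) Q τ

open Classical in
/-- The plans of stage `n`, chosen by recursion on `n`. As they depend on the code of the cluster
only, all vertices of a cluster agree on its plan. -/
noncomputable def plan (κ : ℕ → ℕ) : ℕ → ∀ c : Code, Plan (Fin c.1)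
  | 0 => fun c => ⟨fun _ => c.top, fun _ => ∅⟩
  | n + 1 => fun c =>
    if h : ∃ Q, StepOK κ n (plan κ n) c Q then h.choose else ⟨fun _ => c.top, fun _ => ∅⟩

/-- Since `κ 0 = 1`, no cluster of stage `0` gets a box, and the induction starts. -/
theorem plan_spec {κ : ℕ → ℕ} (h0 : κ 0 = 1) (n : ℕ) :
    (∀ c : Code, c.WF → minSize κ n ≤ c.1 → c.1 < κ n →
      IsPlan c.par c.top (dims n c.1) (plan κ n c)) ∧
    ∀ c : Code, c.WF → minSize κ (n + 1) ≤ c.1 → StepOK κ n (plan κ n) c (plan κ (n + 1) c) := by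
  have step : ∀ n, (∀ c : Code, c.WF → minSize κ n ≤ c.1 → c.1 < κ n →
      IsPlan c.par c.top (dims n c.1) (plan κ n c)) →
      ∀ c : Code, c.WF → minSize κ (n + 1) ≤ c.1 →
        StepOK κ n (plan κ n) c (plan κ (n + 1) c) := by
    classical
    intro n ih c hc hsize
    have key : ∃ Q, StepOK κ n (plan κ n) c Q := by
      have hp := hc.isForest
      choose cd fn hen using fun r => Enum.exists hp r
      set S : Finset (Fin c.1) := Finset.univ.filter fun r => IsRoot κ n c.par r with hS
      have hmemS : ∀ r, r ∈ S ↔ IsRoot κ n c.par r := fun r => by simp [hS]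
      have hanti : ∀ r ∈ S, ∀ r' ∈ S, Below c.par r r' → r = r' := fun r hr r' hr' =>
        ((hmemS r).1 hr).eq_of_below hp ((hmemS r').1 hr')
      have hsz : ∀ r, sz c.par r = (cd r).1 := fun r => (hen r).sz_top hp
      have hsize' : 384 * 4 ^ n * (2 * κ n + 10) ≤ c.1 := by
        refine le_trans ?_ hsize
        simp only [minSize]
        gcongr <;> omega
      have hfit := sum_height_add_le S (sz c.par) (n := n) (k := κ n) (N := c.1)
        (fun r hr => (le_minSize κ n).trans ((hmemS r).1 hr).1)
        ((sum_sz_le S hanti).trans (by simp)) hsize'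
      obtain ⟨Q, hQ, hext⟩ := exists_plan hp hc.below S
        (fun h => by
          have h1 := ((hmemS _).1 h).2
          rw [hc.par_top] at h1
          omega) hanti
        (fun r => height n (sz c.par r)) (κ n) (height (n + 1) c.1)
        (fun r hr => ⟨one_le_height ((le_minSize κ n).trans ((hmemS r).1 hr).1),
          (height_le _ _).trans ((hmemS r).1 hr).2.1.le⟩) hfit
        (if Even n then 0 else 1) (by split_ifs <;> decide) (base n) (base_pos n)
        (by
          rw [Fintype.card_fin]
          exact prod_dims_le (n + 1) c.1)
        (fun r => (plan κ n (cd r)).push (fn r))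
        (fun r hr => by
          have h1 := (hmemS r).1 hr
          rw [hsz r]
          have h2 := (hen r).wf hp
          exact (hen r).isPlan_push (ih _ h2 (hsz r ▸ h1.1) (hsz r ▸ h1.2.1)) h2)
      refine ⟨Q, hQ, fun r c' f hen' hr => ?_⟩
      obtain ⟨τ, hτ⟩ := hext r ((hmemS r).2 hr)
      have h1 : (⟨cd r, fn r⟩ : Σ c' : Code, Fin c'.1 → Fin c.1) = ⟨c', f⟩ :=
        Enum.unique (ℓ := id) (hen r) hen'
      rw [hsz r] at hτ
      have key : ∀ (a b : Σ c' : Code, Fin c'.1 → Fin c.1), a = b →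
          Extends c.par r (dims n a.1.1) ((plan κ n a.1).push a.2) (dims (n + 1) c.1) Q τ →
          Extends c.par r (dims n b.1.1) ((plan κ n b.1).push b.2) (dims (n + 1) c.1) Q τ := by
        rintro a _ rfl h
        exact h
      exact ⟨τ, key _ _ h1 hτ⟩
    simp only [plan]
    rw [dif_pos key]
    exact key.choose_spec
  have hplan : ∀ n, ∀ c : Code, c.WF → minSize κ n ≤ c.1 → c.1 < κ n →
      IsPlan c.par c.top (dims n c.1) (plan κ n c) := by
    intro n
    induction n with
    | zero =>
      intro c _ h1 h2
      rw [h0] at h2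
      simp only [minSize] at h1
      omega
    | succ n ih => exact fun c hc h1 _ => (step n ih c hc h1).1
  exact ⟨hplan n, step n (hplan n)⟩

/-! ### The limit of the plans -/

theorem Extends.mem_latticeBox {V : Type*} {p : V → V} {r : V} {D D' : Fin 3 → ℕ} {P Q : Plan V}
    {τ : Fin 3 → ℤ} (h : Extends p r D P D' Q τ) {z : Fin 3 → ℤ} (hz : z ∈ latticeBox D) :
    z + τ ∈ latticeBox D' := by
  rw [_root_.mem_latticeBox] at hz ⊢
  intro i
  have h1 := hz i
  have h2 := h.margin i
  simp only [Pi.add_apply]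
  omega

/-- An increasing sequence of plans, each containing the previous one with a margin, exhausts the
grid and the space: there is a filling `ψ` of `ℤ³` and a nested system of solids `A`, which agree
with the `n`-th plan in coordinates that are translated by `σ n`. -/
theorem exists_limit_plan {V : Type} {p : V → V} (s : ℕ → V)
    (D : ℕ → Fin 3 → ℕ) (hD : ∀ n i, 0 < D n i) (P : ℕ → Plan V)
    (hP : ∀ n, IsPlan p (s n) (D n) (P n)) (hs : ∀ n, Below p (s n) (s (n + 1)))
    (hext : ∀ n, ∃ τ, Extends p (s n) (D n) (P n) (D (n + 1)) (P (n + 1)) τ)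
    (hp : ∀ x, p x ≠ x) (hanti : IsForest p) (hcov : ∀ v, ∃ n, Below p v (s n)) :
    ∃ (σ : ℕ → Fin 3 → ℤ) (ψ : (Fin 3 → ℤ) → V) (A : V → Set E3), Function.Injective ψ ∧
      (∀ w, ∀ᶠ n in Filter.atTop, w - σ n ∈ latticeBox (D n)) ∧
      (∀ n, ∀ z ∈ latticeBox (D n), ψ (z + σ n) = (P n).site z) ∧
      (∀ n x, Below p x (s n) → A x = shift (σ n) ((P n).sol x)) ∧ IsNestedSystem p A := by
  choose τ hτ using hext
  -- the lower corner of the box of stage `n`; because of the margins this box contains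
  -- `[-n, n]` in each direction
  set σ : ℕ → Fin 3 → ℤ := fun n => - ∑ k ∈ Finset.range n, τ k with hσ
  have hσs : ∀ n, σ n = τ n + σ (n + 1) := by
    intro n
    simp only [hσ, Finset.sum_range_succ]
    abel
  have hσ1 : ∀ n i, σ n i ≤ - n ∧ (n : ℤ) ≤ σ n i + D n i := by
    intro n i
    induction n with
    | zero => simp [hσ]
    | succ n ih =>
      have h1 := (hτ n).margin i
      have h2 : σ n i = τ n i + σ (n + 1) i := congrFun (hσs n) i
      push_cast
      omega
  have hcoh : ∀ n m, n ≤ m → (∀ z ∈ latticeBox (D n), z + σ n - σ m ∈ latticeBox (D m) ∧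
      (P m).site (z + σ n - σ m) = (P n).site z) ∧ ∀ x, Below p x (s n) → Below p x (s m) ∧
      shift (σ m) ((P m).sol x) = shift (σ n) ((P n).sol x) := by
    intro n m hnm
    induction m, hnm using Nat.le_induction with
    | base => exact ⟨fun z hz => by simpa using hz, fun x hx => ⟨hx, rfl⟩⟩
    | succ m hnm ih =>
      refine ⟨fun z hz => ?_, fun x hx => ?_⟩
      · obtain ⟨h1, h2⟩ := ih.1 z hz
        have h3 : z + σ n - σ (m + 1) = z + σ n - σ m + τ m := by rw [hσs m]; abel
        rw [h3]
        exact ⟨(hτ m).mem_latticeBox h1, ((hτ m).site _ h1).trans h2⟩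
      · obtain ⟨h1, h2⟩ := ih.2 x hx
        refine ⟨h1.trans (hs m), ?_⟩
        rw [(hτ m).sol x h1, shift_shift, add_comm, ← hσs m, h2]
  have hev : ∀ w, ∀ᶠ n in Filter.atTop, w - σ n ∈ latticeBox (D n) := by
    intro w
    filter_upwards [Filter.eventually_ge_atTop (∑ i, (w i).natAbs + 1)] with n hn
    rw [mem_latticeBox]
    intro i
    have h1 : (w i).natAbs ≤ ∑ i, (w i).natAbs :=
      Finset.single_le_sum (f := fun i => (w i).natAbs) (fun _ _ => Nat.zero_le _)
        (Finset.mem_univ i)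
    have h2 := hσ1 n i
    simp only [Pi.sub_apply]
    omega
  choose N hN using fun w => (hev w).exists
  choose M hM using hcov
  set ψ : (Fin 3 → ℤ) → V := fun w => (P (N w)).site (w - σ (N w)) with hψ
  set A : V → Set E3 := fun x => shift (σ (M x)) ((P (M x)).sol x) with hA
  have hψ1 : ∀ n, ∀ z ∈ latticeBox (D n), ψ (z + σ n) = (P n).site z := by
    intro n z hz
    have h1 := (hcoh _ _ (le_max_left n (N (z + σ n)))).1 z hz
    have h2 := (hcoh _ _ (le_max_right n (N (z + σ n)))).1 _ (hN (z + σ n))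
    rw [sub_add_cancel] at h2
    exact h2.2.symm.trans h1.2
  have hA1 : ∀ n x, Below p x (s n) → A x = shift (σ n) ((P n).sol x) := by
    intro n x hx
    have h1 := (hcoh _ _ (le_max_left n (M x))).2 x hx
    have h2 := (hcoh _ _ (le_max_right n (M x))).2 x (hM x)
    exact h2.2.symm.trans h1.2
  refine ⟨σ, ψ, A, ?_, hev, hψ1, hA1, ?_, ?_, ?_, ?_⟩
  · intro w w' hww
    obtain ⟨n, hn, hn'⟩ := ((hev w).and (hev w')).exists
    have h1 := hψ1 n _ hn
    have h2 := hψ1 n _ hn'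
    rw [sub_add_cancel] at h1 h2
    rw [h1, h2] at hww
    simpa using (hP n).inj hn hn' hww
  · intro x
    exact ((hP _).star x (hM x)).shift _
  · intro x
    have h1 := hM (p x)
    have h2 := (Below.parent x).trans h1
    rw [hA1 _ _ h1, hA1 _ _ h2, interior_shift]
    refine shift_mono _ ((hP _).nest x h2 fun h3 => ?_)
    rw [← h3] at h1
    exact hp x (hanti.anti _ _ h1 (Below.parent x))
  · intro x y hxy hpp
    obtain ⟨n, h1⟩ : ∃ n, Below p (p x) (s n) := ⟨_, hM _⟩
    have h2 := (Below.parent x).trans h1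
    have h3 : Below p y (s n) := below_iff.2 (Or.inr (by rw [← hpp]; exact h1))
    rw [hA1 _ _ h2, hA1 _ _ h3]
    refine disjoint_shift _ ((hP _).sib x y h2 h3 (fun h4 => ?_) (fun h4 => ?_) hxy hpp)
    · rw [← h4] at h1
      exact hp x (hanti.anti _ _ h1 (Below.parent x))
    · rw [hpp, ← h4] at h1
      exact hp y (hanti.anti _ _ h1 (Below.parent y))
  · intro r
    obtain ⟨n, hn⟩ := exists_nat_ge r
    refine ⟨s n, vec (fun _ => 0) + latticePoint (σ n), vec (fun i => D n i) + latticePoint (σ n),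
      fun i => by simpa using hD n i, ?_, ?_⟩
    · rw [hA1 n _ (Below.refl _), (hP n).top, cornerBrick, shift_brick]
    · rw [hA1 n _ (Below.refl _), (hP n).top]
      intro x hx i
      have h1 : |x i| ≤ ‖x‖ := by
        rw [← Real.norm_eq_abs]
        exact PiLp.norm_apply_le x i
      have h2 : ‖x‖ < r := by simpa using hx
      have h3 := abs_le.1 (h1.trans (h2.le.trans hn))
      have h4 : (σ n i : ℝ) ≤ - n := by exact_mod_cast (hσ1 n i).1
      have h5 : (n : ℝ) ≤ σ n i + D n i := by exact_mod_cast (hσ1 n i).2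
      simp only [latticePoint, PiLp.sub_apply]
      constructor <;> linarith

/-! ### Measurability of local events -/

/-- A set of isomorphism classes is measurable (in fact open) if each of its elements is witnessed
by a ball event. -/
theorem measurableSet_of_ballEvent {L : Type} [TopologicalSpace L] [SecondCountableTopology L]
    {k : ℕ} (A : Set (GraphClass L k))
    (h : ∀ g ∈ A, ∃ (r n : ℕ) (H : SimpleGraph (Fin n)) (ρ : Fin k → Fin n) (O : Fin n → Set L),
      (∀ i, IsOpen (O i)) ∧ g ∈ ballEvent r n H ρ O ∧ ballEvent r n H ρ O ⊆ A) :
    MeasurableSet A := by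
  set B := TopologicalSpace.countableBasis L
  have hB : B.Countable := TopologicalSpace.countable_countableBasis L
  have : Countable B := hB.to_subtype
  set I := Σ n : ℕ, ℕ × SimpleGraph (Fin n) × (Fin k → Fin n) × (Fin n → B)
  set ev : I → Set (GraphClass L k) := fun i =>
    ballEvent i.2.1 i.1 i.2.2.1 i.2.2.2.1 fun j => (i.2.2.2.2 j : Set L) with hev
  have hA : A = ⋃ i ∈ {i : I | ev i ⊆ A}, ev i := by
    apply Subset.antisymm
    · intro g hg
      obtain ⟨r, n, H, ρ, O, hO, ⟨G, hG, e, h1, h2, h3, h4, h5⟩, hsub⟩ := h g hg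
      choose b hb hmem hbO using fun i =>
        (TopologicalSpace.isBasis_countableBasis L).exists_subset_of_mem_open (h5 i) (hO i)
      refine mem_biUnion (x := (⟨n, r, H, ρ, fun i => ⟨b i, hb i⟩⟩ : I)) ?_
        ⟨G, hG, e, h1, h2, h3, h4, hmem⟩
      rintro g' ⟨G', hG', e', h1', h2', h3', h4', h5'⟩
      exact hsub ⟨G', hG', e', h1', h2', h3', h4', fun i => hbO i (h5' i)⟩
    · exact iUnion₂_subset fun i hi => hi
  rw [hA]
  refine MeasurableSet.biUnion (to_countable _) fun i _ => ?_
  exact MeasurableSpace.measurableSet_generateFrom ⟨_, _, _, _, _, fun j =>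
    TopologicalSpace.isOpen_of_mem_countableBasis (i.2.2.2.2 j).2, rfl⟩

theorem exists_adj_dist_le {V : Type} {G : SimpleGraph V} (hG : G.Connected) {x v : V} {s : ℕ}
    (h : G.dist x v = s + 1) : ∃ u, G.Adj u v ∧ G.dist x u ≤ s := by
  obtain ⟨q, hq⟩ := (hG v x).exists_walk_length_eq_dist
  rw [G.dist_comm, h] at hq
  cases q with
  | nil => simp at hq
  | @cons _ u _ huv q =>
    rw [SimpleGraph.Walk.length_cons] at hq
    have h1 := G.dist_le q
    rw [G.dist_comm] at h1
    exact ⟨u, huv.symm, by omega⟩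

theorem finite_ball {V : Type} {G : SimpleGraph V} (hG : G.Connected)
    (hf : ∀ v, (G.neighborSet v).Finite) (x : V) (r : ℕ) : {v | G.dist x v ≤ r}.Finite := by
  induction r with
  | zero =>
    refine (finite_singleton x).subset fun v hv => ?_
    have : G.dist x v = 0 := Nat.le_zero.1 hv
    exact (hG.dist_eq_zero_iff.1 this).symm
  | succ r ih =>
    refine (ih.union (ih.biUnion fun v _ => hf v)).subset fun v hv => ?_
    rcases Nat.lt_or_ge r (G.dist x v) with h | h
    · right
      simp only [mem_ofPred_eq] at hv
      obtain ⟨u, hu, hxu⟩ := exists_adj_dist_le hG (x := x) (v := v) (s := r) (by omega)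
      exact mem_biUnion (x := u) hxu hu
    · exact Or.inl h

/-- In the labelled graph `G`, the map `f` is an isomorphism of the rooted tree `c` with a set of
vertices of which the vertex `w` is the only outside neighbour, `w` being adjacent to the image of
the top of `c` only. The labels respect `lt`, and the roots of `G` are the vertices numbered `ι`. -/
structure IsCluster {L : Type} (lt : L → L → Prop) {k : ℕ} (G : RootedLabelledGraph L k) (c : Code)
    (ι : Fin k → Fin c.1) (f : Fin c.1 → G.V) (w : G.V) : Prop where
  wf : c.WF
  inj : Function.Injective f
  root : ∀ j, f (ι j) = G.root j
  mono : ∀ i j, i < j → lt (G.label (f i)) (G.label (f j))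
  adj : ∀ a b, G.graph.Adj (f a) (f b) ↔ (a ≠ c.top ∧ b = c.par a) ∨ (b ≠ c.top ∧ a = c.par b)
  out : ∀ a y, G.graph.Adj (f a) y → (∃ b, f b = y) ∨ (a = c.top ∧ y = w)
  adj_out : G.graph.Adj (f c.top) w
  ne_out : ∀ a, f a ≠ w

/-- The event that the roots are the vertices numbered `ι` in a cluster with code `c`. -/
def clusterEvent {L : Type} (lt : L → L → Prop) {k : ℕ} (c : Code) (ι : Fin k → Fin c.1) :
    Set (GraphClass L k) :=
  {g | ∃ G, Quotient.mk _ G = g ∧ ∃ f w, IsCluster lt G c ι f w}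

theorem mk_mem_clusterEvent {L : Type} {lt : L → L → Prop} {k : ℕ} {c : Code} {ι : Fin k → Fin c.1}
    {G : RootedLabelledGraph L k} :
    (Quotient.mk _ G : GraphClass L k) ∈ clusterEvent lt c ι ↔ ∃ f w, IsCluster lt G c ι f w := by
  constructor
  · rintro ⟨G', hG', f, w, h⟩
    obtain ⟨e, he, he'⟩ := Quotient.exact hG'
    refine ⟨e ∘ f, e w, h.wf, e.injective.comp h.inj, fun j => ?_, fun i j hij => ?_,
      fun a b => ?_, fun a y hy => ?_, ?_, fun a ha => h.ne_out a (e.injective ha)⟩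
    · rw [Function.comp_apply, h.root, he']
    · simp only [Function.comp_apply, he]
      exact h.mono i j hij
    · rw [← h.adj a b]
      exact e.map_adj_iff
    · have h1 : G'.graph.Adj (f a) (e.symm y) := by
        rw [← e.map_adj_iff]
        simpa using hy
      rcases h.out a _ h1 with ⟨b, hb⟩ | ⟨ha, hw⟩
      · exact Or.inl ⟨b, by simp [hb]⟩
      · exact Or.inr ⟨ha, by simp [← hw]⟩
    · exact e.map_adj_iff.2 h.adj_out
  · exact fun h => ⟨G, rfl, h⟩

/-- Whether the roots lie in such a cluster can be seen in any ball that contains the cluster and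
its neighbours, and small changes of the labels do not alter their order. -/
theorem measurableSet_clusterEvent {L : Type} [TopologicalSpace L] [SecondCountableTopology L]
    {lt : L → L → Prop} (hlt : IsOpen {q : L × L | lt q.1 q.2}) {k : ℕ} (j₀ : Fin k) (c : Code)
    (ι : Fin k → Fin c.1) : MeasurableSet (clusterEvent (k := k) lt c ι) := by
  apply measurableSet_of_ballEvent
  rintro _ ⟨G, rfl, f, w, h⟩
  set r := Finset.univ.sup (fun a => G.graph.dist (G.root j₀) (f a)) + 1 with hr
  have hfr : ∀ a, G.graph.dist (G.root j₀) (f a) + 1 ≤ r := fun a =>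
    Nat.succ_le_succ (Finset.le_sup (f := fun a => G.graph.dist (G.root j₀) (f a))
      (Finset.mem_univ a))
  set B : Set G.V := {v | ∃ j, G.graph.dist (G.root j) v ≤ r} with hB
  have hBfin : B.Finite := by
    have : B = ⋃ j, {v | G.graph.dist (G.root j) v ≤ r} := by
      ext v
      simp [hB]
    rw [this]
    exact finite_iUnion fun j => finite_ball G.connected G.locallyFinite _ _
  have := hBfin.to_subtype
  obtain ⟨n, ⟨E⟩⟩ := Finite.exists_equiv_fin B
  have hrootB : ∀ j, G.root j ∈ B := fun j => ⟨j, by simp⟩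
  have hfB : ∀ a, f a ∈ B := fun a => ⟨j₀, by have := hfr a; omega⟩
  have hnb : ∀ a y, G.graph.Adj (f a) y → y ∈ B := by
    intro a y hy
    refine ⟨j₀, ?_⟩
    have h1 := G.connected.dist_triangle (u := G.root j₀) (v := f a) (w := y)
    rw [SimpleGraph.dist_eq_one_iff_adj.2 hy] at h1
    have := hfr a
    omega
  have hwB : w ∈ B := hnb _ _ h.adj_out
  set e : Fin n → G.V := fun i => (E.symm i : G.V) with he
  have hE : ∀ v (hv : v ∈ B), e (E ⟨v, hv⟩) = v := fun v hv => by simp [he]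
  have heinj : Function.Injective e := Subtype.val_injective.comp E.symm.injective
  set b : Fin c.1 → Fin n := fun a => E ⟨f a, hfB a⟩ with hb
  have heb : ∀ a, e (b a) = f a := fun a => hE _ _
  have hbinj : Function.Injective b := fun a a' haa => h.inj (by rw [← heb, ← heb, haa])
  have hop : IsOpen {y : Fin n → L | ∀ i j, i < j → lt (y (b i)) (y (b j))} := by
    simp only [ofPred_forall]
    refine isOpen_iInter_of_finite fun i => isOpen_iInter_of_finite fun j =>
      isOpen_iInter_of_finite fun _ => ?_
    exact hlt.preimage (f := fun y : Fin n → L => (y (b i), y (b j))) (by fun_prop)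
  obtain ⟨O, hO, hsub⟩ := isOpen_pi_iff'.1 hop (fun i => G.label (e i)) (by
    intro i j hij
    dsimp only
    rw [heb, heb]
    exact h.mono i j hij)
  refine ⟨r, n, G.graph.comap e, fun j => E ⟨_, hrootB j⟩, O, fun i => (hO i).1,
    ⟨G, rfl, e, heinj, ?_, fun _ _ => Iff.rfl, fun j => hE _ _, fun i => (hO i).2⟩, ?_⟩
  · ext v
    constructor
    · rintro ⟨i, rfl⟩
      exact (E.symm i).2
    · exact fun hv => ⟨E ⟨v, hv⟩, hE v hv⟩
  rintro _ ⟨G', rfl, e', he'inj, hrange, hadj, hroot, hlab⟩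
  have hdist : ∀ s, s ≤ r → ∀ i, G.graph.dist (G.root j₀) (e i) ≤ s →
      G'.graph.dist (G'.root j₀) (e' i) ≤ s := by
    intro s
    induction s with
    | zero =>
      intro _ i hi
      have h1 : G.root j₀ = e i := G.connected.dist_eq_zero_iff.1 (Nat.le_zero.1 hi)
      have h2 : E ⟨_, hrootB j₀⟩ = i := heinj (by rw [hE, h1])
      rw [← hroot j₀]
      dsimp only
      rw [h2]
      simp
    | succ s ih =>
      intro hs i hi
      rcases Nat.lt_or_ge s (G.graph.dist (G.root j₀) (e i)) with h1 | h1
      · obtain ⟨u, huv, h2⟩ := exists_adj_dist_le G.connected (le_antisymm hi h1)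
        have huB : u ∈ B := ⟨j₀, by omega⟩
        have h3 := ih (by omega) (E ⟨u, huB⟩) (by rw [hE]; omega)
        have h4 : G'.graph.Adj (e' (E ⟨u, huB⟩)) (e' i) := by
          rw [hadj, SimpleGraph.comap_adj, hE]
          exact huv
        have h5 := G'.connected.dist_triangle (u := G'.root j₀) (v := e' (E ⟨u, huB⟩)) (w := e' i)
        rw [SimpleGraph.dist_eq_one_iff_adj.2 h4] at h5
        omega
      · exact (ih (by omega) i h1).trans (Nat.le_succ s)
  have hadj' : ∀ i j, G'.graph.Adj (e' i) (e' j) ↔ G.graph.Adj (e i) (e j) := hadj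
  refine ⟨G', rfl, e' ∘ b, e' (E ⟨w, hwB⟩), h.wf, he'inj.comp hbinj, fun j => ?_,
    hsub fun i _ => hlab i, fun x y => ?_, fun a y hy => ?_, ?_, fun a ha => ?_⟩
  · rw [← hroot j, Function.comp_apply]
    congr 1
    exact heinj (by rw [heb, hE, h.root])
  · rw [Function.comp_apply, Function.comp_apply, hadj', heb, heb, h.adj]
  · have h1 : G'.graph.dist (G'.root j₀) (e' (b a)) + 1 ≤ r := by
      have := hfr a
      have := hdist (G.graph.dist (G.root j₀) (f a)) (by omega) (b a) (by rw [heb])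
      omega
    have h2 := G'.connected.dist_triangle (u := G'.root j₀) (v := e' (b a)) (w := y)
    rw [show G'.graph.dist (e' (b a)) y = 1 from SimpleGraph.dist_eq_one_iff_adj.2 hy] at h2
    have h3 : y ∈ range e' := by
      rw [hrange]
      exact ⟨j₀, by omega⟩
    obtain ⟨i, rfl⟩ := h3
    rw [Function.comp_apply, hadj', heb] at hy
    rcases h.out a _ hy with ⟨b', hb'⟩ | ⟨ha, hw⟩
    · exact Or.inl ⟨b', congrArg e' (heinj (by rw [heb, hb']))⟩
    · exact Or.inr ⟨ha, congrArg e' (heinj (by rw [hE, hw]))⟩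
  · rw [Function.comp_apply, hadj', heb, hE]
    exact h.adj_out
  · have h1 := he'inj ha
    exact h.ne_out a (by rw [← heb, h1, hE])

/-! ### Clusters in a one-ended tree -/

section OneEnded

variable {L : Type} {lt : L → L → Prop} {k : ℕ} {G : RootedLabelledGraph L k} {p : G.V → G.V}
  {c : Code} {ι : Fin k → Fin c.1} {f : Fin c.1 → G.V} {w : G.V}

/-- The infinite chain of ancestors of a vertex must leave the finite set `range f`, and can do so
only through the edge from the top to `w`. This determines the parents in `range f`. -/
theorem IsCluster.enum (h : IsCluster lt G c ι f w) (hp : IsParentMap G.graph p) :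
    Enum p (fun x y => lt (G.label x) (G.label y)) (f c.top) c f := by
  have hadjp : ∀ x, G.graph.Adj x (p x) := fun x => (hp.adj _ _).2 (Or.inl rfl)
  have hout : ∀ a, (∃ b, f b = p (f a)) ∨ (a = c.top ∧ p (f a) = w) := fun a =>
    h.out a _ (hadjp _)
  have hexit : ∀ a, Below p (f a) (f c.top) ∧ p (f c.top) = w := by
    intro a
    by_contra hcon
    have key : ∀ k, (∃ b, f b = p^[k] (f a)) := by
      intro k
      induction k with
      | zero => exact ⟨a, rfl⟩
      | succ k ih =>
        obtain ⟨b, hb⟩ := ih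
        rcases hout b with ⟨b', hb'⟩ | ⟨rfl, hw⟩
        · exact ⟨b', by rw [Function.iterate_succ_apply', ← hb, hb']⟩
        · exact absurd ⟨⟨k, hb.symm⟩, hw⟩ hcon
    choose b hb using key
    obtain ⟨k, l, hkl, he⟩ := Finite.exists_ne_map_eq_of_infinite b
    have key : ∀ k l, k < l → b k ≠ b l := by
      intro k l hkl he
      have h1 : p^[l - k] (p^[k] (f a)) = p^[k] (f a) := by
        rw [← Function.iterate_add_apply, Nat.sub_add_cancel hkl.le, ← hb, ← hb, he]
      exact hp.acyclic _ _ (by omega) h1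
    rcases lt_or_gt_of_ne hkl with h1 | h1
    · exact key _ _ h1 he
    · exact key _ _ h1 he.symm
  have hw := (hexit c.top).2
  refine ⟨h.inj, ?_, rfl, h.wf.par_top, ?_, h.mono⟩
  · ext x
    constructor
    · rintro ⟨a, rfl⟩
      exact (hexit a).1
    · rintro ⟨k, hk⟩
      induction k generalizing x with
      | zero => exact ⟨c.top, hk.symm⟩
      | succ k ih =>
        obtain ⟨a, ha⟩ := ih (p x) (by rwa [← Function.iterate_succ_apply])
        rcases h.out a x (by rw [ha]; exact (hadjp x).symm) with hb | ⟨rfl, rfl⟩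
        · exact hb
        · rw [ha] at hw
          exact absurd hw (hp.acyclic x 2 two_pos)
  · intro i hi
    obtain ⟨k, hk⟩ := h.wf.below i
    induction k generalizing i with
    | zero => exact absurd hk hi
    | succ k ih =>
      have h1 : G.graph.Adj (f i) (f (c.par i)) := (h.adj _ _).2 (Or.inl ⟨hi, rfl⟩)
      rcases (hp.adj _ _).1 h1 with h2 | h2
      · exact h2.symm
      · by_cases h3 : c.par i = c.top
        · rw [h3, hw] at h2
          exact absurd h2.symm (h.ne_out i)
        · have h4 := ih (c.par i) h3 (by rwa [← Function.iterate_succ_apply])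
          rw [h2] at h4
          have h5 : c.par (c.par i) = i := h.inj h4
          exact absurd (h.wf.isForest.anti _ _ (Below.parent i) ⟨1, h5⟩).symm (h.wf.par_ne hi)

theorem Enum.isCluster (hp : IsParentMap G.graph p)
    {s : G.V} (h : Enum p (fun x y => lt (G.label x) (G.label y)) s c f)
    (hι : ∀ j, f (ι j) = G.root j) : IsCluster lt G c ι f (p s) := by
  have hnot : ∀ b, f b ≠ p s := fun b hb => by
    have h1 := h.below b
    rw [hb] at h1
    exact hp.ne s (hp.isForest.anti _ _ h1 (Below.parent s))
  have key : ∀ a b, p (f a) = f b ↔ a ≠ c.top ∧ b = c.par a := by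
    intro a b
    constructor
    · intro hab
      have ha : a ≠ c.top := by
        rintro rfl
        rw [h.top] at hab
        exact hnot b hab.symm
      rw [← h.par a ha] at hab
      exact ⟨ha, (h.inj hab).symm⟩
    · rintro ⟨ha, rfl⟩
      exact (h.par a ha).symm
  refine ⟨h.wf hp.isForest, h.inj, hι, h.mono, fun a b => ?_, fun a y hy => ?_, ?_, hnot⟩
  · rw [hp.adj, key, key]
  · rcases (hp.adj _ _).1 hy with h1 | h1
    · by_cases ha : a = c.top
      · right
        rw [ha, h.top] at h1
        exact ⟨ha, h1.symm⟩
      · exact Or.inl ⟨_, (h.par a ha).trans h1⟩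
    · refine Or.inl (h.exists_eq ?_)
      exact (Below.parent y).trans (h1 ▸ h.below a)
  · rw [h.top]
    exact (hp.adj _ _).2 (Or.inl rfl)

end OneEnded

/-- In a one-ended tree the sets of the cluster events are the sets of descendants of vertices. -/
theorem LFGraph.mem_clusterEvent {L : Type} {lt : L → L → Prop} {k : ℕ} (T : LFGraph)
    {p : T.V → T.V} (hp : IsParentMap T.graph p) (ℓ : T.V → L) (x : Fin k → T.V) (c : Code)
    (ι : Fin k → Fin c.1) : T.mk' ℓ x ∈ clusterEvent lt c ι ↔
      ∃ s f, Enum p (fun x y => lt (ℓ x) (ℓ y)) s c f ∧ ∀ j, f (ι j) = x j := by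
  refine mk_mem_clusterEvent.trans ⟨?_, ?_⟩
  · rintro ⟨f, w, h⟩
    exact ⟨_, f, h.enum hp, h.root⟩
  · rintro ⟨s, f, h, hf⟩
    exact ⟨f, p s, Enum.isCluster (G := ⟨T, ℓ, x⟩) hp h hf⟩

/-! ### The rule -/

instance : Countable Code := inferInstanceAs (Countable (Σ m, (Fin m → Fin m) × Fin m))

section Stage

variable {L : Type}

/-- The event that the roots are the vertices numbered `ι` in a cluster of stage `n` with code `c`
that gets a box. It is expressed by means of the code of the tree below the parent of the top of
the cluster, since the size of that tree enters into the definition of the clusters. -/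
def stageEvent (κ : ℕ → ℕ) (n : ℕ) (lt : L → L → Prop) {k : ℕ} (c : Code) (ι : Fin k → Fin c.1) :
    Set (GraphClass L k) :=
  ⋃ (c' : Code) (r : Fin c'.1) (f : Fin c.1 → Fin c'.1) (_ : Enum c'.par (· < ·) r c f ∧
    r ≠ c'.top ∧ c'.par r = c'.top ∧ IsRoot κ n c'.par r), clusterEvent lt c' (f ∘ ι)

theorem measurableSet_stageEvent [TopologicalSpace L] [SecondCountableTopology L]
    {lt : L → L → Prop} (hlt : IsOpen {q : L × L | lt q.1 q.2}) (κ : ℕ → ℕ) (n : ℕ) {k : ℕ}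
    (j₀ : Fin k) (c : Code) (ι : Fin k → Fin c.1) :
    MeasurableSet (stageEvent κ n lt c ι) :=
  .iUnion fun c' => .iUnion fun _ => .iUnion fun f => .iUnion fun _ =>
    measurableSet_clusterEvent hlt j₀ c' (f ∘ ι)

theorem LFGraph.mem_stageEvent [LinearOrder L] {κ : ℕ → ℕ} {n k : ℕ} (T : LFGraph)
    {p : T.V → T.V} (hp : IsParentMap T.graph p) {ℓ : T.V → L} (hℓ : Function.Injective ℓ)
    (x : Fin k → T.V) (c : Code) (ι : Fin k → Fin c.1) :
    T.mk' ℓ x ∈ stageEvent κ n (· < ·) c ι ↔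
      ∃ s f, Enum p (fun x y => ℓ x < ℓ y) s c f ∧ IsRoot κ n p s ∧ ∀ j, f (ι j) = x j := by
  have hroot : ∀ {t : T.V} {c' : Code} {f : Fin c'.1 → T.V} {r : Fin c'.1},
      Enum p (fun x y => ℓ x < ℓ y) t c' f → r ≠ c'.top →
        (IsRoot κ n c'.par r ↔ IsRoot κ n p (f r)) := by
    intro t c' f r h hr
    simp only [IsRoot]
    rw [h.sz_eq hp.isForest, h.sz_eq hp.isForest, h.par r hr]
  simp only [stageEvent, mem_iUnion]
  constructor
  · rintro ⟨c', r, f, ⟨h1, h2, h3, h4⟩, h5⟩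
    obtain ⟨t, F, h6, h7⟩ := (T.mem_clusterEvent hp ℓ x c' _).1 h5
    exact ⟨F r, F ∘ f, h6.comp hp.isForest h1, (hroot h6 h2).1 h4, h7⟩
  · rintro ⟨s, f, h1, h2, h3⟩
    obtain ⟨c', F, h4⟩ := Enum.exists_of_injective ℓ hℓ hp.isForest (p s)
    obtain ⟨r, hr⟩ := h4.exists_eq (Below.parent s)
    have hrt : r ≠ c'.top := by
      rintro rfl
      rw [h4.top] at hr
      exact hp.ne s hr
    obtain ⟨c'', f', h5⟩ := Enum.exists (h4.wf hp.isForest).isForest r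
    have h6 := h4.comp hp.isForest h5
    rw [hr] at h6
    obtain ⟨rfl, h7⟩ := Sigma.mk.inj_iff.1 (Enum.unique h6 h1)
    obtain rfl := eq_of_heq h7
    refine ⟨c', r, f', ⟨h5, hrt, h4.inj ?_, (hroot h4 hrt).2 (by rwa [hr])⟩,
      (T.mem_clusterEvent hp ℓ x c' _).2 ⟨p s, F, h4, h3⟩⟩
    rw [h4.par r hrt, hr, h4.top]

end Stage

theorem measurableSet_eventually {α : Type*} [MeasurableSpace α] {S : ℕ → Set α}
    (hS : ∀ n, MeasurableSet (S n)) : MeasurableSet {g | ∀ᶠ n in Filter.atTop, g ∈ S n} := by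
  have : {g | ∀ᶠ n in Filter.atTop, g ∈ S n} = ⋃ N, ⋂ n, ⋂ (_ : N ≤ n), S n := by
    ext g
    simp [Filter.eventually_atTop]
  rw [this]
  exact .iUnion fun N => .iInter fun n => .iInter fun _ => hS n

theorem isOpen_lt_lab : IsOpen {q : Lab × Lab | q.1 < q.2} :=
  isOpen_lt continuous_fst continuous_snd

/-- The event that the root is the vertex at a grid point of the box of its cluster of stage `n`. -/
def siteEvent (κ : ℕ → ℕ) (n : ℕ) : Set (GraphClass Lab 1) :=
  ⋃ (c : Code) (z ∈ latticeBox (dims n c.1)), stageEvent κ n (· < ·) c ![(plan κ n c).site z]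

/-- The event that the two roots are the vertices at grid points of the box of their cluster of
stage `n`, the second being next to the first in the direction `a`. -/
def edgeEvent (κ : ℕ → ℕ) (n : ℕ) (a : Fin 3) : Set (GraphClass Lab 2) :=
  ⋃ (c : Code) (z ∈ latticeBox (dims n c.1)) (_ : z + Pi.single a 1 ∈ latticeBox (dims n c.1)),
    stageEvent κ n (· < ·) c ![(plan κ n c).site z, (plan κ n c).site (z + Pi.single a 1)]

/-- The tile of the vertex `i` of the tree `c` in the plan of stage `n`, in the coordinates in which
the grid point `z` is the origin. -/
def tileValue (κ : ℕ → ℕ) (n : ℕ) (c : Code) (z : Fin 3 → ℤ) (i : Fin c.1) : Set E3 :=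
  {q | q + latticePoint z ∈ interior ((plan κ n c).sol i) \
    ⋃ j ∈ {j | j ≠ c.top ∧ c.par j = i}, (plan κ n c).sol j}

/-- The event that, according to the plan of stage `n`, the tile of the second root is `S` in the
coordinates in which the first root is the origin. -/
def tileEvent (κ : ℕ → ℕ) (n : ℕ) (S : Set E3) : Set (GraphClass Lab 2) :=
  ⋃ (c : Code) (z ∈ latticeBox (dims n c.1)) (i : Fin c.1) (_ : tileValue κ n c z i = S),
    stageEvent κ n (· < ·) c ![(plan κ n c).site z, i]

theorem exists_tileValue_seq (κ : ℕ → ℕ) :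
    ∃ S : ℕ → Set E3, ∀ n c z i, ∃ m, S m = tileValue κ n c z i := by
  have : Nonempty (Σ c : Code, ℕ × (Fin 3 → ℤ) × Fin c.1) := ⟨⟨1, ⟨id, 0⟩⟩, 0, 0, 0⟩
  obtain ⟨e, he⟩ := exists_surjective_nat (Σ c : Code, ℕ × (Fin 3 → ℤ) × Fin c.1)
  refine ⟨fun m => tileValue κ (e m).2.1 (e m).1 (e m).2.2.1 (e m).2.2.2, fun n c z i => ?_⟩
  obtain ⟨m, hm⟩ := he ⟨c, n, z, i⟩
  exact ⟨m, by dsimp only; rw [hm]⟩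

/-- An enumeration of the possible tiles. -/
noncomputable def tileSeq (κ : ℕ → ℕ) : ℕ → Set E3 := (exists_tileValue_seq κ).choose

theorem measurableSets_first {α : Type*} [MeasurableSpace α] (B : ℕ → Set α)
    (hB : ∀ m, MeasurableSet (B m)) (S : ℕ → Set E3) :
    MeasurableSets fun g => {q | ∃ m, g ∈ B m ∧ (∀ m' < m, g ∉ B m') ∧ q ∈ S m} := by
  intro K _
  rcases K.eq_empty_or_nonempty with rfl | ⟨q₀, hq₀⟩
  · simp
  · have : {g | K ⊆ {q | ∃ m, g ∈ B m ∧ (∀ m' < m, g ∉ B m') ∧ q ∈ S m}} =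
        ⋃ (m : ℕ) (_ : K ⊆ S m), B m ∩ ⋂ (m' : ℕ) (_ : m' < m), (B m')ᶜ := by
      ext g
      simp only [mem_ofPred_eq, mem_iUnion, mem_inter_iff, mem_iInter, mem_compl_iff, exists_prop]
      constructor
      · intro h
        obtain ⟨m, h1, h2, -⟩ := h hq₀
        refine ⟨m, fun q hq => ?_, h1, h2⟩
        obtain ⟨m', h1', h2', h3'⟩ := h hq
        obtain rfl : m = m' := by
          by_contra hne
          rcases lt_or_gt_of_ne hne with h | h
          · exact h2' m h h1
          · exact h2 m' h h1'
        exact h3'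
      · rintro ⟨m, h1, h2, h3⟩ q hq
        exact ⟨m, h2, h3, h1 hq⟩
    rw [this]
    exact .iUnion fun m => .iUnion fun _ => (hB m).inter (.iInter fun m' => .iInter fun _ =>
      (hB m').compl)

/-- The rule: it follows the plans of stage `n` that agree for all large `n`. The tile is the first
set in an enumeration of the possible tiles on which they agree; as there are countably many
possible tiles, this is a measurable choice. -/
noncomputable def rule (κ : ℕ → ℕ) : FiidGridTiling where
  U := {g | ∀ᶠ n in Filter.atTop, g ∈ siteEvent κ n}
  E a := {g | ∀ᶠ n in Filter.atTop, g ∈ edgeEvent κ n a}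
  tile g := {q | ∃ m, (∀ᶠ n in Filter.atTop, g ∈ tileEvent κ n (tileSeq κ m)) ∧
    (∀ m' < m, ¬ ∀ᶠ n in Filter.atTop, g ∈ tileEvent κ n (tileSeq κ m')) ∧ q ∈ tileSeq κ m}
  measurable_U := measurableSet_eventually fun n => .iUnion fun c => .iUnion fun _ =>
    .iUnion fun _ => measurableSet_stageEvent isOpen_lt_lab κ n 0 c _
  measurable_E _ := measurableSet_eventually fun n => .iUnion fun c => .iUnion fun _ =>
    .iUnion fun _ => .iUnion fun _ => measurableSet_stageEvent isOpen_lt_lab κ n 0 c _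
  measurable_tile := measurableSets_first _ (fun _ => measurableSet_eventually fun n =>
    .iUnion fun c => .iUnion fun _ => .iUnion fun _ => .iUnion fun _ => .iUnion fun _ =>
      measurableSet_stageEvent isOpen_lt_lab κ n 0 c _) _

/-! ### The rule succeeds -/

theorem add_mem_shift {q : E3} {z σ : Fin 3 → ℤ} {S : Set E3} :
    q + latticePoint (z + σ) ∈ shift σ S ↔ q + latticePoint z ∈ S := by
  rw [shift, mem_ofPred_eq, latticePoint_add, ← add_assoc, add_sub_cancel_right]

/-- The plans of the clusters of a fixed vertex form a sequence to which `exists_limit_plan`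
applies, and every finite set of vertices lies in these clusters from some stage on. -/
theorem rule_represents {κ : ℕ → ℕ} (h0 : κ 0 = 1) (T : LFGraph) {p : T.V → T.V}
    (hp : IsParentMap T.graph p) {ℓ : T.V → Lab} (hℓ : Function.Injective ℓ)
    (hgood : ∀ v, ∀ᶠ n in Filter.atTop, ∃ s, Below p v s ∧ IsRoot κ n p s) :
    (rule κ).Represents T ℓ := by
  have hfor := hp.isForest
  -- `s m` is the top of the cluster of `o` of stage `m + n₀`
  obtain ⟨o⟩ := T.connected.nonempty
  obtain ⟨n₀, hn₀⟩ := Filter.eventually_atTop.1 (hgood o)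
  choose s hos hs using fun m => hn₀ (m + n₀) (Nat.le_add_left _ _)
  choose c f hen using fun m => Enum.exists_of_injective ℓ hℓ hfor (s m)
  have hcs : ∀ m, (c m).1 = sz p (s m) := fun m => ((hen m).sz_top hfor).symm
  have hlt : ∀ m, sz p (s m) < sz p (s (m + 1)) := by
    intro m
    have h1 := (hs m).2.1
    have h2 := (hs (m + 1)).1
    rw [show m + 1 + n₀ = (m + n₀) + 1 by omega] at h2
    simp only [minSize] at h2
    have h3 : 2 * κ (m + n₀) + 10 ≤ 384 * 4 ^ (m + n₀ + 1) * (2 * κ (m + n₀) + 10) :=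
      Nat.le_mul_of_pos_left _ (by positivity)
    omega
  have hss : ∀ m, Below p (s m) (s (m + 1)) := by
    intro m
    rcases (hos m).total (hos (m + 1)) with h | h
    · exact h
    · exact absurd (hfor.sz_le h) (by have := hlt m; omega)
  have hbel : ∀ v, ∀ᶠ m in Filter.atTop, Below p v (s m) := by
    intro v
    obtain ⟨w, how, hvw⟩ := hp.exists_common T.connected o v
    have h1 := (Filter.tendsto_add_atTop_nat n₀).eventually (hgood w)
    filter_upwards [h1] with m hm
    obtain ⟨s', hws, hs'⟩ := hm
    have h2 : s' = s m := by
      rcases (how.trans hws).total (hos m) with h | h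
      · exact hs'.eq_of_below hfor (hs m) h
      · exact ((hs m).eq_of_below hfor hs' h).symm
    exact h2 ▸ hvw.trans hws
  set P : ℕ → Plan T.V := fun m => (plan κ (m + n₀) (c m)).push (f m) with hP
  set D : ℕ → Fin 3 → ℕ := fun m => dims (m + n₀) (c m).1 with hD
  have hwf : ∀ m, (c m).WF := fun m => (hen m).wf hfor
  have hplan : ∀ m, IsPlan p (s m) (D m) (P m) := fun m =>
    (hen m).isPlan_push
      ((plan_spec h0 _).1 _ (hwf m) (hcs m ▸ (hs m).1) (hcs m ▸ (hs m).2.1)) (hwf m)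
  have hext : ∀ m, ∃ τ, Extends p (s m) (D m) (P m) (D (m + 1)) (P (m + 1)) τ := by
    intro m
    have e1 : m + 1 + n₀ = (m + n₀) + 1 := by omega
    have h1 : minSize κ (m + n₀ + 1) ≤ (c (m + 1)).1 := by
      rw [hcs, ← e1]
      exact (hs (m + 1)).1
    have hstep := (plan_spec h0 (m + n₀)).2 _ (hwf (m + 1)) h1
    obtain ⟨r, hr⟩ := (hen (m + 1)).exists_eq (hss m)
    have hrt : r ≠ (c (m + 1)).top := by
      rintro rfl
      rw [(hen (m + 1)).top] at hr
      have := hlt m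
      rw [hr] at this
      exact lt_irrefl _ this
    obtain ⟨c', f', h5⟩ := Enum.exists (hwf (m + 1)).isForest r
    have h6 := (hen (m + 1)).comp hfor h5
    rw [hr] at h6
    have hroot : IsRoot κ (m + n₀) (c (m + 1)).par r := by
      have := hs m
      simp only [IsRoot] at this ⊢
      rw [(hen (m + 1)).sz_eq hfor, (hen (m + 1)).sz_eq hfor, (hen (m + 1)).par r hrt, hr]
      exact this
    obtain ⟨τ, hτ⟩ := hstep.2 r c' f' h5 hroot
    have h7 := (hen (m + 1)).extends_push hfor hτ
    rw [Plan.push_comp (hen (m + 1)).inj h5.inj, hr] at h7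
    have h8 : (⟨c', f (m + 1) ∘ f'⟩ : Σ c : Code, Fin c.1 → T.V) = ⟨c m, f m⟩ :=
      Enum.unique h6 (hen m)
    have key : ∀ (a b : Σ c : Code, Fin c.1 → T.V), a = b →
        Extends p (s m) (dims (m + n₀) a.1.1) ((plan κ (m + n₀) a.1).push a.2)
          (dims (m + n₀ + 1) (c (m + 1)).1) ((plan κ (m + n₀ + 1) (c (m + 1))).push (f (m + 1))) τ →
        Extends p (s m) (dims (m + n₀) b.1.1) ((plan κ (m + n₀) b.1).push b.2)
          (dims (m + n₀ + 1) (c (m + 1)).1)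
          ((plan κ (m + n₀ + 1) (c (m + 1))).push (f (m + 1))) τ := by
      rintro a _ rfl h
      exact h
    have h9 := key _ _ h8 h7
    refine ⟨τ, ?_⟩
    simp only [hP, hD, e1]
    exact h9
  have hDpos : ∀ m i, 0 < D m i := by
    intro m i
    have h1 := base_pos (m + n₀) i
    have h2 := one_le_height ((le_minSize κ (m + n₀)).trans (hcs m ▸ (hs m).1))
    simp only [hD, dims, boxDim]
    split_ifs <;> omega
  obtain ⟨σ, ψ, A, hψ, hbox, hψP, hAP, hA⟩ :=
    exists_limit_plan s D hDpos P hplan hss hext hp.ne hfor fun v => (hbel v).exists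
  have hsite : ∀ w m, w - σ m ∈ latticeBox (D m) →
      f m ((plan κ (m + n₀) (c m)).site (w - σ m)) = ψ w := by
    intro w m hw
    rw [← sub_add_cancel w (σ m), hψP m _ hw, sub_add_cancel]
    rfl
  -- a cluster of stage `m + n₀` that contains a vertex below `s m` is the one of `s m`
  have hstage : ∀ {k : ℕ} (x : Fin k → T.V) (j : Fin k) m, Below p (x j) (s m) →
      ∀ (d : Code) (ι : Fin k → Fin d.1), T.mk' ℓ x ∈ stageEvent κ (m + n₀) (· < ·) d ι →
        ∃ h : d = c m, ∀ j, f m (h ▸ ι j) = x j := by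
    intro k x j m hj d ι hmem
    obtain ⟨s', F, h1, h2, h3⟩ := (T.mem_stageEvent hp hℓ x d ι).1 hmem
    have h4 : Below p (x j) s' := h3 j ▸ h1.below _
    obtain rfl : s' = s m := by
      rcases h4.total hj with h | h
      · exact h2.eq_of_below hfor (hs m) h
      · exact ((hs m).eq_of_below hfor h2 h).symm
    obtain ⟨h5, h6⟩ := Sigma.mk.inj_iff.1 (Enum.unique h1 (hen m))
    subst h5
    obtain rfl := eq_of_heq h6
    exact ⟨rfl, h3⟩
  have hstage' : ∀ {k : ℕ} (x : Fin k → T.V) m (ι : Fin k → Fin (c m).1), (∀ j, f m (ι j) = x j) →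
      T.mk' ℓ x ∈ stageEvent κ (m + n₀) (· < ·) (c m) ι := fun x m ι h =>
    (T.mem_stageEvent hp hℓ x _ ι).2 ⟨s m, f m, hen m, hs m, h⟩
  have hshift : ∀ {Q : ℕ → Prop}, (∀ᶠ n in Filter.atTop, Q n) ↔
      ∀ᶠ m in Filter.atTop, Q (m + n₀) := by
    intro Q
    rw [← Filter.map_add_atTop_eq_nat n₀, Filter.eventually_map, Filter.map_add_atTop_eq_nat]
  have hverts : ∀ x, x ∈ (rule κ).verts T ℓ ↔ x ∈ range ψ := by
    intro x
    have h1 : x ∈ (rule κ).verts T ℓ ↔ ∀ᶠ m in Filter.atTop, T.mk' ℓ ![x] ∈ siteEvent κ (m + n₀) :=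
      hshift
    rw [h1]
    constructor
    · intro h
      obtain ⟨m, hm, hxm⟩ := (h.and (hbel x)).exists
      simp only [siteEvent, mem_iUnion] at hm
      obtain ⟨d, z, hz, hmem⟩ := hm
      obtain ⟨rfl, h2⟩ := hstage ![x] 0 m hxm d _ hmem
      refine ⟨z + σ m, ?_⟩
      rw [hψP m z hz]
      exact h2 0
    · rintro ⟨w, rfl⟩
      filter_upwards [hbox w] with m hm
      simp only [siteEvent, mem_iUnion]
      refine ⟨c m, w - σ m, hm, hstage' _ _ _ fun j => ?_⟩
      fin_cases j
      exact hsite w m hm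
  have hedge : ∀ a x y, (rule κ).edge T ℓ a x y ↔ ∃ w, ψ w = x ∧ ψ (w + Pi.single a 1) = y := by
    intro a x y
    have h1 : (rule κ).edge T ℓ a x y ↔
        ∀ᶠ m in Filter.atTop, T.mk' ℓ ![x, y] ∈ edgeEvent κ (m + n₀) a := hshift
    rw [h1]
    constructor
    · intro h
      obtain ⟨m, hm, hxm⟩ := (h.and (hbel x)).exists
      simp only [edgeEvent, mem_iUnion] at hm
      obtain ⟨d, z, hz, hz', hmem⟩ := hm
      obtain ⟨rfl, h2⟩ := hstage ![x, y] 0 m hxm d _ hmem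
      refine ⟨z + σ m, ?_, ?_⟩
      · rw [hψP m z hz]
        exact h2 0
      · rw [add_right_comm, hψP m _ hz']
        exact h2 1
    · rintro ⟨w, rfl, rfl⟩
      filter_upwards [hbox w, hbox (w + Pi.single a 1)] with m hm hm'
      simp only [edgeEvent, mem_iUnion]
      have e1 : w - σ m + Pi.single a 1 = w + Pi.single a 1 - σ m := by abel
      refine ⟨c m, w - σ m, hm, by rw [e1]; exact hm', hstage' _ _ _ fun j => ?_⟩
      fin_cases j
      · exact hsite w m hm
      · show f m ((plan κ (m + n₀) (c m)).site (w - σ m + Pi.single a 1)) = _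
        rw [e1]
        exact hsite _ m hm'
  have htile : ∀ w v, (rule κ).tileFrom T ℓ (ψ w) v =
      {q | q + latticePoint w ∈ nestedTile p A v} := by
    intro w v
    have hval : ∀ m z i, Below p v (s m) → z ∈ latticeBox (D m) →
        f m ((plan κ (m + n₀) (c m)).site z) = ψ w → f m i = v →
        tileValue κ (m + n₀) (c m) z i = {q | q + latticePoint w ∈ nestedTile p A v} := by
      intro m z i hv hz hzw hi
      obtain rfl : w = z + σ m := hψ (by rw [hψP m z hz, ← hzw]; rfl)
      have hAf : ∀ j, A (f m j) = shift (σ m) ((plan κ (m + n₀) (c m)).sol j) := by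
        intro j
        rw [hAP m _ ((hen m).below j), hP, Plan.push_sol (hen m).inj]
      ext q
      simp only [tileValue, nestedTile, mem_ofPred_eq, mem_sdiff, mem_iUnion, exists_prop,
        not_exists, not_and]
      rw [← hi, hAf, interior_shift, add_mem_shift]
      refine and_congr Iff.rfl ⟨fun h x hx => ?_, fun h j hj => ?_⟩
      · obtain ⟨j, rfl⟩ := (hen m).exists_eq ((Below.parent x).trans (hx ▸ (hen m).below i))
        have hj : j ≠ (c m).top := by
          rintro rfl
          rw [(hen m).top] at hx
          have h1 := (hen m).below i
          rw [← hx] at h1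
          exact hp.ne _ (hfor.anti _ _ h1 (Below.parent _))
        rw [hAf, add_mem_shift]
        refine h j ⟨hj, (hen m).inj ?_⟩
        rw [(hen m).par j hj, hx]
      · have h1 := h (f m j) (by rw [← (hen m).par j hj.1, hj.2])
        rwa [hAf, add_mem_shift] at h1
    set V₀ : Set E3 := {q | q + latticePoint w ∈ nestedTile p A v} with hV₀
    have huniq : ∀ S, (∀ᶠ n in Filter.atTop, T.mk' ℓ ![ψ w, v] ∈ tileEvent κ n S) → S = V₀ := by
      intro S hS
      obtain ⟨m, hm, hvm, hwm⟩ := ((hshift.1 hS).and ((hbel v).and (hbel (ψ w)))).exists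
      simp only [tileEvent, mem_iUnion] at hm
      obtain ⟨d, z, hz, i, rfl, hmem⟩ := hm
      obtain ⟨rfl, h2⟩ := hstage ![ψ w, v] 0 m hwm d _ hmem
      exact hval m z i hvm hz (h2 0) (h2 1)
    have hexist : ∀ᶠ m in Filter.atTop, ∃ z i, z ∈ latticeBox (D m) ∧
        f m ((plan κ (m + n₀) (c m)).site z) = ψ w ∧ f m i = v ∧
          tileValue κ (m + n₀) (c m) z i = V₀ := by
      filter_upwards [hbel v, hbox w] with m hvm hm
      obtain ⟨i, hi⟩ := (hen m).exists_eq hvm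
      exact ⟨w - σ m, i, hm, hsite w m hm, hi, hval m _ i hvm hm (hsite w m hm) hi⟩
    have hev : ∀ᶠ n in Filter.atTop, T.mk' ℓ ![ψ w, v] ∈ tileEvent κ n V₀ := by
      rw [hshift]
      filter_upwards [hexist] with m ⟨z, i, hz, h1, h2, h3⟩
      simp only [tileEvent, mem_iUnion]
      refine ⟨c m, z, hz, i, h3, hstage' _ _ _ fun j => ?_⟩
      fin_cases j
      · exact h1
      · exact h2
    classical
    have hm : ∃ m, ∀ᶠ n in Filter.atTop, T.mk' ℓ ![ψ w, v] ∈ tileEvent κ n (tileSeq κ m) := by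
      obtain ⟨m, z, i, -, -, -, h3⟩ := hexist.exists
      obtain ⟨m', hm'⟩ := (exists_tileValue_seq κ).choose_spec (m + n₀) (c m) z i
      refine ⟨m', ?_⟩
      have : tileSeq κ m' = V₀ := hm'.trans h3
      rwa [this]
    ext q
    constructor
    · rintro ⟨m, h1, -, h2⟩
      rwa [huniq _ h1] at h2
    · intro hq
      refine ⟨Nat.find hm, Nat.find_spec hm, fun m' h => Nat.find_min hm h, ?_⟩
      rwa [huniq _ (Nat.find_spec hm)]
  set φ : (rule κ).verts T ℓ ≃ (Fin 3 → ℤ) :=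
    (Equiv.setCongr (Set.ext hverts)).trans (Equiv.ofInjective ψ hψ).symm with hφ
  have hψφ : ∀ x, ψ (φ x) = x := fun x => Equiv.apply_ofInjective_symm hψ _
  refine ⟨φ, ⟨fun a x y hxy => ?_, fun a x y => ?_⟩, range (nestedTile p A),
    hA.isTiling hp T.connected, hA.isBrickTiling hp, hA.iso hp T.connected, fun u v => ?_⟩
  · obtain ⟨w, rfl, rfl⟩ := (hedge a x y).1 hxy
    exact ⟨(hverts _).2 ⟨_, rfl⟩, (hverts _).2 ⟨_, rfl⟩⟩
  · rw [hedge, cayleyDiagramZ3]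
    constructor
    · rintro ⟨w, h1, h2⟩
      rw [← hψφ] at h1 h2
      rw [← hψ h1, ← hψ h2]
    · intro h
      exact ⟨φ x, hψφ x, by rw [← h, hψφ]⟩
  · rw [← hψφ u, htile]
    rfl

/-! ### Sizes of clusters in a unimodular tree -/

theorem LFGraph.rooted_out (g : RootedGraphs) :
    (Quotient.out g).toLFGraph.rooted ((Quotient.out g).root 0) = g := by
  conv_rhs => rw [← Quotient.out_eq g]
  refine Quotient.sound ⟨RelIso.refl _, fun _ => rfl, fun j => ?_⟩
  fin_cases j
  rfl

/-- The event that the root has at least `k` descendants. -/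
def largeEvent (k : ℕ) : Set RootedGraphs :=
  ⋃ (c : Code) (_ : k ≤ c.1), clusterEvent (fun _ _ => True) c ![c.top]

/-- The event that some ancestor of the root has between `K` and `k` descendants, and its parent has
at least `k` of them. -/
def goodEvent (K k : ℕ) : Set RootedGraphs :=
  ⋃ (c : Code) (r : Fin c.1) (i : Fin c.1) (_ : r ≠ c.top ∧ c.par r = c.top ∧ Below c.par i r ∧
    K ≤ sz c.par r ∧ sz c.par r < k ∧ k ≤ c.1), clusterEvent (fun _ _ => True) c ![i]

/-- The event that the second root has at least `k` descendants, and the first root lies below a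
child of it with fewer than `K` descendants. -/
def transferEvent (K k : ℕ) : Set BirootedGraphs :=
  ⋃ (c : Code) (r : Fin c.1) (i : Fin c.1) (_ : r ≠ c.top ∧ c.par r = c.top ∧ Below c.par i r ∧
    sz c.par r < K ∧ k ≤ c.1), clusterEvent (fun _ _ => True) c ![i, c.top]

theorem measurableSet_clusterEvent_unit {k : ℕ} (j₀ : Fin k) (c : Code) (ι : Fin k → Fin c.1) :
    MeasurableSet (clusterEvent (L := Unit) (fun _ _ => True) c ι) :=
  measurableSet_clusterEvent (by simp) j₀ c ι

theorem measurableSet_largeEvent (k : ℕ) : MeasurableSet (largeEvent k) :=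
  .iUnion fun c => .iUnion fun _ => measurableSet_clusterEvent_unit 0 c _

theorem measurableSet_goodEvent (K k : ℕ) : MeasurableSet (goodEvent K k) :=
  .iUnion fun c => .iUnion fun _ => .iUnion fun _ => .iUnion fun _ =>
    measurableSet_clusterEvent_unit 0 c _

theorem measurableSet_transferEvent (K k : ℕ) : MeasurableSet (transferEvent K k) :=
  .iUnion fun c => .iUnion fun _ => .iUnion fun _ => .iUnion fun _ =>
    measurableSet_clusterEvent_unit 0 c _

section Tree

variable (T : LFGraph) {p : T.V → T.V}

theorem LFGraph.mem_largeEvent (hp : IsParentMap T.graph p) (x : T.V) (k : ℕ) :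
    T.rooted x ∈ largeEvent k ↔ k ≤ sz p x := by
  simp only [largeEvent, mem_iUnion]
  constructor
  · rintro ⟨c, hc, h⟩
    obtain ⟨s, f, h1, h2⟩ := (T.mem_clusterEvent hp _ _ c _).1 h
    obtain rfl : s = x := h1.top.symm.trans (h2 0)
    rwa [h1.sz_top hp.isForest]
  · intro hk
    obtain ⟨c, f, h⟩ := Enum.exists_true hp.isForest x
    refine ⟨c, h.sz_top hp.isForest ▸ hk, (T.mem_clusterEvent hp _ _ c _).2 ⟨x, f, h, fun j => ?_⟩⟩
    fin_cases j
    exact h.top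

theorem LFGraph.mem_goodEvent (hp : IsParentMap T.graph p) (x : T.V) (K k : ℕ) :
    T.rooted x ∈ goodEvent K k ↔
    ∃ s, Below p x s ∧ K ≤ sz p s ∧ sz p s < k ∧ k ≤ sz p (p s) := by
  simp only [goodEvent, mem_iUnion]
  constructor
  · rintro ⟨c, r, i, ⟨h1, h2, h3, h4, h5, h6⟩, h⟩
    obtain ⟨s, f, h7, h8⟩ := (T.mem_clusterEvent hp _ _ c _).1 h
    rw [h7.sz_eq hp.isForest] at h4 h5
    have hx : f i = x := h8 0
    refine ⟨f r, hx ▸ (h7.below_iff hp.isForest).1 h3, h4, h5, ?_⟩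
    rwa [← h7.par r h1, h2, h7.top, h7.sz_top hp.isForest]
  · rintro ⟨s, h1, h2, h3, h4⟩
    obtain ⟨c, f, h⟩ := Enum.exists_true hp.isForest (p s)
    obtain ⟨r, rfl⟩ := h.exists_eq (Below.parent s)
    obtain ⟨i, rfl⟩ := h.exists_eq (h1.trans (Below.parent _))
    have hr : r ≠ c.top := by
      rintro rfl
      exact hp.ne _ h.top.symm
    refine ⟨c, r, i, ⟨hr, h.inj ?_, (h.below_iff hp.isForest).2 h1, ?_, ?_, ?_⟩,
      (T.mem_clusterEvent hp _ _ c _).2 ⟨_, f, h, fun j => ?_⟩⟩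
    · rw [h.par r hr, h.top]
    · rwa [h.sz_eq hp.isForest]
    · rwa [h.sz_eq hp.isForest]
    · rwa [← h.sz_top hp.isForest]
    · fin_cases j
      rfl

theorem LFGraph.mem_transferEvent (hp : IsParentMap T.graph p) (x y : T.V) (K k : ℕ) :
    T.birooted x y ∈ transferEvent K k ↔
    ∃ s, p s = y ∧ Below p x s ∧ sz p s < K ∧ k ≤ sz p y := by
  simp only [transferEvent, mem_iUnion]
  constructor
  · rintro ⟨c, r, i, ⟨h1, h2, h3, h4, h5⟩, h⟩
    obtain ⟨s, f, h7, h8⟩ := (T.mem_clusterEvent hp _ _ c _).1 h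
    rw [h7.sz_eq hp.isForest] at h4
    have hx : f i = x := h8 0
    obtain rfl : s = y := h7.top.symm.trans (h8 1)
    refine ⟨f r, ?_, hx ▸ (h7.below_iff hp.isForest).1 h3, h4, ?_⟩
    · rw [← h7.par r h1, h2, h7.top]
    · rwa [h7.sz_top hp.isForest]
  · rintro ⟨s, rfl, h1, h2, h3⟩
    obtain ⟨c, f, h⟩ := Enum.exists_true hp.isForest (p s)
    obtain ⟨r, rfl⟩ := h.exists_eq (Below.parent s)
    obtain ⟨i, rfl⟩ := h.exists_eq (h1.trans (Below.parent _))
    have hr : r ≠ c.top := by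
      rintro rfl
      exact hp.ne _ h.top.symm
    refine ⟨c, r, i, ⟨hr, h.inj ?_, (h.below_iff hp.isForest).2 h1, ?_, ?_⟩,
      (T.mem_clusterEvent hp _ _ c _).2 ⟨_, f, h, fun j => ?_⟩⟩
    · rw [h.par r hr, h.top]
    · rwa [h.sz_eq hp.isForest]
    · rwa [← h.sz_top hp.isForest]
    · fin_cases j
      · rfl
      · exact h.top

/-- The largest cluster of size less than `k` around `x` is the one below the last ancestor with
fewer than `k` descendants. -/
theorem LFGraph.exists_transfer (hp : IsParentMap T.graph p) (x : T.V) {K k : ℕ}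
    (hgood : T.rooted x ∉ goodEvent K k)
    (hlarge : T.rooted x ∉ largeEvent k) : ∃ y, T.birooted x y ∈ transferEvent K k := by
  classical
  rw [T.mem_largeEvent hp, not_le] at hlarge
  rw [T.mem_goodEvent hp] at hgood
  have hex : ∃ j, k ≤ sz p (p^[j] x) := ⟨k, (hp.lt_sz_iterate x k).le⟩
  set j := Nat.find hex with hj
  have h1 : k ≤ sz p (p^[j] x) := Nat.find_spec hex
  have hj0 : j ≠ 0 := by
    intro h0
    rw [h0] at h1
    exact absurd h1 (not_le.2 hlarge)
  obtain ⟨i, hi⟩ := Nat.exists_eq_succ_of_ne_zero hj0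
  have h2 : sz p (p^[i] x) < k := not_le.1 (Nat.find_min hex (m := i) (by omega))
  rw [hi, Function.iterate_succ_apply'] at h1
  refine ⟨p (p^[i] x), (T.mem_transferEvent hp _ _ _ _).2 ⟨_, rfl, ⟨i, rfl⟩, ?_, h1⟩⟩
  by_contra h3
  exact hgood ⟨_, ⟨i, rfl⟩, not_lt.1 h3, h2, h1⟩

theorem LFGraph.encard_transfer_le (hp : IsParentMap T.graph p) {d : ℕ}
    (hd : ∀ v, (T.graph.neighborSet v).encard ≤ d) (y : T.V) (K k : ℕ) :
    {x | T.birooted x y ∈ transferEvent K k}.encard ≤ (d * K : ℕ) := by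
  classical
  have hchild : {s | p s = y} ⊆ T.graph.neighborSet y := fun s hs => (hp.adj _ _).2 (Or.inr hs)
  have hfin : {s | p s = y}.Finite := (T.locallyFinite y).subset hchild
  set F := hfin.toFinset.filter fun s => sz p s < K with hF
  set B : Finset T.V := F.biUnion fun s => (hp.finite s).toFinset with hB
  have hsub : {x | T.birooted x y ∈ transferEvent K k} ⊆ B := by
    intro x hx
    obtain ⟨s, h1, h2, h3, -⟩ := (T.mem_transferEvent hp _ _ _ _).1 hx
    simp only [hB, hF, Finset.coe_biUnion, mem_iUnion]
    exact ⟨s, by simp [h1, h3], by simpa using h2⟩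
  have hFd : F.card ≤ d := by
    have h1 : (F : Set T.V).encard ≤ d := by
      refine (encard_le_encard ?_).trans (hd y)
      intro s hs
      simp only [hF, Finset.coe_filter, Finite.mem_toFinset, mem_ofPred_eq] at hs
      exact hchild hs.1
    rw [encard_coe_eq_coe_finsetCard] at h1
    exact_mod_cast h1
  have hcard : B.card ≤ d * K := by
    refine (Finset.card_biUnion_le_card_mul _ _ K fun s hs => ?_).trans
      (Nat.mul_le_mul_right K hFd)
    have h1 := (Finset.mem_filter.1 hs).2
    rw [sz, ncard_eq_toFinset_card _ (hp.finite s)] at h1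
    exact h1.le
  refine (encard_le_encard hsub).trans ?_
  rw [encard_coe_eq_coe_finsetCard]
  exact_mod_cast hcard

end Tree

section Unimodular

variable {d : ℕ} {μ : Measure RootedGraphs}

/-- Send mass one from every vertex whose cluster is too small to the parent of the top of that
cluster. A vertex with at least `k` descendants receives at most `d * K`, and all others receive
nothing. -/
theorem measure_compl_goodEvent_le (hunimodular : IsUnimodular μ)
    (htree : AlmostSurely μ fun T => ∃ p, IsParentMap T.graph p)
    (hdegree : AlmostSurely μ fun T => ∀ v, (T.graph.neighborSet v).encard ≤ d) (K k : ℕ) :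
    μ (goodEvent K k)ᶜ ≤ ((d * K : ℕ) + 1) * μ (largeEvent k) := by
  have hmtp := hunimodular ((transferEvent K k).indicator 1)
    (measurable_one.indicator (measurableSet_transferEvent K k))
  have h1 : μ ((goodEvent K k)ᶜ \ largeEvent k) ≤ ∫⁻ g, ∑' y : (Quotient.out g).V,
      (transferEvent K k).indicator 1
        ((Quotient.out g).toLFGraph.birooted ((Quotient.out g).root 0) y) ∂μ := by
    rw [← lintegral_indicator_one
      ((measurableSet_goodEvent K k).compl.diff (measurableSet_largeEvent k))]
    refine lintegral_mono_ae ?_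
    filter_upwards [htree] with g hg
    obtain ⟨p, hp⟩ := hg _ _ (LFGraph.rooted_out g)
    by_cases hmem : g ∈ (goodEvent K k)ᶜ \ largeEvent k
    · rw [indicator_of_mem hmem]
      have h2 := hmem
      rw [← LFGraph.rooted_out g] at h2
      obtain ⟨y, hy⟩ := (Quotient.out g).toLFGraph.exists_transfer hp _ h2.1 h2.2
      refine le_trans ?_ (ENNReal.le_tsum y)
      rw [indicator_of_mem hy]
      exact le_rfl
    · rw [indicator_of_notMem hmem]
      exact zero_le
  have h2 : ∫⁻ g, ∑' y : (Quotient.out g).V, (transferEvent K k).indicator 1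
        ((Quotient.out g).toLFGraph.birooted y ((Quotient.out g).root 0)) ∂μ ≤
      (d * K : ℕ) * μ (largeEvent k) := by
    rw [← lintegral_indicator_const (measurableSet_largeEvent k)]
    refine lintegral_mono_ae ?_
    filter_upwards [htree, hdegree] with g hg hg'
    obtain ⟨p, hp⟩ := hg _ _ (LFGraph.rooted_out g)
    have hd := hg' _ _ (LFGraph.rooted_out g)
    set T := (Quotient.out g).toLFGraph
    set o := (Quotient.out g).root 0
    have h3 : ∑' y : T.V,
        (transferEvent K k).indicator (1 : BirootedGraphs → ℝ≥0∞) (T.birooted y o) =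
        ({x | T.birooted x o ∈ transferEvent K k}.encard : ℝ≥0∞) := by
      rw [← ENNReal.tsum_set_one, tsum_subtype _ (fun _ => (1 : ℝ≥0∞))]
      rfl
    refine h3.trans_le ?_
    by_cases hmem : g ∈ largeEvent k
    · rw [indicator_of_mem hmem]
      have h4 := T.encard_transfer_le hp hd o K k
      have h5 : (({x | T.birooted x o ∈ transferEvent K k}.encard : ℕ∞) : ℝ≥0∞) ≤
          (((d * K : ℕ) : ℕ∞) : ℝ≥0∞) := ENat.toENNReal_le.2 h4
      simpa using h5
    · have h4 : {x | T.birooted x o ∈ transferEvent K k} = ∅ := by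
        rw [eq_empty_iff_forall_notMem]
        intro x hx
        obtain ⟨s, -, -, -, h5⟩ := (T.mem_transferEvent hp _ _ _ _).1 hx
        apply hmem
        rw [← LFGraph.rooted_out g]
        exact (T.mem_largeEvent hp _ _).2 h5
      rw [h4]
      simp
  calc μ (goodEvent K k)ᶜ ≤ μ (((goodEvent K k)ᶜ \ largeEvent k) ∪ largeEvent k) :=
        measure_mono fun g hg => by
          by_cases h : g ∈ largeEvent k
          · exact Or.inr h
          · exact Or.inl ⟨hg, h⟩
    _ ≤ μ ((goodEvent K k)ᶜ \ largeEvent k) + μ (largeEvent k) := measure_union_le _ _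
    _ ≤ (d * K : ℕ) * μ (largeEvent k) + μ (largeEvent k) := by
        gcongr
        exact (h1.trans_eq hmtp).trans h2
    _ = ((d * K : ℕ) + 1) * μ (largeEvent k) := by ring

theorem tendsto_measure_largeEvent [IsProbabilityMeasure μ]
    (htree : AlmostSurely μ fun T => ∃ p, IsParentMap T.graph p) :
    Filter.Tendsto (fun k => μ (largeEvent k)) Filter.atTop (nhds 0) := by
  have h1 := tendsto_measure_iInter_atTop (μ := μ) (s := largeEvent)
    (fun k => (measurableSet_largeEvent k).nullMeasurableSet)
    (fun k l hkl => iUnion_mono fun c => iUnion_subset fun hc =>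
      subset_iUnion_of_subset (hkl.trans hc) le_rfl) ⟨0, measure_ne_top _ _⟩
  have h2 : μ (⋂ k, largeEvent k) = 0 := by
    rw [← compl_compl (⋂ k, largeEvent k), ← mem_ae_iff]
    filter_upwards [htree] with g hg hmem
    obtain ⟨p, hp⟩ := hg _ _ (LFGraph.rooted_out g)
    rw [← LFGraph.rooted_out g] at hmem
    have h3 := (LFGraph.mem_largeEvent _ hp _ _).1
      (mem_iInter.1 hmem (sz p ((Quotient.out g).root 0) + 1))
    omega
  rwa [h2] at h1

theorem exists_measure_compl_goodEvent_le [IsProbabilityMeasure μ] (hunimodular : IsUnimodular μ)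
    (htree : AlmostSurely μ fun T => ∃ p, IsParentMap T.graph p)
    (hdegree : AlmostSurely μ fun T => ∀ v, (T.graph.neighborSet v).encard ≤ d) (K n : ℕ) :
    ∃ k, μ (goodEvent K k)ᶜ ≤ 2⁻¹ ^ n := by
  have h1 := ENNReal.Tendsto.const_mul (a := ((d * K : ℕ) + 1 : ℝ≥0∞))
    (tendsto_measure_largeEvent htree) (Or.inr (by finiteness))
  rw [mul_zero] at h1
  have h2 : (0 : ℝ≥0∞) < 2⁻¹ ^ n := ENNReal.pow_pos (by simp) n
  obtain ⟨k, hk⟩ := (h1.eventually (gt_mem_nhds h2)).exists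
  exact ⟨k, (measure_compl_goodEvent_le hunimodular htree hdegree K k).trans hk.le⟩

/-- By the Borel–Cantelli lemma, there are scales for which almost surely every vertex lies in a
cluster of stage `n` that gets a box, for all large `n`. -/
theorem exists_scales [IsProbabilityMeasure μ] (hunimodular : IsUnimodular μ)
    (htree : AlmostSurely μ fun T => ∃ p, IsParentMap T.graph p)
    (hdegree : AlmostSurely μ fun T => ∀ v, (T.graph.neighborSet v).encard ≤ d) :
    ∃ κ : ℕ → ℕ, κ 0 = 1 ∧ AlmostSurely μ fun T => ∃ p, IsParentMap T.graph p ∧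
      ∀ v, ∀ᶠ n in Filter.atTop, ∃ s, Below p v s ∧ IsRoot κ n p s := by
  choose kk hkk using exists_measure_compl_goodEvent_le hunimodular htree hdegree
  set κ : ℕ → ℕ := fun n => Nat.rec 1 (fun n k => kk (384 * 4 ^ (n + 1) * (2 * k + 10)) n) n with hκ
  -- the size bound of stage `n + 1` is chosen large in terms of that of stage `n`
  have hκs : ∀ n, κ (n + 1) = kk (minSize κ (n + 1)) n := fun n => rfl
  have hsum : ∑' n, μ (goodEvent (minSize κ (n + 1)) (κ (n + 1)))ᶜ ≠ ⊤ := by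
    refine ne_top_of_le_ne_top (b := 2) (by simp) ?_
    rw [← ENNReal.tsum_geometric_two]
    refine ENNReal.tsum_le_tsum fun n => ?_
    rw [hκs]
    exact hkk _ _
  refine ⟨κ, rfl, ?_⟩
  filter_upwards [htree, ae_eventually_notMem hsum] with g hg hev T o ho
  obtain ⟨p, hp⟩ := hg T o ho
  refine ⟨p, hp, fun v => ?_⟩
  obtain ⟨w, how, hvw⟩ := hp.exists_common T.connected o v
  have hev' : ∀ᶠ n in Filter.atTop, g ∈ goodEvent (minSize κ n) (κ n) := by
    rw [← Filter.map_add_atTop_eq_nat 1, Filter.eventually_map]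
    filter_upwards [hev] with n hn
    simpa using hn
  filter_upwards [hev', Filter.eventually_ge_atTop (sz p w)] with n hn hnw
  rw [← ho, T.mem_goodEvent hp] at hn
  obtain ⟨s, h1, h2, h3, h4⟩ := hn
  refine ⟨s, hvw.trans ?_, h2, h3, h4⟩
  rcases how.total h1 with h | h
  · exact h
  · have h5 := hp.isForest.sz_le h
    have h6 := le_minSize κ n
    have h7 : n < 4 ^ n := Nat.lt_pow_self (by norm_num)
    omega

end Unimodular

/-! ### Injectivity of the labels -/

theorem LFGraph.ae_injective (T : LFGraph) [Countable T.V] :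
    ∀ᵐ ℓ ∂T.iid, Function.Injective ℓ := by
  have : IsProbabilityMeasure T.iid := by
    rw [LFGraph.iid]
    infer_instance
  have key : ∀ v w : T.V, v ≠ w → ∀ᵐ ℓ ∂T.iid, ℓ v ≠ ℓ w := by
    intro v w hvw
    have h1 : ProbabilityTheory.IndepFun (fun ℓ : T.V → Lab => ℓ v) (fun ℓ => ℓ w) T.iid :=
      (ProbabilityTheory.iIndepFun_infinitePi (P := fun _ : T.V => (volume : Measure Lab))
        (X := fun _ x => x) fun _ => measurable_id).indepFun hvw
    rw [ProbabilityTheory.indepFun_iff_map_prod_eq_prod_map_map 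
      (measurable_pi_apply v).aemeasurable (measurable_pi_apply w).aemeasurable] at h1
    rw [LFGraph.iid, Measure.infinitePi_map_eval, Measure.infinitePi_map_eval] at h1
    have h2 : ((volume : Measure Lab).prod volume) (diagonal Lab) = 0 := by
      rw [Measure.measure_prod_null measurableSet_diagonal]
      filter_upwards with x
      have : Prod.mk x ⁻¹' diagonal Lab = {x} := by
        ext y
        simp [eq_comm]
      rw [this]
      simp
    rw [← h1, Measure.map_apply (by fun_prop) measurableSet_diagonal] at h2
    exact measure_eq_zero_iff_ae_notMem.1 h2
  have h := ae_all_iff.2 fun v => ae_all_iff.2 fun w => ae_all_iff.2 (key v w)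
  filter_upwards [h] with ℓ hℓ v w hvw
  by_contra hne
  exact hℓ v w hne hvw

theorem IsParentMap.countable {T : LFGraph} {p : T.V → T.V} (hp : IsParentMap T.graph p) :
    Countable T.V := by
  obtain ⟨o⟩ := T.connected.nonempty
  rw [← countable_univ_iff]
  refine (countable_iUnion fun k => (hp.finite (p^[k] o)).countable).mono fun v _ => ?_
  obtain ⟨w, ⟨k, rfl⟩, hv⟩ := hp.exists_common T.connected o v
  exact mem_iUnion.2 ⟨k, hv⟩

/-! ### Conclusion -/

theorem theorem5p1 (d : ℕ) (μ : Measure RootedGraphs) [IsProbabilityMeasure μ]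
    (hunimodular : IsUnimodular μ) (hergodic : IsErgodicGraph μ)
    (htree : AlmostSurely μ fun T => T.graph.IsTree)
    (hend : AlmostSurely μ fun T => T.OneEnded)
    (hdegree : AlmostSurely μ fun T => ∀ v, (T.graph.neighborSet v).encard ≤ d) :
    ∃ F : FiidGridTiling,
      AlmostSurely μ fun T => ∀ᵐ ℓ ∂T.iid, F.Represents T ℓ := by
  have hparent : AlmostSurely μ fun T => ∃ p, IsParentMap T.graph p := by
    filter_upwards [htree, hend] with g h1 h2 T o ho
    exact T.exists_parentMap (h1 T o ho) (h2 T o ho)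
  obtain ⟨κ, hκ, h⟩ := exists_scales hunimodular hparent hdegree
  refine ⟨rule κ, ?_⟩
  filter_upwards [h] with g hg T o ho
  obtain ⟨p, hp, hgood⟩ := hg T o ho
  have := hp.countable
  filter_upwards [T.ae_injective] with ℓ hℓ
  exact rule_represents hκ T hp hℓ hgood
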